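/- **Theorem 2.1.** Let $\lambda>0$ and let $a(x,t)$, $x\in[0,1]$, $t\in[0,1)$, be real-valued, continuous in $x$, and analytic in $t$ uniformly in $x$: for every $t_1\in[0,1)$ there are $r>0$, $C$ such that $a(x,t)=\sum_n a_n(x)(t-t_1)^n$ for all $x\in[0,1]$ and all $t\in[0,1)$ with $|t-t_1|<r$, where $|a_n(x)|\le Cr^{-n}$. Put $\Omega=\{0\le y\le x\le 1\}$. (a) There is exactly one function $k$ on $\Omega\times[0,1)$ that is $C^1$ in $(x,y)\in\Omega$ for each $t$, analytic in $t\in[0,1)$ uniformly in $(x,y)\in\Omega$, and satisfies, for $0<t<1$, $$k_{xx}-k_{yy}-k_t=(a(y,t)+\lambda)k\ \ (0<y<x<1),$$ $$k(x,0,t)=0,\qquad k_x(x,x,t)+k_y(x,x,t)+\tfrac{d}{dx}\bigl(k(x,x,t)\bigr)=a(x,t)+\lambda\ \ (0<x<1),$$ where $k_{xx}-k_{yy}$ is understood as $(\partial_x+\partial_y)(\partial_x-\partial_y)k$, the outer operator being the derivative in the direction $(1,1)$ (for $k\in C^2$ in $(x,y)$ the two agree). (b) With this $k$, consider $$u_t=u_{xx}+a(x,t)u,\qquad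 u(0,t)=0,\qquad u(x,0)=u^0(x)$$ for $0<x<1$, $t>0$, with either the Dirichlet feedback $$u(1,t)=-\int_0^1k(1,y,t)u(y,t)\,dy$$ or the Neumann feedback $$u_x(1,t)=-k(1,1,t)u(1,t)-\int_0^1k_x(1,y,t)u(y,t)\,dy .$$ Let $u^0\in H^1(0,1)$ satisfy $u^0(0)=0$ and, in the Dirichlet case, also $u^0(1)=-\int_0^1k(1,y,0)u^0(y)\,dy$. For $0<\tau\le1$, a solution on $[0,\tau)$ is a function $u\in C([0,\tau);H^1(0,1))$ with derivatives $u_t,u_{xx}$ continuous on $[0,1]\times(0,\tau)$ that satisfies the equation, the boundary conditions for $0<t<\tau$, and the initial condition pointwise. Then in each of the two cases: 1. there is a solution on $[0,1)$; 2. for every $\tau\in(0,1]$, the solution on $[0,\tau)$ is unique; 3. for every $t_0\in(0,1)$ there is a constant $M>0$, independent of $u^0$, such that every solution on $[0,t_0)$ satisfies $$\|u(\cdot,t)\|_{H^1}\le M\|u^0\|_{H^1}e^{-\lambda t},\qquad t\in(0,t_0).$$ -/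

import Mathlib

open Set Filter Topology MeasureTheory

noncomputable section

/-- `f p t` is analytic in `t ∈ J`, uniformly in the parameter `p ∈ S`: around each `t₁ ∈ J`
the functions `f p`, `p ∈ S`, are given on `J` by power series in `t - t₁` with a common radius
`r` and a common Cauchy bound `C / r ^ n` on their coefficients. -/
def UniformlyAnalyticOn {P : Type*} (f : P → ℝ → ℝ) (S : Set P) (J : Set ℝ) : Prop :=
  ∀ t₁ ∈ J, ∃ (r C : ℝ) (c : P → ℕ → ℝ), 0 < r ∧
    (∀ p ∈ S, ∀ n : ℕ, |c p n| * r ^ n ≤ C) ∧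
    ∀ p ∈ S, ∀ t ∈ J, |t - t₁| < r → HasSum (fun n : ℕ => c p n * (t - t₁) ^ n) (f p t)

/-- The closed triangle `0 ≤ y ≤ x ≤ 1`. -/
def triangle : Set (ℝ × ℝ) := {p | 0 ≤ p.2 ∧ p.2 ≤ p.1 ∧ p.1 ≤ 1}

/-- The partial derivative `k_x(x,y,t)` (one-sided on the boundary of the triangle). -/
def kernelDx (k : ℝ → ℝ → ℝ → ℝ) (x y t : ℝ) : ℝ :=
  fderivWithin ℝ (fun p : ℝ × ℝ => k p.1 p.2 t) triangle (x, y) (1, 0)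

/-- The partial derivative `k_y(x,y,t)` (one-sided on the boundary of the triangle). -/
def kernelDy (k : ℝ → ℝ → ℝ → ℝ) (x y t : ℝ) : ℝ :=
  fderivWithin ℝ (fun p : ℝ × ℝ => k p.1 p.2 t) triangle (x, y) (0, 1)

/-- `k` solves the kernel problem
`k_xx - k_yy - k_t = (a(y,t) + lam) k`, `k(x,0,t) = 0`,
`k_x(x,x,t) + k_y(x,x,t) + d/dx (k(x,x,t)) = a(x,t) + lam`
for `0 ≤ y ≤ x ≤ 1`, `0 < t < 1`, with `k` analytic in `t` uniformly in `(x,y)`.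

Since `a` is only continuous in `x`, a solution is in general `C¹` and not `C²` in `(x,y)`;
the wave operator `k_xx - k_yy` is therefore taken in its factored form
`(∂_x + ∂_y)(∂_x - ∂_y) k`, the outer factor being the derivative along the direction `(1,1)`.
For `C²` kernels this is literally `k_xx - k_yy`. -/
structure IsBacksteppingKernel (a : ℝ → ℝ → ℝ) (lam : ℝ) (k : ℝ → ℝ → ℝ → ℝ) : Prop where
  contDiff_space : ∀ t ∈ Ico (0 : ℝ) 1,
    ContDiffOn ℝ 1 (fun p : ℝ × ℝ => k p.1 p.2 t) triangle
  analytic_time : UniformlyAnalyticOn (fun (p : ℝ × ℝ) t => k p.1 p.2 t) triangle (Ico (0 : ℝ) 1)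
  equation : ∀ x y t : ℝ, 0 < y → y < x → x < 1 → t ∈ Ioo (0 : ℝ) 1 →
    HasDerivAt (fun s : ℝ => kernelDx k (x + s) (y + s) t - kernelDy k (x + s) (y + s) t)
      (deriv (fun s => k x y s) t + (a y t + lam) * k x y t) 0
  zero_edge : ∀ x ∈ Ioo (0 : ℝ) 1, ∀ t ∈ Ioo (0 : ℝ) 1, k x 0 t = 0
  diagonal : ∀ x ∈ Ioo (0 : ℝ) 1, ∀ t ∈ Ioo (0 : ℝ) 1,
    kernelDx k x x t + kernelDy k x x t + deriv (fun s => k s s t) x = a x t + lam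

/-- `f` is (the continuous representative of) a function in `H¹(0,1)`: absolutely continuous
on `[0,1]` with square integrable derivative. -/
def MemH1 (f : ℝ → ℝ) : Prop :=
  AbsolutelyContinuousOnInterval f 0 1 ∧
    MemLp (deriv f) 2 (volume.restrict (Ioo (0 : ℝ) 1))

/-- The norm of `H¹(0,1)`. -/
def normH1 (f : ℝ → ℝ) : ℝ :=
  Real.sqrt ((∫ x in (0 : ℝ)..1, f x ^ 2) + ∫ x in (0 : ℝ)..1, deriv f x ^ 2)

/-- The spatial derivative `u_x(x,t)`, one-sided at `x = 0` and `x = 1`. -/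
def spaceDeriv (u : ℝ → ℝ → ℝ) (x t : ℝ) : ℝ :=
  derivWithin (fun z => u z t) (Icc (0 : ℝ) 1) x

/-- The two ways of closing the loop at `x = 1`. -/
inductive Feedback : Type
  | dirichlet
  | neumann

/-- The feedback law at `x = 1` and time `t`. -/
def FeedbackLaw (k : ℝ → ℝ → ℝ → ℝ) (u : ℝ → ℝ → ℝ) (t : ℝ) : Feedback → Prop
  | .dirichlet => u 1 t = -∫ y in (0 : ℝ)..1, k 1 y t * u y t
  | .neumann => spaceDeriv u 1 t =
      -k 1 1 t * u 1 t - ∫ y in (0 : ℝ)..1, kernelDx k 1 y t * u y t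

/-- Compatibility of the initial data with the boundary conditions. For the Neumann feedback the
only trace condition that makes sense for a general `H¹` function is `u⁰(0) = 0`. -/
def Compatible (k : ℝ → ℝ → ℝ → ℝ) (u₀ : ℝ → ℝ) : Feedback → Prop
  | .dirichlet => u₀ 0 = 0 ∧ u₀ 1 = -∫ y in (0 : ℝ)..1, k 1 y 0 * u₀ y
  | .neumann => u₀ 0 = 0

/-- `u` is a solution on `[0,1] × [0,τ)` of `u_t = u_xx + a u`, `u(0,t) = 0`, the feedback law
`b` at `x = 1`, and `u(x,0) = u₀(x)`: it belongs to `C([0,τ); H¹(0,1))`, it has derivatives `u_t`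
and `u_xx` that are continuous on `[0,1] × (0,τ)`, and the equations hold pointwise. -/
structure IsSolution (a : ℝ → ℝ → ℝ) (k : ℝ → ℝ → ℝ → ℝ) (b : Feedback) (u₀ : ℝ → ℝ) (τ : ℝ)
    (u : ℝ → ℝ → ℝ) : Prop where
  memH1 : ∀ t ∈ Ico 0 τ, MemH1 (fun x => u x t)
  continuousH1 : ∀ s ∈ Ico 0 τ,
    Tendsto (fun t => normH1 (fun x => u x t - u x s)) (𝓝[Ico 0 τ] s) (𝓝 0)
  differentiable_time : ∀ x ∈ Icc (0 : ℝ) 1, ∀ t ∈ Ioo 0 τ, DifferentiableAt ℝ (fun s => u x s) t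
  contDiff_space : ∀ t ∈ Ioo 0 τ, ContDiffOn ℝ 2 (fun x => u x t) (Icc (0 : ℝ) 1)
  continuous_time_deriv :
    ContinuousOn (fun p : ℝ × ℝ => deriv (fun s => u p.1 s) p.2) (Icc (0 : ℝ) 1 ×ˢ Ioo 0 τ)
  continuous_space_deriv :
    ContinuousOn (fun p : ℝ × ℝ => spaceDeriv (spaceDeriv u) p.1 p.2) (Icc (0 : ℝ) 1 ×ˢ Ioo 0 τ)
  equation : ∀ x ∈ Ioo (0 : ℝ) 1, ∀ t ∈ Ioo 0 τ,
    deriv (fun s => u x s) t = spaceDeriv (spaceDeriv u) x t + a x t * u x t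
  left_boundary : ∀ t ∈ Ioo 0 τ, u 0 t = 0
  right_boundary : ∀ t ∈ Ioo 0 τ, FeedbackLaw k u t b
  initial : ∀ x ∈ Icc (0 : ℝ) 1, u x 0 = u₀ x

end

/-! The proof is by backstepping. Put w = (1 + K)u with (Ku)(x,t) = ∫₀ˣ k(x,y,t) u(y,t) dy. The wave
equation for k and its two edge conditions are what is needed for u_t = u_xx + a u to become w_t =
w_xx - λ w with w(0) = 0, and the two feedback laws become w(1) = 0 and w_x(1) = 0. At each time K
is a Volterra operator, so 1 + K is invertible and everything can be carried over to the damped heat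
equation and back.

Kernel. In the characteristic coordinates ξ = x + y, η = x - y the kernel problem is an integral
equation G = `diagOp` α + `waveOp` (G_t + αG) with α = a + λ. The time derivative on the right is
unbounded, and analyticity in t pays for it: after m passes the m-th iterate has used m time
derivatives, which costs (n+m)! in the Cauchy estimates, while the m-fold double integration gains
1/(m!)². This balance is `CharCauchyBound.step`; summed up, it gives existence (`exists_goursat`),
and run on a homogeneous solution it gives uniqueness (`eq_zero_of_waveOp_eq`). That any kernel in
the differential sense also satisfies the integral equation follows by integrating along
characteristics (`goursat_unique`, `diagonal_value`, `kernel_unique`).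

Regularity. As a is only continuous in x, k is C¹ and k_xx need not exist. Only the mixed derivative
G_ξη is available, and `hasDerivAt_deriv_integral_waveKernel_mul` differentiates Ku twice by putting
part of the derivative on u.

Closed loop. The unknown is P = u_x as a curve in C[0,1], with u the primitive of P, so that u(0) =
0 is built in. `ClosedLoop.heatLoop` and `HeatLoop.closedLoop` are the two directions of the
transformation. For w the energy ‖w_x‖² in L² decays like exp(-2λt) (`HeatLoop.hasDerivAt_energy`),
and it controls the H¹ norm because w(0) = 0. On [0,t₀] with t₀ < 1 the operators D (where Du =
(Ku)') and (1 + K)⁻¹ are bounded by compactness, which gives the constant M (`exists_decay`).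
Uniqueness is this estimate applied to the difference of two solutions, whose gradients tend to 0 in
L² as t → 0. Existence comes from expanding w_x in a complete orthogonal system of cosines and
applying (1 + K)⁻¹; the Dirichlet compatibility condition says that the constant mode is absent. -/

/-! ### Cauchy estimates and Taylor series for vector-valued analytic functions -/

section AnalyticTools

variable {E : Type*} [NormedAddCommGroup E] [NormedSpace ℝ E]

open scoped NNReal ENNReal in
/-- Locally uniform Cauchy estimates for the derivatives of an analytic function. -/
lemma AnalyticAt.exists_bound_iteratedDeriv [CompleteSpace E] {f : ℝ → E} {t₁ : ℝ}
    (hf : AnalyticAt ℝ f t₁) :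
    ∃ C R δ : ℝ, 0 ≤ C ∧ 0 ≤ R ∧ 0 < δ ∧ ∀ t, |t - t₁| < δ →
      AnalyticAt ℝ f t ∧ ∀ n : ℕ, ‖iteratedDeriv n f t‖ ≤ C * n.factorial * R ^ n := by
  obtain ⟨p, r, hp⟩ := hf
  -- Twice ρ must stay below the radius: one ρ for moving the centre, one for the radius of the
  -- re-expanded series. The total mass S of the double series then bounds all coefficients at all
  -- nearby centres at once.
  obtain ⟨ρ, hρ0, hρ⟩ : ∃ ρ : ℝ≥0, 0 < ρ ∧ (ρ : ℝ≥0∞) + ρ < r := by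
    obtain ⟨q, hq0, hq⟩ := ENNReal.lt_iff_exists_nnreal_btwn.1 hp.r_pos
    refine ⟨q / 2, ?_, ?_⟩
    · have : (0 : ℝ≥0) < q := by exact_mod_cast hq0
      positivity
    · rwa [← ENNReal.coe_add, add_halves]
  have hsum := p.changeOriginSeries_summable_aux₁ (hρ.trans_le hp.r_le)
  set S := ∑' s : Σ k l : ℕ, { s : Finset (Fin (k + l)) // s.card = l },
    ‖p (s.1 + s.2.1)‖₊ * ρ ^ s.2.1 * ρ ^ s.1 with hS
  refine ⟨S, (ρ : ℝ)⁻¹, ρ, S.2, by positivity, by exact_mod_cast hρ0, fun t ht => ?_⟩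
  set y := t - t₁ with hy
  have hyρ : ‖y‖₊ ≤ ρ := by
    rw [← NNReal.coe_le_coe, coe_nnnorm, Real.norm_eq_abs]; exact ht.le
  have hyr : (‖y‖₊ : ℝ≥0∞) < r :=
    lt_of_le_of_lt (by exact_mod_cast hyρ) (lt_of_le_of_lt le_self_add hρ)
  have hc := hp.changeOrigin hyr
  have hty : t₁ + y = t := by simp [hy]
  rw [hty] at hc
  refine ⟨hc.analyticAt, fun n => ?_⟩
  have h1 := hc.factorial_smul (1 : ℝ) n
  rw [iteratedDeriv_eq_iteratedFDeriv, ← h1]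
  have h2 : ‖p.changeOrigin y n‖₊ * ρ ^ n ≤ S := by
    have e1 := p.nnnorm_changeOrigin_le n (hyr.trans_le hp.r_le)
    have hs2 := p.changeOriginSeries_summable_aux₂ (hyr.trans_le hp.r_le) n
    have hs3 := (NNReal.summable_sigma.1 hsum).1 n
    calc ‖p.changeOrigin y n‖₊ * ρ ^ n
        ≤ (∑' s : Σ l : ℕ, { s : Finset (Fin (n + l)) // s.card = l },
            ‖p (n + s.1)‖₊ * ‖y‖₊ ^ s.1) * ρ ^ n := by gcongr
      _ = ∑' s : Σ l : ℕ, { s : Finset (Fin (n + l)) // s.card = l },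
            ‖p (n + s.1)‖₊ * ‖y‖₊ ^ s.1 * ρ ^ n := by rw [NNReal.tsum_mul_right]
      _ ≤ ∑' s : Σ l : ℕ, { s : Finset (Fin (n + l)) // s.card = l },
            ‖p (n + s.1)‖₊ * ρ ^ s.1 * ρ ^ n := by
          refine Summable.tsum_le_tsum (fun s => by gcongr) (hs2.mul_right _) hs3
      _ ≤ S := by
          rw [hS, hsum.tsum_sigma' (NNReal.summable_sigma.1 hsum).1]
          exact ((NNReal.summable_sigma.1 hsum).2).le_tsum n (fun _ _ => zero_le)
  have h3 : ‖p.changeOrigin y n‖ ≤ S * (ρ : ℝ)⁻¹ ^ n := by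
    have : ‖p.changeOrigin y n‖ * (ρ : ℝ) ^ n ≤ S := by exact_mod_cast h2
    rw [inv_pow, ← div_eq_mul_inv, le_div_iff₀ (by positivity)]
    exact this
  have h4 : ‖p.changeOrigin y n (fun _ => (1 : ℝ))‖ ≤ S * (ρ : ℝ)⁻¹ ^ n := by
    refine ((p.changeOrigin y n).le_opNorm _).trans ?_
    simpa using h3
  calc ‖n.factorial • p.changeOrigin y n (fun _ => (1 : ℝ))‖
      ≤ n.factorial * ‖p.changeOrigin y n (fun _ => (1 : ℝ))‖ := by
        rw [← Nat.cast_smul_eq_nsmul ℝ, norm_smul]; simp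
    _ ≤ n.factorial * (S * (ρ : ℝ)⁻¹ ^ n) := by gcongr
    _ = S * n.factorial * (ρ : ℝ)⁻¹ ^ n := by ring

/-- Taylor remainder estimate along a sequence of successive derivatives. -/
lemma norm_sub_sum_taylor_le {g : ℕ → ℝ → E} {t₁ δ : ℝ}
    (hg : ∀ n t, |t - t₁| < δ → HasDerivAt (g n) (g (n + 1) t) t)
    {h : ℝ} (hh : |h| < δ) (n : ℕ) : ∀ (k : ℕ) (B : ℝ), 
    (∀ t, |t - t₁| < δ → ‖g (k + n) t‖ ≤ B) → ∀ s ∈ Icc (0 : ℝ) 1,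
    ‖g k (t₁ + s * h) - ∑ j ∈ Finset.range n, ((s * h) ^ j / j.factorial) • g (k + j) t₁‖
      ≤ B * |h| ^ n * (s ^ n / n.factorial) := by
  have hmem : ∀ s ∈ Icc (0 : ℝ) 1, |t₁ + s * h - t₁| < δ := by
    intro s hs
    rw [add_sub_cancel_left, abs_mul, abs_of_nonneg hs.1]
    exact lt_of_le_of_lt (mul_le_of_le_one_left (abs_nonneg _) hs.2) hh
  induction n with
  | zero =>
    intro k B hB s hs
    simpa using hB _ (hmem s hs)
  | succ n ih =>
    intro k B hB
    have ih' := ih (k + 1) B (by simpa [add_assoc, add_comm 1 n] using hB)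
    -- Differentiating in s turns the remainder of order n + 1 for `g k` into h times the remainder
    -- of order n for `g (k + 1)`, which the induction hypothesis bounds; the boundary function
    -- below is the primitive of that bound.
    have hder : ∀ s ∈ Icc (0 : ℝ) 1, HasDerivAt (fun s : ℝ => g k (t₁ + s * h) -
        ∑ j ∈ Finset.range (n + 1), ((s * h) ^ j / j.factorial) • g (k + j) t₁)
        (h • (g (k + 1) (t₁ + s * h) -
          ∑ j ∈ Finset.range n, ((s * h) ^ j / j.factorial) • g (k + 1 + j) t₁)) s := by
      intro s hs
      have hlin : HasDerivAt (fun s : ℝ => t₁ + s * h) h s := by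
        simpa using ((hasDerivAt_id s).mul_const h).const_add t₁
      have h1 := (hg k _ (hmem s hs)).scomp s hlin
      have hlin' : HasDerivAt (fun s : ℝ => s * h) h s := by
        simpa using ((hasDerivAt_id s).mul_const h)
      have h2 : HasDerivAt (fun s : ℝ =>
          ∑ j ∈ Finset.range (n + 1), ((s * h) ^ j / j.factorial) • g (k + j) t₁)
          (∑ j ∈ Finset.range (n + 1), ((j * (s * h) ^ (j - 1) * h) / j.factorial) •
            g (k + j) t₁) s := by
        refine HasDerivAt.fun_sum fun j _ => ?_
        exact ((hlin'.pow j).div_const _).smul_const _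
      convert! h1.sub h2 using 1
      rw [smul_sub, Finset.sum_range_succ']
      simp only [Nat.cast_zero, zero_mul, zero_div, zero_smul, add_zero, Finset.smul_sum,
        Nat.add_sub_cancel, smul_smul]
      congr 1
      refine Finset.sum_congr rfl fun j _ => ?_
      rw [add_assoc k 1 j, add_comm 1 j, Nat.factorial_succ]
      congr 1
      push_cast
      have : (j.factorial : ℝ) ≠ 0 := by positivity
      field_simp
    intro s hs
    refine image_norm_le_of_norm_deriv_right_le_deriv_boundary
      (B := fun s => B * |h| ^ (n + 1) * (s ^ (n + 1) / (n + 1).factorial))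
      (B' := fun s => B * |h| ^ (n + 1) * (s ^ n / n.factorial))
      (fun s hs => (hder s hs).continuousAt.continuousWithinAt)
      (fun s hs => (hder s ⟨hs.1, hs.2.le⟩).hasDerivWithinAt) ?_ ?_ ?_ hs
    · have : g k t₁ - ∑ x ∈ Finset.range (n + 1), ((0 : ℝ) ^ x / (x.factorial : ℝ)) • g (k + x) t₁ = 0 := by
        rw [Finset.sum_range_succ']; simp
      simp [this]
    · intro s
      have := (((hasDerivAt_id s).pow (n + 1)).div_const ((n + 1).factorial : ℝ)).const_mul
        (B * |h| ^ (n + 1))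
      convert! this using 1
      rw [Nat.factorial_succ]
      have : (n.factorial : ℝ) ≠ 0 := by positivity
      have h' : ((n : ℝ) + 1) ≠ 0 := by positivity
      push_cast
      simp only [id]
      field_simp
    · intro s hs
      rw [norm_smul, Real.norm_eq_abs]
      calc |h| * _ ≤ |h| * (B * |h| ^ n * (s ^ n / n.factorial)) := by
            gcongr
            exact ih' s ⟨hs.1, hs.2.le⟩
        _ = B * |h| ^ (n + 1) * (s ^ n / n.factorial) := by ring

/-- A smooth function whose derivatives satisfy Cauchy estimates is the sum of its Taylor series. -/
lemma hasSum_taylor_of_bound [CompleteSpace E] {g : ℕ → ℝ → E} {t₁ δ C R : ℝ}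
    (hg : ∀ n t, |t - t₁| < δ → HasDerivAt (g n) (g (n + 1) t) t)
    (hb : ∀ n t, |t - t₁| < δ → ‖g n t‖ ≤ C * n.factorial * R ^ n)
    (hR : 0 ≤ R) {t : ℝ} (ht : |t - t₁| < δ) (htR : R * |t - t₁| < 1) :
    HasSum (fun n : ℕ => ((t - t₁) ^ n / n.factorial) • g n t₁) (g 0 t) := by
  have hδ : |t₁ - t₁| < δ := by simpa using (abs_nonneg _).trans_lt ht
  have hC : 0 ≤ C := by simpa using (norm_nonneg _).trans (hb 0 t₁ hδ)
  set q := R * |t - t₁| with hq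
  have hq0 : 0 ≤ q := by positivity
  have hterm : ∀ n : ℕ, ‖((t - t₁) ^ n / n.factorial) • g n t₁‖ ≤ C * q ^ n := by
    intro n
    have hf : (0 : ℝ) < n.factorial := by positivity
    rw [norm_smul, norm_div, norm_pow, Real.norm_eq_abs, Real.norm_of_nonneg hf.le]
    calc |t - t₁| ^ n / n.factorial * ‖g n t₁‖
        ≤ |t - t₁| ^ n / n.factorial * (C * n.factorial * R ^ n) := by gcongr; exact hb n t₁ hδ
      _ = C * q ^ n := by rw [hq, mul_pow]; field_simp
  have hsum : Summable fun n : ℕ => ((t - t₁) ^ n / n.factorial) • g n t₁ :=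
    Summable.of_norm_bounded ((summable_geometric_of_lt_one hq0 htR).mul_left C) hterm
  rw [hsum.hasSum_iff_tendsto_nat, tendsto_iff_norm_sub_tendsto_zero]
  have hlim : Tendsto (fun n : ℕ => C * q ^ n) atTop (𝓝 0) := by
    simpa using (tendsto_pow_atTop_nhds_zero_of_lt_one hq0 htR).const_mul C
  refine squeeze_zero (fun _ => norm_nonneg _) (fun n => ?_) hlim
  have h1 := norm_sub_sum_taylor_le hg ht n 0 (C * n.factorial * R ^ n)
    (fun s hs => by simpa using hb n s hs) 1 (by simp)
  rw [norm_sub_rev]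
  have hf : (0 : ℝ) < n.factorial := by positivity
  calc _ ≤ C * n.factorial * R ^ n * |t - t₁| ^ n * (1 ^ n / n.factorial) := by
        simpa using h1
    _ = C * q ^ n := by rw [hq, mul_pow, one_pow]; field_simp

end AnalyticTools

/-! ### Uniformly analytic families as analytic curves of continuous functions -/

/-- The Taylor coefficients of a uniformly analytic family of continuous functions are continuous. -/
lemma continuousOn_coeff_of_hasSum {P : Type*} [TopologicalSpace P] {S : Set P} {r C : ℝ}
    {c : P → ℕ → ℝ} {F : P → ℝ → ℝ} (hr : 0 < r) (hC : ∀ p ∈ S, ∀ n, |c p n| * r ^ n ≤ C)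
    (hF : ∀ h ∈ Ioo 0 r, ContinuousOn (fun p => F p h) S)
    (hsum : ∀ p ∈ S, ∀ h ∈ Ioo 0 r, HasSum (fun n => c p n * h ^ n) (F p h)) (n : ℕ) :
    ContinuousOn (fun p => c p n) S := by
  have key : ∀ (n : ℕ) (F : P → ℝ → ℝ), (∀ h ∈ Ioo 0 r, ContinuousOn (fun p => F p h) S) →
      (∀ p ∈ S, ∀ h ∈ Ioo 0 r, HasSum (fun j => c p (n + j) * h ^ j) (F p h)) →
      ContinuousOn (fun p => c p n) S := by
    intro n F hF hsum
    have hbound : ∀ p ∈ S, ∀ h ∈ Ioo 0 (r / 2), dist (c p n) (F p h) ≤ C / r ^ (n + 1) * 2 * h := by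
      intro p hp h hh
      have hh' : h ∈ Ioo 0 r := ⟨hh.1, by linarith [hh.2]⟩
      have h1 := (hasSum_nat_add_iff' 1).2 (hsum p hp h hh')
      simp only [Finset.range_one, Finset.sum_singleton, add_zero, pow_zero, mul_one] at h1
      have hq : h / r < 1 / 2 := by rw [div_lt_iff₀ hr]; linarith [hh.2]
      have hq0 : 0 ≤ h / r := div_nonneg hh.1.le hr.le
      have hC0 : 0 ≤ C := (by positivity : 0 ≤ |c p 0| * r ^ 0).trans (hC p hp 0)
      have h2 : HasSum (fun j : ℕ => C / r ^ (n + 1) * h * (h / r) ^ j)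
          (C / r ^ (n + 1) * h * (1 - h / r)⁻¹) :=
        (hasSum_geometric_of_lt_one hq0 (by linarith)).mul_left _
      have h3 : ‖F p h - c p n‖ ≤ C / r ^ (n + 1) * h * (1 - h / r)⁻¹ := by
        rw [← h1.tsum_eq]
        refine tsum_of_norm_bounded h2 fun j => ?_
        rw [norm_mul, norm_pow, Real.norm_eq_abs, Real.norm_of_nonneg hh.1.le]
        have := hC p hp (n + (j + 1))
        rw [← le_div_iff₀ (by positivity)] at this
        calc |c p (n + (j + 1))| * h ^ (j + 1) ≤ C / r ^ (n + (j + 1)) * h ^ (j + 1) := by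
              have := hh.1
              gcongr
          _ = C / r ^ (n + 1) * h * (h / r) ^ j := by
              rw [div_pow]; field_simp; ring
      rw [dist_comm, Real.dist_eq]
      refine h3.trans ?_
      have h4 : (1 - h / r)⁻¹ ≤ 2 := by
        rw [inv_le_comm₀ (by linarith) (by norm_num)]; linarith
      have : 0 ≤ C / r ^ (n + 1) * h := mul_nonneg (by positivity) hh.1.le
      calc _ ≤ C / r ^ (n + 1) * h * 2 := by gcongr
        _ = _ := by ring
    -- The lowest coefficient is a uniform limit of continuous functions as h → 0+. Only positive h
    -- is used, so the argument also works at the left end of the time interval.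
    have hunif : TendstoUniformlyOn (fun (h : ℝ) p => F p h) (fun p => c p n) (𝓝[>] 0) S := by
      rw [Metric.tendstoUniformlyOn_iff]
      intro ε hε
      have hlim : Tendsto (fun h : ℝ => C / r ^ (n + 1) * 2 * h) (𝓝[>] 0) (𝓝 0) := by
        have : Tendsto (fun h : ℝ => C / r ^ (n + 1) * 2 * h) (𝓝 0) (𝓝 (C / r ^ (n + 1) * 2 * 0)) :=
          (continuous_const.mul continuous_id).tendsto 0
        rw [mul_zero] at this
        exact this.mono_left nhdsWithin_le_nhds
      filter_upwards [hlim.eventually_lt_const hε, Ioo_mem_nhdsGT (half_pos hr)] with h h1 h2 p hp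
      exact (hbound p hp h h2).trans_lt h1
    refine hunif.continuousOn (Eventually.frequently ?_)
    filter_upwards [Ioo_mem_nhdsGT hr] with h hh using hF h hh
  -- Subtracting the lowest coefficient, already known to be continuous, and dividing by h shifts
  -- the series by one index and keeps the continuity in p.
  have key2 : ∀ n : ℕ, ∃ F : P → ℝ → ℝ, (∀ h ∈ Ioo 0 r, ContinuousOn (fun p => F p h) S) ∧
      (∀ p ∈ S, ∀ h ∈ Ioo 0 r, HasSum (fun j => c p (n + j) * h ^ j) (F p h)) := by
    intro n
    induction n with
    | zero => exact ⟨F, hF, by simpa using hsum⟩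
    | succ n ih =>
      obtain ⟨F, hF, hsum⟩ := ih
      have hc := key n F hF hsum
      refine ⟨fun p h => (F p h - c p n) / h, fun h hh => ((hF h hh).sub hc).div_const _, ?_⟩
      intro p hp h hh
      have h1 := ((hasSum_nat_add_iff' 1).2 (hsum p hp h hh)).div_const h
      simp only [Finset.range_one, Finset.sum_singleton, add_zero, pow_zero, mul_one] at h1
      convert! h1 using 2 with j
      have := hh.1.ne'
      rw [pow_succ, add_assoc, add_comm 1 j]
      field_simp
  obtain ⟨F, hF, hsum⟩ := key2 n
  exact key n F hF hsum

/-- A uniformly analytic family of continuous functions on a compact set, seen as an analytic curve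
in the space of continuous functions; the curve is extended a little beyond `t = 0`. -/
lemma UniformlyAnalyticOn.exists_analyticOnNhd {P : Type*} [TopologicalSpace P] {S : Set P}
    [CompactSpace S] {f : P → ℝ → ℝ} (hf : UniformlyAnalyticOn f S (Ico 0 1))
    (hc : ∀ t ∈ Ico (0 : ℝ) 1, ContinuousOn (fun p => f p t) S) :
    ∃ (ε : ℝ) (A : ℝ → C(S, ℝ)), 0 < ε ∧ AnalyticOnNhd ℝ A (Ioo (-ε) 1) ∧
      ∀ t ∈ Ico (0 : ℝ) 1, ∀ p : S, A t p = f p t := by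
  have hloc : ∀ t₁ ∈ Ico (0 : ℝ) 1, ∃ (r : ℝ) (c : ℕ → C(S, ℝ)), 0 < r ∧
      (∀ h, |h| < r → Summable fun n => h ^ n • c n) ∧
      ∀ t ∈ Ico (0 : ℝ) 1, |t - t₁| < r → ∀ p : S, (∑' n, (t - t₁) ^ n • c n) p = f p t := by
    intro t₁ ht₁
    obtain ⟨r, C, c, hr, hC, hs⟩ := hf t₁ ht₁
    set r' := min r (1 - t₁) with hr'
    have hr'0 : 0 < r' := lt_min hr (by linarith [ht₁.2])
    have hcont : ∀ n, ContinuousOn (fun p => c p n) S := by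
      refine continuousOn_coeff_of_hasSum (F := fun p h => f p (t₁ + h)) hr'0 (C := C) ?_ ?_ ?_
      · intro p hp n
        refine le_trans ?_ (hC p hp n)
        gcongr
        exact min_le_left _ _
      · intro h hh
        exact hc _ ⟨by linarith [ht₁.1, hh.1], by linarith [hh.2, min_le_right r (1 - t₁)]⟩
      · intro p hp h hh
        have := hs p hp (t₁ + h) ⟨by linarith [ht₁.1, hh.1],
          by linarith [hh.2, min_le_right r (1 - t₁)]⟩
          (by rw [add_sub_cancel_left, abs_of_pos hh.1]; exact hh.2.trans_le (min_le_left _ _))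
        simpa using this
    have hsumm : ∀ h, |h| < r → Summable fun n => h ^ n • 
        (⟨S.domRestrict fun p => c p n, (hcont n).domRestrict⟩ : C(S, ℝ)) := by
      intro h hh
      have hq : |h| / r < 1 := by rwa [div_lt_one hr]
      refine Summable.of_norm_bounded (g := fun n => |C| * (|h| / r) ^ n)
        ((summable_geometric_of_lt_one (by positivity) hq).mul_left _) fun n => ?_
      rw [ContinuousMap.norm_le _ (by positivity)]
      intro p
      have := (hC p p.2 n).trans (le_abs_self C)
      rw [← le_div_iff₀ (by positivity)] at this
      simp only [ContinuousMap.smul_apply, smul_eq_mul,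
        norm_mul, norm_pow, Real.norm_eq_abs]
      calc |h| ^ n * |c p n| ≤ |h| ^ n * (|C| / r ^ n) := by gcongr
        _ = |C| * (|h| / r) ^ n := by rw [div_pow]; ring
    refine ⟨r, _, hr, hsumm, fun t ht htr p => ?_⟩
    have h1 := ContinuousMap.hasSum_apply (hsumm _ htr).hasSum p
    refine h1.unique ((hs p p.2 t ht htr).congr_fun ?_)
    intro n
    exact mul_comm _ _
  choose! r c hr hsumm heq using hloc
  classical
  -- For t < 0 the curve is the power series centred at 0, so that t = 0 becomes an interior point
  -- of the domain of analyticity.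
  set A : ℝ → C(S, ℝ) := fun t => if ht : t ∈ Ico (0 : ℝ) 1 then
    ⟨S.domRestrict fun p => f p t, (hc t ht).domRestrict⟩ else ∑' n, t ^ n • c 0 n with hA
  have hAt : ∀ t ∈ Ico (0 : ℝ) 1, ∀ p : S, A t p = f p t := by
    intro t ht p
    simp only [hA, dif_pos ht]
    rfl
  have h0 : (0 : ℝ) ∈ Ico (0 : ℝ) 1 := by simp
  have hana : ∀ t₁ ∈ Ico (0 : ℝ) 1, AnalyticAt ℝ A t₁ := by
    intro t₁ ht₁
    let p : FormalMultilinearSeries ℝ ℝ C(S, ℝ) :=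
      fun n => ContinuousMultilinearMap.mkPiRing ℝ (Fin n) (c t₁ n)
    refine HasFPowerSeriesAt.analyticAt (p := p) (hasFPowerSeriesAt_iff.2 ?_)
    have e1 : ∀ᶠ z : ℝ in 𝓝 0, |z| < min (r t₁) (1 - t₁) := by
      have : Tendsto (fun z : ℝ => |z|) (𝓝 0) (𝓝 0) := by
        simpa using (continuous_abs (G := ℝ)).tendsto 0
      exact this.eventually_lt_const (lt_min (hr t₁ ht₁) (by linarith [ht₁.2]))
    -- Negative times have to be considered only when the centre is 0, and there the extension is
    -- the expansion itself.
    have e2 : ∀ᶠ z : ℝ in 𝓝 0, t₁ = 0 ∨ 0 < t₁ + z := by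
      rcases ht₁.1.eq_or_lt with h | h
      · exact Eventually.of_forall fun _ => Or.inl h.symm
      · filter_upwards [Ioi_mem_nhds (show -t₁ < (0 : ℝ) by linarith)] with z hz
        exact Or.inr (by linarith [mem_Ioi.1 hz])
    filter_upwards [e1, e2] with z hz hz2
    have hs := hsumm t₁ ht₁ z (hz.trans_le (min_le_left _ _))
    have : A (t₁ + z) = ∑' n, z ^ n • c t₁ n := by
      have hlt : t₁ + z < 1 := by
        linarith [le_abs_self z, hz.trans_le (min_le_right (r t₁) (1 - t₁))]
      by_cases hmem : t₁ + z ∈ Ico (0 : ℝ) 1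
      · ext p
        rw [hAt _ hmem]
        have := heq t₁ ht₁ (t₁ + z) hmem (by simpa using hz.trans_le (min_le_left _ _)) p
        rw [add_sub_cancel_left] at this
        exact this.symm
      · have ht0 : t₁ = 0 := by
          rcases hz2 with h | h
          · exact h
          · exact absurd ⟨h.le, hlt⟩ hmem
        subst ht0
        rw [hA]
        simp only
        rw [dif_neg hmem, zero_add]
    rw [this]
    convert! hs.hasSum using 2 with n
    simp [FormalMultilinearSeries.coeff, p]
  obtain ⟨ε, hε, hε'⟩ := Metric.eventually_nhds_iff.1 (hana 0 h0).eventually_analyticAt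
  refine ⟨ε, A, hε, fun t ht => ?_, hAt⟩
  by_cases h : 0 ≤ t
  · exact hana t ⟨h, ht.2⟩
  · push Not at h
    exact hε' (by rw [Real.dist_eq, sub_zero, abs_of_neg h]; linarith [ht.1])

/-! ### Integrals depending on a parameter and on their limits -/

section ParametricIntegrals

lemma continuous_integral_param {X : Type*} [TopologicalSpace X] [FirstCountableTopology X]
    {f : X → ℝ → ℝ} (hf : Continuous (Function.uncurry f)) {u v : X → ℝ} (hu : Continuous u)
    (hv : Continuous v) : Continuous fun x => ∫ y in (u x)..(v x), f x y := by
  have hi : ∀ x a b, IntervalIntegrable (f x) volume a b := fun x a b =>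
    (hf.comp (Continuous.prodMk_right x)).intervalIntegrable a b
  have h : ∀ x, ∫ y in (u x)..(v x), f x y = (∫ y in (0 : ℝ)..(v x), f x y) -
      ∫ y in (0 : ℝ)..(u x), f x y := fun x =>
    (intervalIntegral.integral_interval_sub_left (hi _ _ _) (hi _ _ _)).symm
  simp_rw [h]
  exact (intervalIntegral.continuous_parametric_intervalIntegral_of_continuous hf hv).sub
    (intervalIntegral.continuous_parametric_intervalIntegral_of_continuous hf hu)

/-- Differentiation under the integral sign for jointly continuous data. -/
lemma hasDerivAt_integral_param {f f' : ℝ → ℝ → ℝ} (hf : Continuous (Function.uncurry f))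
    (hf' : Continuous (Function.uncurry f')) (hd : ∀ x y, HasDerivAt (fun x => f x y) (f' x y) x)
    (a b x : ℝ) : HasDerivAt (fun x => ∫ y in a..b, f x y) (∫ y in a..b, f' x y) x := by
  obtain ⟨C, hC⟩ := (isCompact_Icc.prod isCompact_uIcc :
    IsCompact (Icc (x - 1) (x + 1) ×ˢ uIcc a b)).exists_bound_of_continuousOn hf'.continuousOn
  have hsec : ∀ x, Continuous (f x) := fun x => hf.comp (Continuous.prodMk_right x)
  have hsec' : ∀ x, Continuous (f' x) := fun x => hf'.comp (Continuous.prodMk_right x)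
  refine (intervalIntegral.hasDerivAt_integral_of_dominated_loc_of_deriv_le (F := f) (F' := f')
    (bound := fun _ => C) (Icc_mem_nhds (show x - 1 < x by linarith) (show x < x + 1 by linarith))
    (Eventually.of_forall fun x => (hsec x).aestronglyMeasurable)
    ((hsec x).intervalIntegrable _ _) (hsec' x).aestronglyMeasurable ?_
    intervalIntegrable_const ?_).2
  · exact ae_of_all _ fun y hy z hz => hC (z, y) ⟨hz, uIoc_subset_uIcc hy⟩
  · exact ae_of_all _ fun y _ z _ => hd z y

/-- The Leibniz rule for an integral with variable upper limit. -/
lemma hasDerivAt_integral_param_limit {f f' : ℝ → ℝ → ℝ} (hf : Continuous (Function.uncurry f))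
    (hf' : Continuous (Function.uncurry f')) (hd : ∀ x y, HasDerivAt (fun x => f x y) (f' x y) x)
    (a : ℝ) {u : ℝ → ℝ} {u' x : ℝ} (hu : HasDerivAt u u' x) :
    HasDerivAt (fun x => ∫ y in a..(u x), f x y) (u' * f x (u x) + ∫ y in a..(u x), f' x y) x := by
  have hsec : ∀ x, Continuous (f x) := fun x => hf.comp (Continuous.prodMk_right x)
  -- The parameter and the upper limit are treated as independent variables; continuous partial
  -- derivatives give a total derivative, which is then composed with x ↦ (x, u x).
  have h := hasStrictFDerivAt_uncurry_coprod (𝕜 := ℝ) (u := (x, u x))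
    (f := fun x z => ∫ y in a..z, f x y)
    (f₁ := fun x z => ContinuousLinearMap.toSpanSingleton ℝ (∫ y in a..z, f' x y))
    (f₂ := fun x z => ContinuousLinearMap.toSpanSingleton ℝ (f x z))
    (Eventually.of_forall fun v => (hasDerivAt_integral_param hf hf' hd a v.2 v.1).hasFDerivAt)
    (Eventually.of_forall fun v =>
      (((hsec v.1).integral_hasStrictDerivAt a v.2).hasDerivAt).hasFDerivAt)
    (Continuous.continuousAt ?_) (Continuous.continuousAt ?_)
  · have h2 := h.hasFDerivAt.comp_hasDerivAt x ((hasDerivAt_id x).prodMk hu)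
    convert! h2 using 1
    simp [Function.HasUncurry.uncurry, ContinuousLinearMap.toSpanSingleton_apply]
    ring
  · refine (ContinuousLinearMap.toSpanSingletonCLE (𝕜 := ℝ) (E := ℝ)).continuous.comp ?_
    exact continuous_integral_param (f := fun (v : ℝ × ℝ) y => f' v.1 y)
      (hf'.comp ((continuous_fst.comp continuous_fst).prodMk continuous_snd)) continuous_const
      continuous_snd
  · exact (ContinuousLinearMap.toSpanSingletonCLE (𝕜 := ℝ) (E := ℝ)).continuous.comp hf

end ParametricIntegrals

/-! ### The Goursat kernel and derivatives of its Volterra integral -/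

noncomputable section CharacteristicKernel

/-- The solution of `4 G_ξη = F` in characteristic coordinates with `G(ξ,ξ) = 0` and
`G(ξ,0) = ½ ∫₀^{ξ/2} α`. -/
def charKernel (α : ℝ → ℝ) (F : ℝ → ℝ → ℝ) (ξ η : ℝ) : ℝ :=
  (1 / 2) * (∫ s in (η / 2)..(ξ / 2), α s) +
    (1 / 4) * ∫ τ in η..ξ, ∫ s in (0 : ℝ)..η, F τ s

def charKernelXi (α : ℝ → ℝ) (F : ℝ → ℝ → ℝ) (ξ η : ℝ) : ℝ :=
  (1 / 4) * α (ξ / 2) + (1 / 4) * ∫ s in (0 : ℝ)..η, F ξ s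

def charKernelEta (α : ℝ → ℝ) (F : ℝ → ℝ → ℝ) (ξ η : ℝ) : ℝ :=
  -(1 / 4) * α (η / 2) + (1 / 4) * ((∫ τ in η..ξ, F τ η) - ∫ s in (0 : ℝ)..η, F η s)

variable {α : ℝ → ℝ} {F : ℝ → ℝ → ℝ}

lemma charKernel_self (ξ : ℝ) : charKernel α F ξ ξ = 0 := by simp [charKernel]

lemma charKernel_zero (ξ : ℝ) : charKernel α F ξ 0 = (1 / 2) * ∫ s in (0 : ℝ)..(ξ / 2), α s := by
  simp [charKernel]

lemma continuous_charKernelXi (hα : Continuous α) (hF : Continuous (Function.uncurry F)) :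
    Continuous fun p : ℝ × ℝ => charKernelXi α F p.1 p.2 := by
  refine ((hα.comp (continuous_fst.div_const 2)).const_mul _).add (Continuous.const_mul ?_ _)
  exact continuous_integral_param (f := fun (p : ℝ × ℝ) s => F p.1 s)
    (hF.comp ((continuous_fst.comp continuous_fst).prodMk continuous_snd)) continuous_const
    continuous_snd

lemma continuous_charKernelEta (hα : Continuous α) (hF : Continuous (Function.uncurry F)) :
    Continuous fun p : ℝ × ℝ => charKernelEta α F p.1 p.2 := by
  refine ((hα.comp (continuous_snd.div_const 2)).const_mul _).add
    (Continuous.const_mul (Continuous.sub ?_ ?_) _)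
  · exact continuous_integral_param (f := fun (p : ℝ × ℝ) s => F s p.2)
      (hF.comp (continuous_snd.prodMk (continuous_snd.comp continuous_fst))) continuous_snd
      continuous_fst
  · exact continuous_integral_param (f := fun (p : ℝ × ℝ) s => F p.2 s)
      (hF.comp ((continuous_snd.comp continuous_fst).prodMk continuous_snd)) continuous_const
      continuous_snd

lemma hasDerivAt_charKernel_fst (hα : Continuous α) (hF : Continuous (Function.uncurry F))
    (ξ η : ℝ) : HasDerivAt (fun ξ => charKernel α F ξ η) (charKernelXi α F ξ η) ξ := by
  have h1 : HasDerivAt (fun ξ => ∫ s in (η / 2)..(ξ / 2), α s) (α (ξ / 2) * (1 / 2)) ξ :=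
    HasDerivAt.comp ξ (hα.integral_hasStrictDerivAt _ _).hasDerivAt ((hasDerivAt_id ξ).div_const 2)
  have hc : Continuous fun τ => ∫ s in (0 : ℝ)..η, F τ s :=
    continuous_integral_param hF continuous_const continuous_const
  have h2 := (hc.integral_hasStrictDerivAt η ξ).hasDerivAt
  convert! (h1.const_mul (1 / 2)).add (h2.const_mul (1 / 4)) using 1
  simp only [charKernelXi]; ring

lemma hasDerivAt_charKernel_snd (hα : Continuous α) (hF : Continuous (Function.uncurry F))
    (ξ η : ℝ) : HasDerivAt (fun η => charKernel α F ξ η) (charKernelEta α F ξ η) η := by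
  have h1 : HasDerivAt (fun η => ∫ s in (ξ / 2)..(η / 2), α s) (α (η / 2) * (1 / 2)) η :=
    HasDerivAt.comp η (hα.integral_hasStrictDerivAt _ _).hasDerivAt ((hasDerivAt_id η).div_const 2)
  have hc : Continuous (Function.uncurry fun η τ => ∫ s in (0 : ℝ)..η, F τ s) :=
    continuous_integral_param (f := fun (p : ℝ × ℝ) s => F p.2 s)
      (hF.comp ((continuous_snd.comp continuous_fst).prodMk continuous_snd)) continuous_const
      continuous_fst
  have h2 := hasDerivAt_integral_param_limit (f' := fun η τ => F τ η) hc
    (hF.comp (continuous_snd.prodMk continuous_fst))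
    (fun η τ => ((hF.comp (Continuous.prodMk_right τ)).integral_hasStrictDerivAt 0 η).hasDerivAt) 
    ξ (hasDerivAt_id η)
  have h3 := (h1.const_mul (-(1 / 2))).add (h2.const_mul (-(1 / 4)))
  have e : (fun η => charKernel α F ξ η) = (fun η => -(1 / 2) * ∫ s in (ξ / 2)..(η / 2), α s) +
      fun η => -(1 / 4) * ∫ τ in ξ..(id η), ∫ s in (0 : ℝ)..η, F τ s := by
    funext η
    simp only [charKernel, Pi.add_apply, id]
    rw [intervalIntegral.integral_symm (ξ / 2), intervalIntegral.integral_symm ξ]; ring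
  rw [e]
  convert! h3 using 1
  simp only [charKernelEta, id]
  rw [intervalIntegral.integral_symm ξ]; ring

/-- The second derivative on which everything rests. Both first derivatives contain the merely
continuous α, but in the η-derivative it is evaluated at η / 2 and is constant in ξ. -/
lemma hasDerivAt_charKernelEta_fst (hF : Continuous (Function.uncurry F))
    (ξ η : ℝ) : HasDerivAt (fun ξ => charKernelEta α F ξ η) ((1 / 4) * F ξ η) ξ := by
  have hc : Continuous fun τ => F τ η := hF.comp (Continuous.prodMk_left η)
  exact (((hc.integral_hasStrictDerivAt η ξ).hasDerivAt.sub_const _).const_mul _).const_add _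

lemma hasStrictFDerivAt_charKernel (hα : Continuous α) (hF : Continuous (Function.uncurry F))
    (p : ℝ × ℝ) : HasStrictFDerivAt (fun p : ℝ × ℝ => charKernel α F p.1 p.2)
      ((ContinuousLinearMap.toSpanSingleton ℝ (charKernelXi α F p.1 p.2)).coprod
        (ContinuousLinearMap.toSpanSingleton ℝ (charKernelEta α F p.1 p.2))) p :=
  hasStrictFDerivAt_uncurry_coprod (𝕜 := ℝ) (u := p) (f := charKernel α F)
    (f₁ := fun ξ η => ContinuousLinearMap.toSpanSingleton ℝ (charKernelXi α F ξ η))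
    (f₂ := fun ξ η => ContinuousLinearMap.toSpanSingleton ℝ (charKernelEta α F ξ η))
    (Eventually.of_forall fun v => (hasDerivAt_charKernel_fst hα hF v.1 v.2).hasFDerivAt)
    (Eventually.of_forall fun v => (hasDerivAt_charKernel_snd hα hF v.1 v.2).hasFDerivAt)
    ((ContinuousLinearMap.toSpanSingletonCLE (𝕜 := ℝ) (E := ℝ)).continuous.comp
      (continuous_charKernelXi hα hF)).continuousAt
    ((ContinuousLinearMap.toSpanSingletonCLE (𝕜 := ℝ) (E := ℝ)).continuous.comp
      (continuous_charKernelEta hα hF)).continuousAt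

/-- The kernel `charKernel` in the coordinates `x = (ξ + η) / 2`, `y = (ξ - η) / 2`. -/
def waveKernel (α : ℝ → ℝ) (F : ℝ → ℝ → ℝ) (x y : ℝ) : ℝ := charKernel α F (x + y) (x - y)

def waveKernelDx (α : ℝ → ℝ) (F : ℝ → ℝ → ℝ) (x y : ℝ) : ℝ :=
  charKernelXi α F (x + y) (x - y) + charKernelEta α F (x + y) (x - y)

def waveKernelDy (α : ℝ → ℝ) (F : ℝ → ℝ → ℝ) (x y : ℝ) : ℝ :=
  charKernelXi α F (x + y) (x - y) - charKernelEta α F (x + y) (x - y)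

lemma continuous_waveKernelDx (hα : Continuous α) (hF : Continuous (Function.uncurry F)) :
    Continuous fun p : ℝ × ℝ => waveKernelDx α F p.1 p.2 :=
  ((continuous_charKernelXi hα hF).comp (g := fun p : ℝ × ℝ => charKernelXi α F p.1 p.2)
    (f := fun p : ℝ × ℝ => (p.1 + p.2, p.1 - p.2)) (by fun_prop)).add
  ((continuous_charKernelEta hα hF).comp (g := fun p : ℝ × ℝ => charKernelEta α F p.1 p.2)
    (f := fun p : ℝ × ℝ => (p.1 + p.2, p.1 - p.2)) (by fun_prop))

lemma continuous_waveKernelDy (hα : Continuous α) (hF : Continuous (Function.uncurry F)) :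
    Continuous fun p : ℝ × ℝ => waveKernelDy α F p.1 p.2 :=
  ((continuous_charKernelXi hα hF).comp (g := fun p : ℝ × ℝ => charKernelXi α F p.1 p.2)
    (f := fun p : ℝ × ℝ => (p.1 + p.2, p.1 - p.2)) (by fun_prop)).sub
  ((continuous_charKernelEta hα hF).comp (g := fun p : ℝ × ℝ => charKernelEta α F p.1 p.2)
    (f := fun p : ℝ × ℝ => (p.1 + p.2, p.1 - p.2)) (by fun_prop))

lemma hasFDerivAt_waveKernel (hα : Continuous α) (hF : Continuous (Function.uncurry F))
    (p : ℝ × ℝ) : HasFDerivAt (fun p : ℝ × ℝ => waveKernel α F p.1 p.2)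
      ((ContinuousLinearMap.toSpanSingleton ℝ (waveKernelDx α F p.1 p.2)).coprod
        (ContinuousLinearMap.toSpanSingleton ℝ (waveKernelDy α F p.1 p.2))) p := by
  have h := (hasStrictFDerivAt_charKernel hα hF (p.1 + p.2, p.1 - p.2)).hasFDerivAt
  have h2 : HasFDerivAt (fun p : ℝ × ℝ => (p.1 + p.2, p.1 - p.2))
      (((ContinuousLinearMap.fst ℝ ℝ ℝ) + (ContinuousLinearMap.snd ℝ ℝ ℝ)).prod
        ((ContinuousLinearMap.fst ℝ ℝ ℝ) - (ContinuousLinearMap.snd ℝ ℝ ℝ))) p :=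
    (hasFDerivAt_fst.add hasFDerivAt_snd).prodMk (hasFDerivAt_fst.sub hasFDerivAt_snd)
  refine (h.comp p h2).congr_fderiv ?_
  ext <;> simp [waveKernelDx, waveKernelDy, ContinuousLinearMap.toSpanSingleton_apply]
  ring

lemma continuous_waveKernel (hα : Continuous α) (hF : Continuous (Function.uncurry F)) :
    Continuous fun p : ℝ × ℝ => waveKernel α F p.1 p.2 :=
  continuous_iff_continuousAt.2 fun p => (hasFDerivAt_waveKernel hα hF p).continuousAt

lemma hasDerivAt_waveKernel_fst (hα : Continuous α) (hF : Continuous (Function.uncurry F))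
    (x y : ℝ) : HasDerivAt (fun x => waveKernel α F x y) (waveKernelDx α F x y) x := by
  have h := (hasFDerivAt_waveKernel hα hF (x, y)).comp_hasDerivAt x
    ((hasDerivAt_id x).prodMk (hasDerivAt_const x y))
  convert! h using 1
  simp [ContinuousLinearMap.toSpanSingleton_apply]

lemma hasDerivAt_waveKernel_snd (hα : Continuous α) (hF : Continuous (Function.uncurry F))
    (x y : ℝ) : HasDerivAt (fun y => waveKernel α F x y) (waveKernelDy α F x y) y := by
  have h := (hasFDerivAt_waveKernel hα hF (x, y)).comp_hasDerivAt y
    ((hasDerivAt_const y x).prodMk (hasDerivAt_id y))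
  convert! h using 1
  simp [ContinuousLinearMap.toSpanSingleton_apply]

lemma contDiff_waveKernel (hα : Continuous α) (hF : Continuous (Function.uncurry F)) :
    ContDiff ℝ 1 fun p : ℝ × ℝ => waveKernel α F p.1 p.2 := by
  have h : ∀ p : ℝ × ℝ, HasFDerivAt (fun p : ℝ × ℝ => waveKernel α F p.1 p.2)
      (waveKernelDx α F p.1 p.2 • ContinuousLinearMap.fst ℝ ℝ ℝ +
        waveKernelDy α F p.1 p.2 • ContinuousLinearMap.snd ℝ ℝ ℝ) p := by
    intro p
    refine (hasFDerivAt_waveKernel hα hF p).congr_fderiv ?_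
    ext <;> simp
  exact contDiff_one_iff_hasFDerivAt.2 ⟨_, ((continuous_waveKernelDx hα hF).smul
    continuous_const).add ((continuous_waveKernelDy hα hF).smul continuous_const), h⟩

lemma waveKernel_zero (x : ℝ) : waveKernel α F x 0 = 0 := by
  simp [waveKernel, charKernel_self]

lemma waveKernel_self (x : ℝ) : waveKernel α F x x = (1 / 2) * ∫ s in (0 : ℝ)..x, α s := by
  simp [waveKernel, charKernel_zero]

/-- Derivative of the Volterra integral of a `C¹` function. -/
lemma hasDerivAt_integral_waveKernel_mul (hα : Continuous α) (hF : Continuous (Function.uncurry F))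
    {v : ℝ → ℝ} (hv : Continuous v) (x : ℝ) :
    HasDerivAt (fun x => ∫ y in (0 : ℝ)..x, waveKernel α F x y * v y)
      (waveKernel α F x x * v x + ∫ y in (0 : ℝ)..x, waveKernelDx α F x y * v y) x := by
  have h := hasDerivAt_integral_param_limit (f := fun x y => waveKernel α F x y * v y)
    (f' := fun x y => waveKernelDx α F x y * v y)
    ((continuous_waveKernel hα hF).mul (hv.comp continuous_snd))
    ((continuous_waveKernelDx hα hF).mul (hv.comp continuous_snd))
    (fun x y => (hasDerivAt_waveKernel_fst hα hF x y).mul_const _) 0 (hasDerivAt_id x)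
  simpa using h

/-- Second derivative of the Volterra integral. Only the mixed derivative of the kernel in
characteristic coordinates is available, so part of the derivative falls on `v`. -/
lemma hasDerivAt_deriv_integral_waveKernel_mul (hα : Continuous α)
    (hF : Continuous (Function.uncurry F)) {v p : ℝ → ℝ} (hv : ∀ x, HasDerivAt v (p x) x)
    (hp : Continuous p) (hv0 : v 0 = 0) (x : ℝ) :
    HasDerivAt (fun x => waveKernel α F x x * v x + ∫ y in (0 : ℝ)..x, waveKernelDx α F x y * v y)
      (α x * v x + (waveKernel α F x x * p x - ∫ y in (0 : ℝ)..x, waveKernelDy α F x y * p y) +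
        ∫ y in (0 : ℝ)..x, F (x + y) (x - y) * v y) x := by
  have hvc : Continuous v := continuous_iff_continuousAt.2 fun x => (hv x).continuousAt
  have hKx := continuous_waveKernelDx hα hF
  have hKy := continuous_waveKernelDy hα hF
  have hEta := continuous_charKernelEta hα hF
  have hsec : ∀ {g : ℝ → ℝ → ℝ}, Continuous (fun p : ℝ × ℝ => g p.1 p.2) → ∀ x, Continuous (g x) :=
    fun hg x => hg.comp (Continuous.prodMk_right x)
  have hint : ∀ {g : ℝ → ℝ → ℝ}, Continuous (fun p : ℝ × ℝ => g p.1 p.2) → ∀ {w : ℝ → ℝ},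
      Continuous w → ∀ x a b, IntervalIntegrable (fun y => g x y * w y) volume a b :=
    fun hg w hw x a b => ((hsec hg x).mul hw).intervalIntegrable a b
  -- integrate by parts in the `y`-derivative of the kernel
  have hparts : ∀ x, ∫ y in (0 : ℝ)..x, waveKernelDy α F x y * v y =
      waveKernel α F x x * v x - ∫ y in (0 : ℝ)..x, waveKernel α F x y * p y := by
    intro x
    have h := intervalIntegral.integral_deriv_mul_eq_sub (a := 0) (b := x)
      (fun y _ => hasDerivAt_waveKernel_snd hα hF x y) (fun y _ => hv y)
      ((hsec hKy x).intervalIntegrable _ _) (hp.intervalIntegrable _ _)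
    rw [intervalIntegral.integral_add (hint hKy hvc x 0 x)
      (hint (continuous_waveKernel hα hF) hp x 0 x), waveKernel_zero, hv0] at h
    linarith
  -- The substitution s = x - y freezes the second characteristic variable: x now enters the kernel
  -- only through ξ = 2x - s, the variable in which `charKernelEta` is differentiable.
  have hsub : ∀ x (g : ℝ → ℝ → ℝ) (w : ℝ → ℝ), ∫ y in (0 : ℝ)..x, g (x + y) (x - y) * w y =
      ∫ s in (0 : ℝ)..x, g (2 * x - s) s * w (x - s) := by
    intro x g w
    have h := intervalIntegral.integral_comp_sub_left (a := 0) (b := x)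
      (fun y => g (x + y) (x - y) * w y) x
    simp only [sub_zero, sub_self] at h
    rw [← h]
    refine intervalIntegral.integral_congr fun s _ => ?_
    simp only [sub_sub_cancel]
    congr 2
    ring
  -- Write k_x = 2 G_η + k_y and move the k_y part onto v by `hparts`. The two diagonal terms add up
  -- to 2 k(x,x) v(x) = (∫₀ˣ α) v(x).
  have heq : (fun x => waveKernel α F x x * v x + ∫ y in (0 : ℝ)..x, waveKernelDx α F x y * v y) =
      fun x => ((∫ s in (0 : ℝ)..x, α s) * v x +
        ∫ s in (0 : ℝ)..x, 2 * charKernelEta α F (2 * x - s) s * v (x - s)) -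
        ∫ y in (0 : ℝ)..x, waveKernel α F x y * p y := by
    funext x
    have e1 : ∫ y in (0 : ℝ)..x, waveKernelDx α F x y * v y =
        (∫ y in (0 : ℝ)..x, 2 * charKernelEta α F (x + y) (x - y) * v y) +
          ∫ y in (0 : ℝ)..x, waveKernelDy α F x y * v y := by
      rw [← intervalIntegral.integral_add _ (hint hKy hvc x 0 x)]
      · refine intervalIntegral.integral_congr fun y _ => ?_
        simp only [waveKernelDx, waveKernelDy]; ring
      · refine Continuous.intervalIntegrable (Continuous.mul (continuous_const.mul ?_) hvc) _ _
        exact hEta.comp (g := fun p : ℝ × ℝ => charKernelEta α F p.1 p.2)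
          (f := fun y : ℝ => (x + y, x - y)) (by fun_prop)
    rw [e1, hparts, hsub x (fun ξ η => 2 * charKernelEta α F ξ η) v, waveKernel_self]
    ring
  rw [heq]
  have d1 := ((hα.integral_hasStrictDerivAt 0 x).hasDerivAt).mul (hv x)
  have d2 := hasDerivAt_integral_param_limit
    (f := fun x s => 2 * charKernelEta α F (2 * x - s) s * v (x - s))
    (f' := fun x s => F (2 * x - s) s * v (x - s) +
      2 * charKernelEta α F (2 * x - s) s * p (x - s)) ?_ ?_ ?_ 0 (hasDerivAt_id x)
  · have d3 := hasDerivAt_integral_param_limit (f := fun x y => waveKernel α F x y * p y)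
      (f' := fun x y => waveKernelDx α F x y * p y)
      ((continuous_waveKernel hα hF).mul (hp.comp continuous_snd))
      (hKx.mul (hp.comp continuous_snd))
      (fun x y => (hasDerivAt_waveKernel_fst hα hF x y).mul_const _) 0 (hasDerivAt_id x)
    convert! (d1.add d2).sub d3 using 1
    have e2 : ∫ s in (0 : ℝ)..x, (F (2 * x - s) s * v (x - s) +
        2 * charKernelEta α F (2 * x - s) s * p (x - s)) =
        (∫ y in (0 : ℝ)..x, F (x + y) (x - y) * v y) +
          ∫ y in (0 : ℝ)..x, 2 * charKernelEta α F (x + y) (x - y) * p y := by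
      rw [hsub x F v, hsub x (fun ξ η => 2 * charKernelEta α F ξ η) p,
        intervalIntegral.integral_add]
      · refine Continuous.intervalIntegrable (Continuous.mul ?_ (by fun_prop)) _ _
        exact hF.comp (g := Function.uncurry F) (f := fun s : ℝ => (2 * x - s, s)) (by fun_prop)
      · refine Continuous.intervalIntegrable
          (Continuous.mul (continuous_const.mul ?_) (by fun_prop)) _ _
        exact hEta.comp (g := fun p : ℝ × ℝ => charKernelEta α F p.1 p.2)
          (f := fun s : ℝ => (2 * x - s, s)) (by fun_prop)
    have e3 : ∫ y in (0 : ℝ)..x, waveKernelDx α F x y * p y =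
        (∫ y in (0 : ℝ)..x, 2 * charKernelEta α F (x + y) (x - y) * p y) +
          ∫ y in (0 : ℝ)..x, waveKernelDy α F x y * p y := by
      rw [← intervalIntegral.integral_add _ (hint hKy hp x 0 x)]
      · refine intervalIntegral.integral_congr fun y _ => ?_
        simp only [waveKernelDx, waveKernelDy]; ring
      · refine Continuous.intervalIntegrable (Continuous.mul (continuous_const.mul ?_) hp) _ _
        exact hEta.comp (g := fun p : ℝ × ℝ => charKernelEta α F p.1 p.2)
          (f := fun y : ℝ => (x + y, x - y)) (by fun_prop)
    simp only [id]
    rw [e2, e3, sub_self, hv0, waveKernel_self]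
    ring
  · refine Continuous.mul (continuous_const.mul ?_) (hvc.comp (by fun_prop))
    exact hEta.comp (g := fun p : ℝ × ℝ => charKernelEta α F p.1 p.2)
      (f := fun p : ℝ × ℝ => (2 * p.1 - p.2, p.2)) (by fun_prop)
  · refine Continuous.add (Continuous.mul ?_ (hvc.comp (by fun_prop)))
      (Continuous.mul (continuous_const.mul ?_) (hp.comp (by fun_prop)))
    · exact hF.comp (g := Function.uncurry F)
        (f := fun p : ℝ × ℝ => (2 * p.1 - p.2, p.2)) (by fun_prop)
    · exact hEta.comp (g := fun p : ℝ × ℝ => charKernelEta α F p.1 p.2)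
        (f := fun p : ℝ × ℝ => (2 * p.1 - p.2, p.2)) (by fun_prop)
  · intro x s
    have h1 : HasDerivAt (fun x : ℝ => 2 * x - s) 2 x := by
      simpa using ((hasDerivAt_id x).const_mul 2).sub_const s
    have h2 := ((hasDerivAt_charKernelEta_fst (α := α) hF (2 * x - s) s).comp x h1).const_mul 2
    have h3 := (hv (x - s)).comp x ((hasDerivAt_id x).sub_const s)
    convert! h2.mul h3 using 1
    simp only [Function.comp_apply, id]
    ring

/-- Integration by parts against the kernel, for `v' = p`, `p' = q` on `[0,1]`. -/
lemma integral_waveKernel_mul_eq (hα : Continuous α) (hF : Continuous (Function.uncurry F))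
    {p q : ℝ → ℝ} (hp : Continuous p) (hq : Continuous q)
    (hpq : ∀ x ∈ Ioo (0 : ℝ) 1, HasDerivAt p (q x) x) {x : ℝ} (hx : x ∈ Icc (0 : ℝ) 1) :
    ∫ y in (0 : ℝ)..x, waveKernel α F x y * q y =
      waveKernel α F x x * p x - ∫ y in (0 : ℝ)..x, waveKernelDy α F x y * p y := by
  have hsec : ∀ {g : ℝ → ℝ → ℝ}, Continuous (fun p : ℝ × ℝ => g p.1 p.2) → ∀ x, Continuous (g x) :=
    fun hg x => hg.comp (Continuous.prodMk_right x)
  have h := intervalIntegral.integral_mul_deriv_eq_deriv_mul_of_hasDerivAt (a := 0) (b := x)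
    (u := waveKernel α F x) (v := p) (u' := waveKernelDy α F x) (v' := q)
    (hsec (continuous_waveKernel hα hF) x).continuousOn hp.continuousOn
    (fun y _ => hasDerivAt_waveKernel_snd hα hF x y)
    (fun y hy => hpq y ?_) ((hsec (continuous_waveKernelDy hα hF) x).intervalIntegrable _ _)
    (hq.intervalIntegrable _ _)
  · rw [h, waveKernel_zero]; ring
  · rw [min_eq_left hx.1, max_eq_right hx.1] at hy
    exact ⟨hy.1, hy.2.trans_le hx.2⟩

end CharacteristicKernel

/-! ### The Goursat problem as bounded operators on continuous functions -/

noncomputable section KernelOperators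

lemma isCompact_triangle : IsCompact triangle := by
  have hc : IsClosed triangle := by
    have : triangle = {p : ℝ × ℝ | 0 ≤ p.2} ∩ ({p | p.2 ≤ p.1} ∩ {p | p.1 ≤ 1}) := by
      ext p; simp [triangle]
    rw [this]
    exact (isClosed_le continuous_const continuous_snd).inter
      ((isClosed_le continuous_snd continuous_fst).inter
        (isClosed_le continuous_fst continuous_const))
  refine IsCompact.of_isClosed_subset (isCompact_Icc (a := ((0 : ℝ), (0 : ℝ))) (b := (1, 1))) hc ?_
  rintro ⟨x, y⟩ ⟨h1, h2, h3⟩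
  simp only at h1 h2 h3
  exact ⟨⟨by simp only; linarith, h1⟩, ⟨h3, by simp only; linarith⟩⟩

instance : CompactSpace triangle := isCompact_iff_compactSpace.1 isCompact_triangle

lemma convex_triangle : Convex ℝ triangle := by
  rintro ⟨x, y⟩ ⟨h1, h2, h3⟩ ⟨x', y'⟩ ⟨h1', h2', h3'⟩ a b ha hb hab
  simp only [triangle, mem_ofPred_eq, Prod.smul_mk, Prod.mk_add_mk, smul_eq_mul] at *
  refine ⟨by positivity, by gcongr, ?_⟩
  calc a * x + b * x' ≤ a * 1 + b * 1 := by gcongr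
    _ = 1 := by linarith

lemma mem_interior_triangle {x y : ℝ} (hy : 0 < y) (hxy : y < x) (hx : x < 1) :
    (x, y) ∈ interior triangle := by
  have ho : IsOpen {p : ℝ × ℝ | 0 < p.2 ∧ p.2 < p.1 ∧ p.1 < 1} := by
    have : {p : ℝ × ℝ | 0 < p.2 ∧ p.2 < p.1 ∧ p.1 < 1} =
        {p : ℝ × ℝ | 0 < p.2} ∩ ({p | p.2 < p.1} ∩ {p | p.1 < 1}) := by
      ext p; simp
    rw [this]
    exact (isOpen_lt continuous_const continuous_snd).inter
      ((isOpen_lt continuous_snd continuous_fst).inter (isOpen_lt continuous_fst continuous_const))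
  have hs : {p : ℝ × ℝ | 0 < p.2 ∧ p.2 < p.1 ∧ p.1 < 1} ⊆ triangle :=
    fun p hp => ⟨hp.1.le, hp.2.1.le, hp.2.2.le⟩
  exact interior_maximal hs ho ⟨hy, hxy, hx⟩

lemma uniqueDiffOn_triangle : UniqueDiffOn ℝ triangle :=
  uniqueDiffOn_convex convex_triangle
    ⟨((1 / 2, 1 / 4) : ℝ × ℝ), mem_interior_triangle (by norm_num) (by norm_num) (by norm_num)⟩

/-- The retraction of the plane onto the triangle. -/
def projTriangle (p : ℝ × ℝ) : triangle :=
  ⟨(max 0 (min p.1 1), max 0 (min p.2 (max 0 (min p.1 1)))), by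
    refine ⟨le_max_left _ _, max_le (le_max_left _ _) (min_le_right _ _), ?_⟩
    exact max_le zero_le_one (min_le_right _ _)⟩

lemma continuous_projTriangle : Continuous projTriangle := by
  unfold projTriangle
  fun_prop

lemma projTriangle_of_mem {p : ℝ × ℝ} (hp : p ∈ triangle) : projTriangle p = ⟨p, hp⟩ := by
  obtain ⟨h1, h2, h3⟩ := hp
  have e1 : max 0 (min p.1 1) = p.1 := by
    rw [min_eq_left h3, max_eq_right (h1.trans h2)]
  apply Subtype.ext
  simp only [projTriangle, e1, min_eq_left h2, max_eq_right h1]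

/-- The continuous extension of a function on `[0,1]` by constants. -/
def extI (f : C(Icc (0 : ℝ) 1, ℝ)) (x : ℝ) : ℝ := f (projIcc 0 1 zero_le_one x)

lemma extI_of_mem (f : C(Icc (0 : ℝ) 1, ℝ)) {x : ℝ} (hx : x ∈ Icc (0 : ℝ) 1) :
    extI f x = f ⟨x, hx⟩ := by
  rw [extI, projIcc_of_mem zero_le_one hx]

lemma continuous_extI (f : C(Icc (0 : ℝ) 1, ℝ)) : Continuous (extI f) :=
  f.continuous.comp continuous_projIcc

lemma abs_extI_le (f : C(Icc (0 : ℝ) 1, ℝ)) (x : ℝ) : |extI f x| ≤ ‖f‖ := f.norm_coe_le_norm _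

/-- A function on the triangle, extended to the plane, in characteristic coordinates. -/
def extChar (g : C(triangle, ℝ)) (ξ η : ℝ) : ℝ := g (projTriangle ((ξ + η) / 2, (ξ - η) / 2))

lemma continuous_extChar (g : C(triangle, ℝ)) : Continuous (Function.uncurry (extChar g)) :=
  g.continuous.comp (continuous_projTriangle.comp (by fun_prop))

lemma abs_extChar_le (g : C(triangle, ℝ)) (ξ η : ℝ) : |extChar g ξ η| ≤ ‖g‖ := g.norm_coe_le_norm _

lemma extChar_of_mem (g : C(triangle, ℝ)) {x y : ℝ} (h : (x, y) ∈ triangle) :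
    extChar g (x + y) (x - y) = g ⟨(x, y), h⟩ := by
  have e1 : (x + y + (x - y)) / 2 = x := by ring
  have e2 : (x + y - (x - y)) / 2 = y := by ring
  rw [extChar, e1, e2, projTriangle_of_mem h]

lemma charKernel_add {α α' : ℝ → ℝ} {F F' : ℝ → ℝ → ℝ} (hα : Continuous α) (hα' : Continuous α')
    (hF : Continuous (Function.uncurry F)) (hF' : Continuous (Function.uncurry F')) (ξ η : ℝ) :
    charKernel (α + α') (F + F') ξ η = charKernel α F ξ η + charKernel α' F' ξ η := by
  have hi : ∀ τ, ∫ s in (0 : ℝ)..η, (F + F') τ s =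
      (∫ s in (0 : ℝ)..η, F τ s) + ∫ s in (0 : ℝ)..η, F' τ s := fun τ =>
    intervalIntegral.integral_add ((hF.comp (Continuous.prodMk_right τ)).intervalIntegrable _ _)
      ((hF'.comp (Continuous.prodMk_right τ)).intervalIntegrable _ _)
  simp only [charKernel, hi]
  rw [intervalIntegral.integral_add
      ((continuous_integral_param hF continuous_const continuous_const).intervalIntegrable _ _)
      ((continuous_integral_param hF' continuous_const continuous_const).intervalIntegrable _ _)]
  simp only [Pi.add_apply]
  rw [intervalIntegral.integral_add (hα.intervalIntegrable _ _) (hα'.intervalIntegrable _ _)]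
  ring

lemma charKernelXi_add {α α' : ℝ → ℝ} {F F' : ℝ → ℝ → ℝ}
    (hF : Continuous (Function.uncurry F)) (hF' : Continuous (Function.uncurry F')) (ξ η : ℝ) :
    charKernelXi (α + α') (F + F') ξ η = charKernelXi α F ξ η + charKernelXi α' F' ξ η := by
  have h : Continuous (F ξ) := hF.comp (Continuous.prodMk_right ξ)
  have h' : Continuous (F' ξ) := hF'.comp (Continuous.prodMk_right ξ)
  simp only [charKernelXi, Pi.add_apply]
  rw [intervalIntegral.integral_add (h.intervalIntegrable _ _) (h'.intervalIntegrable _ _)]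
  ring

lemma charKernelEta_add {α α' : ℝ → ℝ} {F F' : ℝ → ℝ → ℝ}
    (hF : Continuous (Function.uncurry F)) (hF' : Continuous (Function.uncurry F')) (ξ η : ℝ) :
    charKernelEta (α + α') (F + F') ξ η = charKernelEta α F ξ η + charKernelEta α' F' ξ η := by
  have h : Continuous (F η) := hF.comp (Continuous.prodMk_right η)
  have h' : Continuous (F' η) := hF'.comp (Continuous.prodMk_right η)
  have g : Continuous fun τ => F τ η := hF.comp (Continuous.prodMk_left η)
  have g' : Continuous fun τ => F' τ η := hF'.comp (Continuous.prodMk_left η)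
  simp only [charKernelEta, Pi.add_apply]
  rw [intervalIntegral.integral_add (h.intervalIntegrable _ _) (h'.intervalIntegrable _ _),
    intervalIntegral.integral_add (g.intervalIntegrable _ _) (g'.intervalIntegrable _ _)]
  ring

lemma charKernel_smul {α : ℝ → ℝ} {F : ℝ → ℝ → ℝ} (c ξ η : ℝ) :
    charKernel (c • α) (c • F) ξ η = c * charKernel α F ξ η := by
  simp only [charKernel, Pi.smul_apply, smul_eq_mul, intervalIntegral.integral_const_mul]
  ring

lemma charKernelXi_smul {α : ℝ → ℝ} {F : ℝ → ℝ → ℝ} (c ξ η : ℝ) :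
    charKernelXi (c • α) (c • F) ξ η = c * charKernelXi α F ξ η := by
  simp only [charKernelXi, Pi.smul_apply, smul_eq_mul, intervalIntegral.integral_const_mul]
  ring

lemma charKernelEta_smul {α : ℝ → ℝ} {F : ℝ → ℝ → ℝ} (c ξ η : ℝ) :
    charKernelEta (c • α) (c • F) ξ η = c * charKernelEta α F ξ η := by
  simp only [charKernelEta, Pi.smul_apply, smul_eq_mul, intervalIntegral.integral_const_mul]
  ring

lemma abs_integral_le_of_abs_le {f : ℝ → ℝ} {a b C : ℝ} (h : ∀ x, |f x| ≤ C) :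
    |∫ x in a..b, f x| ≤ C * |b - a| :=
  intervalIntegral.norm_integral_le_of_norm_le_const (f := f) fun x _ => h x

/-- The ranges are those of the triangle: η = x - y ≤ 1 and ξ - η = 2y ≤ 2. The prefactors leave A/2
+ B/2. -/
lemma abs_charKernel_le {α : ℝ → ℝ} {F : ℝ → ℝ → ℝ} {A B ξ η : ℝ} (hA : ∀ x, |α x| ≤ A)
    (hB : ∀ x y, |F x y| ≤ B) (hη : η ∈ Icc (0 : ℝ) 1) (hξ : ξ ∈ Icc η (η + 2)) :
    |charKernel α F ξ η| ≤ A + B := by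
  have hA0 : 0 ≤ A := (abs_nonneg _).trans (hA 0)
  have hB0 : 0 ≤ B := (abs_nonneg _).trans (hB 0 0)
  have h1 : |∫ s in (η / 2)..(ξ / 2), α s| ≤ A * |ξ / 2 - η / 2| :=
    abs_integral_le_of_abs_le fun x => hA x
  have h2 : ∀ τ, |∫ s in (0 : ℝ)..η, F τ s| ≤ B * |η - 0| := fun τ =>
    abs_integral_le_of_abs_le fun x => hB τ x
  have h3 : |∫ τ in η..ξ, ∫ s in (0 : ℝ)..η, F τ s| ≤ (B * |η - 0|) * |ξ - η| :=
    abs_integral_le_of_abs_le fun x => h2 x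
  have e1 : |ξ / 2 - η / 2| ≤ 1 := by rw [abs_le]; constructor <;> linarith [hξ.1, hξ.2]
  have e2 : |η - 0| ≤ 1 := by rw [sub_zero, abs_of_nonneg hη.1]; exact hη.2
  have e3 : |ξ - η| ≤ 2 := by rw [abs_le]; constructor <;> linarith [hξ.1, hξ.2]
  have h1' : |∫ s in (η / 2)..(ξ / 2), α s| ≤ A * 1 := h1.trans (by gcongr)
  have h3' : |∫ τ in η..ξ, ∫ s in (0 : ℝ)..η, F τ s| ≤ (B * 1) * 2 := h3.trans (by gcongr)
  rw [abs_le] at *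
  simp only [charKernel]
  constructor <;> linarith [h1'.1, h1'.2, h3'.1, h3'.2]

/-- The two values of α contribute A/2, and the three integrals contribute (B + 2B + B)/4 = B. -/
lemma abs_charKernelXi_add_Eta_le {α : ℝ → ℝ} {F : ℝ → ℝ → ℝ} {A B ξ η : ℝ} (hA : ∀ x, |α x| ≤ A)
    (hB : ∀ x y, |F x y| ≤ B) (hη : η ∈ Icc (0 : ℝ) 1) (hξ : ξ ∈ Icc η (η + 2)) :
    |charKernelXi α F ξ η + charKernelEta α F ξ η| ≤ A + B := by
  have hA0 : 0 ≤ A := (abs_nonneg _).trans (hA 0)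
  have hB0 : 0 ≤ B := (abs_nonneg _).trans (hB 0 0)
  have e2 : |η - 0| ≤ 1 := by rw [sub_zero, abs_of_nonneg hη.1]; exact hη.2
  have e3 : |ξ - η| ≤ 2 := by rw [abs_le]; constructor <;> linarith [hξ.1, hξ.2]
  have h2 : ∀ τ, |∫ s in (0 : ℝ)..η, F τ s| ≤ B * 1 := fun τ =>
    (abs_integral_le_of_abs_le fun x => hB τ x).trans (by gcongr)
  have h3 : |∫ τ in η..ξ, F τ η| ≤ B * 2 :=
    (abs_integral_le_of_abs_le fun x => hB x η).trans (by gcongr)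
  have a1 := hA (ξ / 2)
  have a2 := hA (η / 2)
  have b1 := h2 ξ
  have b2 := h2 η
  rw [abs_le] at *
  simp only [charKernelXi, charKernelEta]
  constructor <;> linarith [a1.1, a1.2, a2.1, a2.2, b1.1, b1.2, b2.1, b2.2, h3.1, h3.2]

lemma char_mem_of_mem_triangle {x y : ℝ} (h : (x, y) ∈ triangle) :
    x - y ∈ Icc (0 : ℝ) 1 ∧ x + y ∈ Icc (x - y) (x - y + 2) := by
  obtain ⟨h1, h2, h3⟩ := h
  simp only at h1 h2 h3
  exact ⟨⟨by linarith, by linarith⟩, ⟨by linarith, by linarith⟩⟩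

/-- The solution operator of the Goursat problem for `4 G_ξη = F` with diagonal data `α`. -/
def goursatOp : C(Icc (0 : ℝ) 1, ℝ) × C(triangle, ℝ) →L[ℝ] C(triangle, ℝ) :=
  LinearMap.mkContinuous
    { toFun := fun q => ⟨fun p => waveKernel (extI q.1) (extChar q.2) p.1.1 p.1.2,
        (continuous_waveKernel (continuous_extI _) (continuous_extChar _)).comp
          continuous_subtype_val⟩
      map_add' := fun q q' => ContinuousMap.ext fun p =>
        charKernel_add (continuous_extI _) (continuous_extI _) (continuous_extChar _)
          (continuous_extChar _) _ _
      map_smul' := fun c q => ContinuousMap.ext fun p => charKernel_smul _ _ _ } 2 <| by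
    intro q
    rw [ContinuousMap.norm_le _ (by positivity)]
    rintro ⟨⟨x, y⟩, h⟩
    refine (abs_charKernel_le (abs_extI_le q.1) (abs_extChar_le q.2) (char_mem_of_mem_triangle h).1
      (char_mem_of_mem_triangle h).2).trans ?_
    linarith [norm_fst_le q, norm_snd_le q]

/-- The `x`-derivative of `goursatOp`. -/
def goursatDxOp : C(Icc (0 : ℝ) 1, ℝ) × C(triangle, ℝ) →L[ℝ] C(triangle, ℝ) :=
  LinearMap.mkContinuous
    { toFun := fun q => ⟨fun p => waveKernelDx (extI q.1) (extChar q.2) p.1.1 p.1.2,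
        (continuous_waveKernelDx (continuous_extI _) (continuous_extChar _)).comp
          continuous_subtype_val⟩
      map_add' := fun q q' => ContinuousMap.ext fun p => by
        have h1 := charKernelXi_add (α := extI q.1) (α' := extI q'.1) (continuous_extChar q.2)
          (continuous_extChar q'.2) (p.1.1 + p.1.2) (p.1.1 - p.1.2)
        have h2 := charKernelEta_add (α := extI q.1) (α' := extI q'.1) (continuous_extChar q.2)
          (continuous_extChar q'.2) (p.1.1 + p.1.2) (p.1.1 - p.1.2)
        refine (congrArg₂ (· + ·) h1 h2).trans ?_
        simp only [ContinuousMap.add_apply, ContinuousMap.coe_mk, waveKernelDx]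
        ring
      map_smul' := fun c q => ContinuousMap.ext fun p => by
        refine (congrArg₂ (· + ·) (charKernelXi_smul (α := extI q.1) (F := extChar q.2) c
          (p.1.1 + p.1.2) (p.1.1 - p.1.2)) (charKernelEta_smul (α := extI q.1) (F := extChar q.2) c
          (p.1.1 + p.1.2) (p.1.1 - p.1.2))).trans ?_
        simp only [ContinuousMap.smul_apply, ContinuousMap.coe_mk, waveKernelDx, smul_eq_mul,
          RingHom.id_apply]
        ring } 2 <| by
    intro q
    rw [ContinuousMap.norm_le _ (by positivity)]
    rintro ⟨⟨x, y⟩, h⟩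
    refine (abs_charKernelXi_add_Eta_le (abs_extI_le q.1) (abs_extChar_le q.2)
      (char_mem_of_mem_triangle h).1 (char_mem_of_mem_triangle h).2).trans ?_
    linarith [norm_fst_le q, norm_snd_le q]

lemma goursatOp_apply (q : C(Icc (0 : ℝ) 1, ℝ) × C(triangle, ℝ)) (p : triangle) :
    goursatOp q p = waveKernel (extI q.1) (extChar q.2) p.1.1 p.1.2 := rfl

/-- The part of `goursatOp` with zero diagonal data. -/
def waveOp : C(triangle, ℝ) →L[ℝ] C(triangle, ℝ) :=
  goursatOp.comp (ContinuousLinearMap.inr ℝ _ _)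

/-- The part of `goursatOp` with zero right-hand side. -/
def diagOp : C(Icc (0 : ℝ) 1, ℝ) →L[ℝ] C(triangle, ℝ) :=
  goursatOp.comp (ContinuousLinearMap.inl ℝ _ _)

lemma goursatOp_eq_add (α : C(Icc (0 : ℝ) 1, ℝ)) (g : C(triangle, ℝ)) :
    goursatOp (α, g) = diagOp α + waveOp g := by
  simp only [diagOp, waveOp, ContinuousLinearMap.comp_apply, ContinuousLinearMap.inl_apply,
    ContinuousLinearMap.inr_apply, ← map_add]
  simp

/-- The gain of two orders of vanishing under `waveOp`. -/
lemma abs_waveOp_le {g : C(triangle, ℝ)} {c : ℝ} {m : ℕ}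
    (hg : ∀ p : triangle, |g p| ≤ c * ((p.1.1 + p.1.2) ^ m * (p.1.1 - p.1.2) ^ m)) (hc : 0 ≤ c)
    (p : triangle) : |waveOp g p| ≤ c / (m + 1) ^ 2 *
      ((p.1.1 + p.1.2) ^ (m + 1) * (p.1.1 - p.1.2) ^ (m + 1)) := by
  obtain ⟨⟨x, y⟩, h⟩ := p
  have h' := h
  obtain ⟨h1, h2, h3⟩ := h'
  simp only at h1 h2 h3 ⊢
  set ξ := x + y with hξ
  set η := x - y with hη
  have hη0 : 0 ≤ η := by linarith
  have hηξ : η ≤ ξ := by linarith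
  -- The rectangle [η,ξ] × [0,η] of integration lies inside the triangle, so the values of the
  -- extension outside play no role.
  have hF : ∀ τ ∈ Icc η ξ, ∀ s ∈ Icc (0 : ℝ) η, |extChar g τ s| ≤ c * τ ^ m * s ^ m := by
    intro τ hτ s hs
    have hmem : ((τ + s) / 2, (τ - s) / 2) ∈ triangle :=
      ⟨by simp only; linarith [hτ.1, hs.2], by simp only; linarith [hs.1],
        by simp only; linarith [hτ.2, hs.2]⟩
    have := hg ⟨_, hmem⟩
    simp only [extChar, projTriangle_of_mem hmem]
    refine this.trans_eq ?_
    simp only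
    rw [show (τ + s) / 2 + (τ - s) / 2 = τ by ring, show (τ + s) / 2 - (τ - s) / 2 = s by ring]
    ring
  have hin : ∀ τ ∈ Icc η ξ, |∫ s in (0 : ℝ)..η, extChar g τ s| ≤
      c * (η ^ (m + 1) / (m + 1)) * τ ^ m := by
    intro τ hτ
    have := intervalIntegral.norm_integral_le_of_norm_le (μ := volume) (f := extChar g τ)
      (g := fun s => c * τ ^ m * s ^ m) hη0
      (ae_of_all _ fun s hs => hF τ hτ s ⟨hs.1.le, hs.2⟩)
      ((continuous_const.mul (continuous_pow m)).intervalIntegrable _ _)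
    refine this.trans_eq ?_
    rw [intervalIntegral.integral_const_mul, integral_pow]
    simp only [ne_eq, Nat.add_eq_zero_iff, one_ne_zero, and_false, not_false_eq_true, zero_pow,
      sub_zero]
    ring
  have hout : |∫ τ in η..ξ, ∫ s in (0 : ℝ)..η, extChar g τ s| ≤
      c * (η ^ (m + 1) / (m + 1)) * ((ξ ^ (m + 1) - η ^ (m + 1)) / (m + 1)) := by
    have := intervalIntegral.norm_integral_le_of_norm_le (μ := volume)
      (f := fun τ => ∫ s in (0 : ℝ)..η, extChar g τ s)
      (g := fun τ => c * (η ^ (m + 1) / (m + 1)) * τ ^ m) hηξ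
      (ae_of_all _ fun τ hτ => hin τ ⟨hτ.1.le, hτ.2⟩)
      ((continuous_const.mul (continuous_pow m)).intervalIntegrable _ _)
    refine this.trans_eq ?_
    rw [intervalIntegral.integral_const_mul, integral_pow]
  have e : waveOp g ⟨(x, y), h⟩ =
      (1 / 4) * ∫ τ in η..ξ, ∫ s in (0 : ℝ)..η, extChar g τ s := by
    simp only [waveOp, ContinuousLinearMap.comp_apply, ContinuousLinearMap.inr_apply,
      goursatOp_apply, waveKernel, charKernel, ← hξ, ← hη]
    simp [extI]
  rw [e, abs_mul, abs_of_pos (by norm_num : (0 : ℝ) < 1 / 4)]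
  have hm : (0 : ℝ) < m + 1 := by positivity
  have hξ0 : 0 ≤ ξ := hη0.trans hηξ
  calc 1 / 4 * _ ≤ 1 * (c * (η ^ (m + 1) / (m + 1)) * ((ξ ^ (m + 1) - η ^ (m + 1)) / (m + 1))) := by
        gcongr
        norm_num
    _ ≤ 1 * (c * (η ^ (m + 1) / (m + 1)) * (ξ ^ (m + 1) / (m + 1))) := by
        gcongr
        linarith [pow_nonneg hη0 (m + 1)]
    _ = c / (m + 1) ^ 2 * (ξ ^ (m + 1) * η ^ (m + 1)) := by field_simp

end KernelOperators

/-! ### Successive approximations with a time derivative on the right -/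

noncomputable section GoursatSeries

/-- Cauchy estimates at time `t` with `m`-fold vanishing in each characteristic direction. -/
structure CharCauchyBound (Y : ℝ → C(triangle, ℝ)) (t C K R : ℝ) (m : ℕ) : Prop where
  analyticAt : AnalyticAt ℝ Y t
  bound : ∀ (n : ℕ) (p : triangle), |iteratedDeriv n Y t p| ≤
    C * K ^ m * ((n + m).factorial * R ^ n) / (m.factorial : ℝ) ^ 2 *
      ((p.1.1 + p.1.2) ^ m * (p.1.1 - p.1.2) ^ m)

lemma iteratedDeriv_clm_comp {E E' : Type*} [NormedAddCommGroup E] [NormedSpace ℝ E]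
    [CompleteSpace E] [NormedAddCommGroup E'] [NormedSpace ℝ E'] (L : E →L[ℝ] E') {f : ℝ → E} {t : ℝ}
    (hf : AnalyticAt ℝ f t) (n : ℕ) :
    iteratedDeriv n (fun s => L (f s)) t = L (iteratedDeriv n f t) := by
  have h := L.iteratedFDeriv_comp_left (hf.contDiffAt (n := n)) (i := n) le_rfl
  have h2 : (fun s => L (f s)) = L ∘ f := rfl
  rw [iteratedDeriv_eq_iteratedFDeriv, iteratedDeriv_eq_iteratedFDeriv, h2, h]
  rfl

/-- Both sides are (n+m-i)! times a descending factorial of length i, starting at n on the left and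
at n + m on the right. This makes all terms of the Leibniz sum for b·Y obey the same bound. -/
lemma choose_mul_factorial_mul_le {n i : ℕ} (hi : i ≤ n) (m : ℕ) :
    n.choose i * i.factorial * (n - i + m).factorial ≤ (n + m).factorial := by
  have h1 : n.choose i * i.factorial = n.descFactorial i := by
    rw [Nat.descFactorial_eq_factorial_mul_choose, mul_comm]
  have h2 := Nat.factorial_mul_descFactorial (n := n + m) (k := i) (by omega)
  have h3 : n - i + m = n + m - i := by omega
  rw [h1, h3, ← h2, mul_comm]
  exact Nat.mul_le_mul_left _ (Nat.descFactorial_le i (by omega))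

/-- The derivative of Y raises (n+m)! to (n+m+1)! and costs a factor R; the product with b costs B
after the Leibniz sum. Together this is one factor K ≥ R + B, and `abs_waveOp_le` supplies the
1/(m+1)² that turns (m!)² into ((m+1)!)². -/
lemma CharCauchyBound.step {Y b : ℝ → C(triangle, ℝ)} {t C K R B : ℝ} {m : ℕ}
    (hY : CharCauchyBound Y t C K R m) (hb : AnalyticAt ℝ b t)
    (hbb : ∀ n : ℕ, ‖iteratedDeriv n b t‖ ≤ B * n.factorial * R ^ n) (hC : 0 ≤ C) (hR : 0 ≤ R)
    (hB : 0 ≤ B) (hK : R + B ≤ K) :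
    CharCauchyBound (fun s => waveOp (deriv Y s + b s * Y s)) t C K R (m + 1) := by
  have hK0 : 0 ≤ K := by linarith
  have hd := hY.analyticAt.deriv
  have hm := hb.mul hY.analyticAt
  have hsum : AnalyticAt ℝ (fun s => deriv Y s + b s * Y s) t := hd.add hm
  refine ⟨(waveOp.analyticAt _).comp hsum, fun n p => ?_⟩
  rw [iteratedDeriv_clm_comp waveOp hsum n]
  set c := C * K ^ (m + 1) * ((n + (m + 1)).factorial * R ^ n) / (m.factorial : ℝ) ^ 2 with hc
  have key : ∀ q : triangle, |iteratedDeriv n (fun s => deriv Y s + b s * Y s) t q| ≤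
      c * ((q.1.1 + q.1.2) ^ m * (q.1.1 - q.1.2) ^ m) := by
    rintro ⟨⟨x, y⟩, h⟩
    have hch := char_mem_of_mem_triangle h
    simp only
    set w := (x + y) ^ m * (x - y) ^ m with hw
    have hw0 : 0 ≤ w := by
      have := hch.1.1
      have : 0 ≤ x + y := by linarith [hch.2.1]
      positivity
    have e1 : iteratedDeriv n (fun s => deriv Y s + b s * Y s) t =
        iteratedDeriv (n + 1) Y t + ∑ i ∈ Finset.range (n + 1),
          n.choose i * iteratedDeriv i b t * iteratedDeriv (n - i) Y t := by
      have h1 : (fun s => deriv Y s + b s * Y s) = deriv Y + b * Y := rfl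
      rw [h1, iteratedDeriv_add hd.contDiffAt hm.contDiffAt, ← iteratedDeriv_succ',
        iteratedDeriv_mul hb.contDiffAt hY.analyticAt.contDiffAt]
    rw [e1, ContinuousMap.add_apply, ContinuousMap.sum_apply]
    set D := C * K ^ m * ((n + (m + 1)).factorial * R ^ n) / (m.factorial : ℝ) ^ 2 * w with hD
    have hD0 : 0 ≤ D := by positivity
    have b1 : |iteratedDeriv (n + 1) Y t ⟨(x, y), h⟩| ≤ R * D := by
      refine (hY.bound (n + 1) _).trans_eq ?_
      rw [show n + 1 + m = n + (m + 1) by ring, hD, hw]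
      ring
    have b2 : ∀ i ∈ Finset.range (n + 1),
        |((n.choose i : C(triangle, ℝ)) * iteratedDeriv i b t * iteratedDeriv (n - i) Y t)
          ⟨(x, y), h⟩| ≤ B * (C * K ^ m * ((n + m).factorial * R ^ n) / (m.factorial : ℝ) ^ 2 * w) := by
      intro i hi
      have hi' : i ≤ n := by simpa [Nat.lt_succ_iff] using hi
      simp only [ContinuousMap.mul_apply, ContinuousMap.natCast_apply, abs_mul, Nat.abs_cast]
      have h1 : |iteratedDeriv i b t ⟨(x, y), h⟩| ≤ B * i.factorial * R ^ i :=
        ((iteratedDeriv i b t).norm_coe_le_norm _).trans (hbb i)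
      have h2 := hY.bound (n - i) ⟨(x, y), h⟩
      simp only at h2
      rw [← hw] at h2
      calc _ ≤ (n.choose i) * (B * i.factorial * R ^ i) *
            (C * K ^ m * ((n - i + m).factorial * R ^ (n - i)) / (m.factorial : ℝ) ^ 2 * w) := by
            gcongr
        _ = B * (C * K ^ m * ((n.choose i * i.factorial * (n - i + m).factorial) *
              (R ^ i * R ^ (n - i))) / (m.factorial : ℝ) ^ 2 * w) := by ring
        _ ≤ _ := by
            rw [← pow_add, Nat.add_sub_cancel' hi']
            have := choose_mul_factorial_mul_le hi' m
            gcongr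
            exact_mod_cast this
    -- The n + 1 equal Leibniz bounds are absorbed by (n+1)·(n+m)! ≤ (n+m+1)!, the same growth as
    -- that caused by the time derivative.
    have b3 : (n + 1) * (B * (C * K ^ m * ((n + m).factorial * R ^ n) / (m.factorial : ℝ) ^ 2 * w))
        ≤ B * D := by
      have : ((n : ℝ) + 1) * (n + m).factorial ≤ (n + (m + 1)).factorial := by
        rw [← add_assoc, Nat.factorial_succ]
        push_cast
        gcongr
        linarith [(Nat.cast_nonneg m : (0 : ℝ) ≤ m)]
      calc _ = B * (C * K ^ m * (((n + 1) * (n + m).factorial) * R ^ n) /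
              (m.factorial : ℝ) ^ 2 * w) := by ring
        _ ≤ _ := by rw [hD]; gcongr
    calc _ ≤ R * D + ∑ i ∈ Finset.range (n + 1),
          B * (C * K ^ m * ((n + m).factorial * R ^ n) / (m.factorial : ℝ) ^ 2 * w) :=
          (abs_add_le _ _).trans (add_le_add b1 ((Finset.abs_sum_le_sum_abs _ _).trans
            (Finset.sum_le_sum b2)))
      _ ≤ R * D + B * D := by
          rw [Finset.sum_const, Finset.card_range, nsmul_eq_mul]
          push_cast
          gcongr
      _ = (R + B) * D := by ring
      _ ≤ K * D := by gcongr
      _ = c * w := by rw [hD, hc]; ring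
  refine (abs_waveOp_le key (by positivity) p).trans_eq ?_
  rw [hc, Nat.factorial_succ m]
  push_cast
  have : (m.factorial : ℝ) ≠ 0 := by positivity
  field_simp

/-- From (n+m)! ≤ 2^(n+m) n! m! one of the two factors 1/m! survives, which makes the bound summable
in m. The 4 in (4K)^m is this 2 times the bound ξ ≤ 2 on the triangle; R is doubled for the same
binomial reason. -/
lemma CharCauchyBound.norm_le {Y : ℝ → C(triangle, ℝ)} {t C K R : ℝ} {m : ℕ}
    (hY : CharCauchyBound Y t C K R m) (hC : 0 ≤ C) (hR : 0 ≤ R) (hK : 0 ≤ K) (n : ℕ) :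
    ‖iteratedDeriv n Y t‖ ≤ C * n.factorial * (2 * R) ^ n * ((4 * K) ^ m / m.factorial) := by
  rw [ContinuousMap.norm_le _ (by positivity)]
  rintro ⟨⟨x, y⟩, h⟩
  have hch := char_mem_of_mem_triangle h
  refine (hY.bound n _).trans ?_
  simp only
  have h0 : 0 ≤ x - y := hch.1.1
  have h1 : 0 ≤ x + y := by linarith [hch.2.1]
  have h2 : x + y ≤ 2 := by obtain ⟨_, h2, h3⟩ := h; simp only at h2 h3; linarith
  have h3 : (x + y) ^ m * (x - y) ^ m ≤ 2 ^ m * 1 ^ m := by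
    have := hch.1.2
    gcongr
  have h4 : ((n + m).factorial : ℝ) ≤ 2 ^ (n + m) * (n.factorial * m.factorial) := by
    have e := Nat.add_choose_mul_factorial_mul_factorial n m
    have e2 : (n + m).choose m ≤ 2 ^ (n + m) := Nat.choose_le_two_pow _ _
    rw [← e, mul_assoc]
    push_cast
    gcongr
    exact_mod_cast e2
  have hm : (0 : ℝ) < m.factorial := by positivity
  calc _ ≤ C * K ^ m * ((2 ^ (n + m) * (n.factorial * m.factorial)) * R ^ n) /
        (m.factorial : ℝ) ^ 2 * (2 ^ m * 1 ^ m) := by gcongr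
    _ = _ := by
      rw [mul_pow, mul_pow, pow_add, one_pow, show (4 : ℝ) = 2 * 2 by norm_num, mul_pow]
      field_simp

lemma CharCauchyBound.zero {Y : ℝ → C(triangle, ℝ)} {t C R : ℝ} (K : ℝ) (hY : AnalyticAt ℝ Y t)
    (hb : ∀ n : ℕ, ‖iteratedDeriv n Y t‖ ≤ C * n.factorial * R ^ n) :
    CharCauchyBound Y t C K R 0 := by
  refine ⟨hY, fun n p => (((iteratedDeriv n Y t).norm_coe_le_norm p).trans (hb n)).trans_eq ?_⟩
  simp
  ring

/-- The homogeneous Goursat problem has only the zero solution among analytic curves. -/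
lemma eq_zero_of_waveOp_eq {U : Set ℝ} (hU : IsOpen U) {Z b : ℝ → C(triangle, ℝ)}
    (hZ : AnalyticOnNhd ℝ Z U) (hb : AnalyticOnNhd ℝ b U)
    (heq : ∀ t ∈ U, Z t = waveOp (deriv Z t + b t * Z t)) : ∀ t ∈ U, Z t = 0 := by
  intro t ht
  obtain ⟨C, R₁, δ₁, hC, hR₁, hδ₁, h1⟩ := (hZ t ht).exists_bound_iteratedDeriv
  obtain ⟨B, R₂, δ₂, hB, hR₂, hδ₂, h2⟩ := (hb t ht).exists_bound_iteratedDeriv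
  replace h1 := (h1 t (by simpa using hδ₁)).2
  replace h2 := (h2 t (by simpa using hδ₂)).2
  -- The step estimate needs one growth rate for the solution and the coefficient.
  set R := max R₁ R₂ with hR
  have hR0 : 0 ≤ R := hR₁.trans (le_max_left _ _)
  have hbb : ∀ n : ℕ, ‖iteratedDeriv n b t‖ ≤ B * n.factorial * R ^ n := fun n =>
    (h2 n).trans (by gcongr; exact le_max_right _ _)
  have hall : ∀ m : ℕ, CharCauchyBound Z t C (R + B) R m := by
    intro m
    induction m with
    | zero =>
      exact .zero _ (hZ t ht) fun n => (h1 n).trans (by gcongr; exact le_max_left _ _)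
    -- Z is its own next iterate, so the bound with m-fold vanishing holds for every m with the same
    -- C; letting m → ∞ forces Z t = 0.
    | succ m ih =>
      have h := ih.step (hb t ht) hbb hC hR0 hB le_rfl
      have hev : Z =ᶠ[𝓝 t] fun s => waveOp (deriv Z s + b s * Z s) := by
        filter_upwards [hU.mem_nhds ht] with s hs using heq s hs
      exact ⟨hZ t ht, fun n p => by rw [hev.iteratedDeriv_eq n]; exact h.bound n p⟩
  have hlim : Tendsto (fun m : ℕ => C * (Nat.factorial 0) * (2 * R) ^ 0 *
      ((4 * (R + B)) ^ m / m.factorial)) atTop (𝓝 0) := by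
    simpa using (FloorSemiring.tendsto_pow_div_factorial_atTop (4 * (R + B))).const_mul C
  have hle : ‖Z t‖ ≤ 0 := by
    refine ge_of_tendsto' hlim fun m => ?_
    simpa using (hall m).norm_le hC hR0 (by positivity) 0
  exact norm_le_zero_iff.1 hle

/-- The successive approximations for the Goursat problem. -/
def goursatSeq (α : ℝ → C(Icc (0 : ℝ) 1, ℝ)) (b : ℝ → C(triangle, ℝ)) : ℕ → ℝ → C(triangle, ℝ)
  | 0 => fun t => diagOp (α t)
  | m + 1 => fun t => waveOp (deriv (goursatSeq α b m) t + b t * goursatSeq α b m t)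

/-- Near t₁ the Taylor series of `g 0` converges to it by `hasSum_taylor_of_bound`; the analyticity
of the sum of the approximations is obtained from the bounds on its termwise derivatives. -/
lemma analyticAt_of_jets {E : Type*} [NormedAddCommGroup E] [NormedSpace ℝ E] [CompleteSpace E]
    {g : ℕ → ℝ → E} {t₁ δ C R : ℝ} (hδ : 0 < δ)
    (hg : ∀ n t, |t - t₁| < δ → HasDerivAt (g n) (g (n + 1) t) t)
    (hb : ∀ n t, |t - t₁| < δ → ‖g n t‖ ≤ C * n.factorial * R ^ n)
    (hR : 0 ≤ R) : AnalyticAt ℝ (g 0) t₁ := by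
  let p : FormalMultilinearSeries ℝ ℝ E :=
    fun n => ContinuousMultilinearMap.mkPiRing ℝ (Fin n) ((n.factorial : ℝ)⁻¹ • g n t₁)
  refine HasFPowerSeriesAt.analyticAt (p := p) (hasFPowerSeriesAt_iff.2 ?_)
  have h1 : Tendsto (fun z : ℝ => |z|) (𝓝 0) (𝓝 0) := by
    simpa using (continuous_abs (G := ℝ)).tendsto 0
  have h2 : Tendsto (fun z : ℝ => R * |z|) (𝓝 0) (𝓝 0) := by
    simpa using h1.const_mul R
  filter_upwards [h1.eventually_lt_const hδ, h2.eventually_lt_const one_pos] with z hz1 hz2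
  have h := hasSum_taylor_of_bound (t := t₁ + z) hg hb hR (by simpa using hz1) (by simpa using hz2)
  convert! h using 2 with n
  simp [FormalMultilinearSeries.coeff, p, div_eq_mul_inv, smul_smul]

/-- Solution of the Goursat problem whose right-hand side contains a time derivative. -/
lemma exists_goursat {U : Set ℝ} {α : ℝ → C(Icc (0 : ℝ) 1, ℝ)}
    {b : ℝ → C(triangle, ℝ)} (hα : AnalyticOnNhd ℝ α U) (hb : AnalyticOnNhd ℝ b U) :
    ∃ G : ℝ → C(triangle, ℝ), AnalyticOnNhd ℝ G U ∧
      ∀ t ∈ U, G t = goursatOp (α t, deriv G t + b t * G t) := by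
  set S := goursatSeq α b with hS
  have hloc : ∀ t₁ ∈ U, ∃ C R K δ : ℝ, 0 ≤ C ∧ 0 ≤ R ∧ 0 ≤ K ∧ 0 < δ ∧ ∀ t, |t - t₁| < δ →
      ∀ m, CharCauchyBound (S m) t C K R m := by
    intro t₁ ht₁
    obtain ⟨C, R₁, δ₁, hC, hR₁, hδ₁, h1⟩ := (hα t₁ ht₁).exists_bound_iteratedDeriv
    obtain ⟨B, R₂, δ₂, hB, hR₂, hδ₂, h2⟩ := (hb t₁ ht₁).exists_bound_iteratedDeriv
    set R := max R₁ R₂ with hR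
    have hR0 : 0 ≤ R := hR₁.trans (le_max_left _ _)
    refine ⟨‖diagOp‖ * C, R, R + B, min δ₁ δ₂, by positivity, hR0, by positivity,
      lt_min hδ₁ hδ₂, fun t ht m => ?_⟩
    obtain ⟨a1, a2⟩ := h1 t (ht.trans_le (min_le_left _ _))
    obtain ⟨b1, b2⟩ := h2 t (ht.trans_le (min_le_right _ _))
    have hbb : ∀ n : ℕ, ‖iteratedDeriv n b t‖ ≤ B * n.factorial * R ^ n := fun n =>
      (b2 n).trans (by gcongr; exact le_max_right _ _)
    induction m with
    | zero =>
      refine .zero _ ((diagOp.analyticAt _).comp a1) fun n => ?_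
      have := iteratedDeriv_clm_comp diagOp a1 n
      change ‖iteratedDeriv n (fun s => diagOp (α s)) t‖ ≤ _
      rw [this]
      refine (diagOp.le_opNorm _).trans ?_
      rw [mul_assoc, mul_assoc]
      gcongr
      refine (a2 n).trans ?_
      rw [mul_assoc]
      gcongr
      exact le_max_left _ _
    | succ m ih => exact ih.step b1 hbb (by positivity) hR0 hB le_rfl
  -- `g n` is the termwise n-th time derivative of the sum of all approximations; the locally
  -- uniform bounds make it the derivative of `g (n - 1)` for n ≥ 1.
  set g : ℕ → ℝ → C(triangle, ℝ) := fun n t => ∑' m, iteratedDeriv n (S m) t with hg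
  have hsum : ∀ t ∈ U, ∀ n, Summable fun m => iteratedDeriv n (S m) t := by
    intro t ht n
    obtain ⟨C, R, K, δ, hC, hR, hK, hδ, h⟩ := hloc t ht
    exact Summable.of_norm_bounded ((Real.summable_pow_div_factorial (4 * K)).mul_left _)
      fun m => (h t (by simpa using hδ) m).norm_le hC hR hK n
  have hjets : ∀ t₁ ∈ U, ∃ C R δ : ℝ, 0 ≤ R ∧ 0 < δ ∧
      (∀ n t, |t - t₁| < δ → HasDerivAt (g n) (g (n + 1) t) t) ∧
      (∀ n t, |t - t₁| < δ → ‖g n t‖ ≤ C * n.factorial * R ^ n) := by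
    intro t₁ ht₁
    obtain ⟨C, R, K, δ, hC, hR, hK, hδ, h⟩ := hloc t₁ ht₁
    refine ⟨C * ∑' m : ℕ, (4 * K) ^ m / m.factorial, 2 * R, δ, by positivity, hδ, ?_, ?_⟩
    · intro n t ht
      refine hasDerivAt_tsum_of_isPreconnected (t := Metric.ball t₁ δ) (y₀ := t₁)
        ((Real.summable_pow_div_factorial (4 * K)).mul_left
          (C * (n + 1).factorial * (2 * R) ^ (n + 1))) Metric.isOpen_ball
        (convex_ball t₁ δ).isPreconnected (fun m s hs => ?_) (fun m s hs => ?_)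
        (Metric.mem_ball_self hδ) (hsum t₁ ht₁ n) ?_
      · rw [Metric.mem_ball, Real.dist_eq] at hs
        rw [iteratedDeriv_succ, iteratedDeriv_eq_iterate]
        exact ((h s hs m).analyticAt.iterated_deriv n).differentiableAt.hasDerivAt
      · rw [Metric.mem_ball, Real.dist_eq] at hs
        exact (h s hs m).norm_le hC hR hK (n + 1)
      · rwa [Metric.mem_ball, Real.dist_eq]
    · intro n t ht
      have := tsum_of_norm_bounded ((Real.summable_pow_div_factorial (4 * K)).mul_left
        (C * n.factorial * (2 * R) ^ n)).hasSum fun m => (h t ht m).norm_le hC hR hK n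
      refine this.trans_eq ?_
      rw [tsum_mul_left]; ring
  have hana : AnalyticOnNhd ℝ (g 0) U := by
    intro t₁ ht₁
    obtain ⟨C, R, δ, hR, hδ, h1, h2⟩ := hjets t₁ ht₁
    exact analyticAt_of_jets hδ h1 h2 hR
  refine ⟨g 0, hana, fun t ht => ?_⟩
  have hd : deriv (g 0) t = g 1 t := by
    obtain ⟨C, R, δ, hR, hδ, h1, h2⟩ := hjets t ht
    exact (h1 0 t (by simpa using hδ)).deriv
  have s0 : Summable fun m => S m t := by simpa using hsum t ht 0
  have s1 : Summable fun m => deriv (S m) t := by simpa using hsum t ht 1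
  have e0 : g 0 t = ∑' m, S m t := by simp [hg]
  have e1 : g 1 t = ∑' m, deriv (S m) t := by simp [hg]
  have e2 : (∑' m, deriv (S m) t) + b t * ∑' m, S m t = ∑' m, (deriv (S m) t + b t * S m t) := by
    rw [s1.tsum_add (s0.mul_left _), s0.tsum_mul_left]
  -- `waveOp` applied to the summed source is the sum of the iterates of index at least 1, and
  -- `diagOp` is the iterate of index 0.
  rw [goursatOp_eq_add, hd, e1, e0, e2, waveOp.map_tsum (s1.add (s0.mul_left _)),
    s0.tsum_eq_zero_add]
  rfl

/-- Evaluating an analytic curve of continuous functions gives a uniformly analytic family. -/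
lemma UniformlyAnalyticOn.of_analyticOnNhd {P : Type*} [TopologicalSpace P] {S : Set P}
    [CompactSpace S] {J U : Set ℝ} {f : P → ℝ → ℝ} {A : ℝ → C(S, ℝ)} (hA : AnalyticOnNhd ℝ A U)
    (hJ : J ⊆ U) (hf : ∀ t ∈ J, ∀ p : S, f p t = A t p) : UniformlyAnalyticOn f S J := by
  intro t₁ ht₁
  obtain ⟨p, r, hp⟩ := hA t₁ (hJ ht₁)
  obtain ⟨q, hq0, hq⟩ := ENNReal.lt_iff_exists_nnreal_btwn.1 hp.r_pos
  have hq0' : (0 : ℝ) < q := by exact_mod_cast hq0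
  obtain ⟨C, hC0, hC⟩ := p.norm_mul_pow_le_of_lt_radius (hq.trans_le hp.r_le)
  classical
  refine ⟨q, C, fun x n => if h : x ∈ S then p.coeff n ⟨x, h⟩ else 0, hq0', fun x hx n => ?_,
    fun x hx t ht htr => ?_⟩
  · refine le_trans ?_ (hC n)
    simp only [hx, dif_pos]
    gcongr
    rw [FormalMultilinearSeries.norm_apply_eq_norm_coef]
    exact ((p.coeff n).norm_coe_le_norm ⟨x, hx⟩)
  · have hy : t - t₁ ∈ Metric.eball (0 : ℝ) r := by
      rw [mem_eball_zero_iff]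
      refine lt_of_le_of_lt ?_ hq
      rw [← ofReal_norm, Real.norm_eq_abs, ← ENNReal.ofReal_coe_nnreal]
      exact ENNReal.ofReal_le_ofReal htr.le
    have h := ContinuousMap.hasSum_apply (hp.hasSum hy) (⟨x, hx⟩ : S)
    rw [add_sub_cancel] at h
    rw [hf t ht ⟨x, hx⟩]
    refine h.congr_fun fun n => ?_
    simp [hx, mul_comm]

end GoursatSeries

/-! ### Existence and uniqueness of the backstepping kernel -/

noncomputable section Kernel

/-- Pull-back of a function of `y ∈ [0,1]` to the triangle. -/
def liftSnd : C(Icc (0 : ℝ) 1, ℝ) →L[ℝ] C(triangle, ℝ) :=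
  LinearMap.mkContinuous
    { toFun := fun f => ⟨fun p => extI f p.1.2, (continuous_extI f).comp
        (continuous_snd.comp continuous_subtype_val)⟩
      map_add' := fun _ _ => rfl
      map_smul' := fun _ _ => rfl } 1 <| by
    intro f
    rw [ContinuousMap.norm_le _ (by positivity), one_mul]
    exact fun p => abs_extI_le f _

lemma liftSnd_apply (f : C(Icc (0 : ℝ) 1, ℝ)) (p : triangle) : liftSnd f p = extI f p.1.2 := rfl

/-- The right-hand side `k_t + (a(y,t) + lam) k` of the wave equation for the kernel. -/
def kernelSource (α : ℝ → C(Icc (0 : ℝ) 1, ℝ)) (G : ℝ → C(triangle, ℝ)) (t : ℝ) : C(triangle, ℝ) :=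
  deriv G t + liftSnd (α t) * G t

/-- `G` solves the kernel problem in integrated form, with `α = a + lam`, as an analytic curve. -/
structure IsGoursatSolution (a : ℝ → ℝ → ℝ) (lam ε : ℝ) (α : ℝ → C(Icc (0 : ℝ) 1, ℝ))
    (G : ℝ → C(triangle, ℝ)) : Prop where
  pos : 0 < ε
  analytic_coeff : AnalyticOnNhd ℝ α (Ioo (-ε) 1)
  coeff_eq : ∀ t ∈ Ico (0 : ℝ) 1, ∀ x ∈ Icc (0 : ℝ) 1, extI (α t) x = a x t + lam
  analytic : AnalyticOnNhd ℝ G (Ioo (-ε) 1)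
  eq : ∀ t ∈ Ioo (-ε) 1, G t = goursatOp (α t, kernelSource α G t)

lemma exists_isGoursatSolution {lam : ℝ} {a : ℝ → ℝ → ℝ}
    (hc : ∀ t ∈ Ico (0 : ℝ) 1, ContinuousOn (fun x => a x t) (Icc (0 : ℝ) 1))
    (ha : UniformlyAnalyticOn a (Icc (0 : ℝ) 1) (Ico (0 : ℝ) 1)) :
    ∃ ε α G, IsGoursatSolution a lam ε α G := by
  obtain ⟨ε, A, hε, hA, hAa⟩ := ha.exists_analyticOnNhd hc
  set α : ℝ → C(Icc (0 : ℝ) 1, ℝ) := fun t => A t + ContinuousMap.const _ lam with hα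
  have hα' : AnalyticOnNhd ℝ α (Ioo (-ε) 1) := fun t ht => (hA t ht).add analyticAt_const
  have hb : AnalyticOnNhd ℝ (fun t => liftSnd (α t)) (Ioo (-ε) 1) := fun t ht =>
    (liftSnd.analyticAt _).comp (hα' t ht)
  obtain ⟨G, hG, heq⟩ := exists_goursat hα' hb
  refine ⟨ε, α, G, hε, hα', fun t ht x hx => ?_, hG, heq⟩
  rw [extI_of_mem _ hx, hα, ContinuousMap.add_apply, hAa t ht]
  rfl

lemma Ico_subset_Ioo_neg {ε : ℝ} (hε : 0 < ε) : Ico (0 : ℝ) 1 ⊆ Ioo (-ε) 1 :=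
  fun t ht => ⟨by linarith [ht.1], ht.2⟩

/-- The kernel attached to a Goursat solution, extended to all `(x,y)`. -/
def kernelOf (α : ℝ → C(Icc (0 : ℝ) 1, ℝ)) (G : ℝ → C(triangle, ℝ)) (x y t : ℝ) : ℝ :=
  waveKernel (extI (α t)) (extChar (kernelSource α G t)) x y

section

variable {a : ℝ → ℝ → ℝ} {lam ε : ℝ} {α : ℝ → C(Icc (0 : ℝ) 1, ℝ)} {G : ℝ → C(triangle, ℝ)}

lemma IsGoursatSolution.kernelOf_eq (h : IsGoursatSolution a lam ε α G) {t : ℝ}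
    (ht : t ∈ Ioo (-ε) 1) {x y : ℝ} (hp : (x, y) ∈ triangle) :
    kernelOf α G x y t = G t ⟨(x, y), hp⟩ := by
  rw [h.eq t ht]
  rfl

lemma hasFDerivWithinAt_kernelOf (α : ℝ → C(Icc (0 : ℝ) 1, ℝ)) (G : ℝ → C(triangle, ℝ)) (t : ℝ)
    (p : ℝ × ℝ) (s : Set (ℝ × ℝ)) :
    HasFDerivWithinAt (fun p : ℝ × ℝ => kernelOf α G p.1 p.2 t)
      ((ContinuousLinearMap.toSpanSingleton ℝ
          (waveKernelDx (extI (α t)) (extChar (kernelSource α G t)) p.1 p.2)).coprod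
        (ContinuousLinearMap.toSpanSingleton ℝ
          (waveKernelDy (extI (α t)) (extChar (kernelSource α G t)) p.1 p.2))) s p :=
  (hasFDerivAt_waveKernel (continuous_extI _) (continuous_extChar _) p).hasFDerivWithinAt

lemma kernelDx_kernelOf {x y : ℝ} (hp : (x, y) ∈ triangle) (t : ℝ) :
    kernelDx (kernelOf α G) x y t =
      waveKernelDx (extI (α t)) (extChar (kernelSource α G t)) x y := by
  rw [kernelDx, (hasFDerivWithinAt_kernelOf α G t (x, y) triangle).fderivWithin
    (uniqueDiffOn_triangle _ hp)]
  simp [ContinuousLinearMap.toSpanSingleton_apply]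

lemma kernelDy_kernelOf {x y : ℝ} (hp : (x, y) ∈ triangle) (t : ℝ) :
    kernelDy (kernelOf α G) x y t =
      waveKernelDy (extI (α t)) (extChar (kernelSource α G t)) x y := by
  rw [kernelDy, (hasFDerivWithinAt_kernelOf α G t (x, y) triangle).fderivWithin
    (uniqueDiffOn_triangle _ hp)]
  simp [ContinuousLinearMap.toSpanSingleton_apply]

lemma hasDerivAt_eval {S : Type*} [TopologicalSpace S] [CompactSpace S] {A : ℝ → C(S, ℝ)}
    {A' : C(S, ℝ)} {t : ℝ} (hA : HasDerivAt A A' t) (p : S) :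
    HasDerivAt (fun s => A s p) (A' p) t := by
  have h := (ContinuousLinearMap.hasFDerivAt (x := A t)
    (ContinuousMap.evalCLM ℝ p : C(S, ℝ) →L[ℝ] ℝ)).comp_hasDerivAt t hA
  exact h

lemma IsGoursatSolution.hasDerivAt_kernelOf (h : IsGoursatSolution a lam ε α G) {t : ℝ}
    (ht : t ∈ Ioo (-ε) 1) {x y : ℝ} (hp : (x, y) ∈ triangle) :
    HasDerivAt (fun s => kernelOf α G x y s) (deriv G t ⟨(x, y), hp⟩) t := by
  refine (hasDerivAt_eval (h.analytic t ht).differentiableAt.hasDerivAt ⟨(x, y), hp⟩)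
    |>.congr_of_eventuallyEq ?_
  filter_upwards [isOpen_Ioo.mem_nhds ht] with s hs using h.kernelOf_eq hs hp

lemma mem_triangle_of_lt {x y : ℝ} (hy : 0 < y) (hxy : y < x) (hx : x < 1) : (x, y) ∈ triangle :=
  ⟨hy.le, hxy.le, hx.le⟩

lemma diag_mem_triangle {x : ℝ} (hx : x ∈ Icc (0 : ℝ) 1) : (x, x) ∈ triangle :=
  ⟨hx.1, le_rfl, hx.2⟩

lemma edge_mem_triangle {x : ℝ} (hx : x ∈ Icc (0 : ℝ) 1) : (x, (0 : ℝ)) ∈ triangle :=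
  ⟨le_rfl, hx.1, hx.2⟩

lemma eventually_shift_mem {x y : ℝ} (hy : 0 < y) (hxy : y < x) (hx : x < 1) :
    ∀ᶠ s : ℝ in 𝓝 0, (x + s, y + s) ∈ triangle := by
  filter_upwards [Ioo_mem_nhds (show -y < 0 by linarith) (show 0 < 1 - x by linarith)] with s hs
  exact mem_triangle_of_lt (by linarith [hs.1]) (by linarith) (by linarith [hs.2])

/-- The difference k_x - k_y equals 2 G_η, and a shift by s along (1,1) changes ξ by 2s and leaves η
fixed. The derivative is therefore 4 G_ξη = F, which explains the factored form of the wave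
operator. -/
lemma hasDerivAt_waveKernelDx_sub_Dy {β : ℝ → ℝ} {F : ℝ → ℝ → ℝ}
    (hF : Continuous (Function.uncurry F)) (x y : ℝ) :
    HasDerivAt (fun s => waveKernelDx β F (x + s) (y + s) - waveKernelDy β F (x + s) (y + s))
      (F (x + y) (x - y)) 0 := by
  have e : (fun s => waveKernelDx β F (x + s) (y + s) - waveKernelDy β F (x + s) (y + s)) =
      fun s => 2 * charKernelEta β F (x + y + 2 * s) (x - y) := by
    funext s
    simp only [waveKernelDx, waveKernelDy]
    rw [show x + s + (y + s) = x + y + 2 * s by ring, show x + s - (y + s) = x - y by ring]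
    ring
  rw [e]
  have h1 : HasDerivAt (fun s : ℝ => x + y + 2 * s) 2 0 := by
    simpa using ((hasDerivAt_id (0 : ℝ)).const_mul 2).const_add (x + y)
  have h2 := ((hasDerivAt_charKernelEta_fst (α := β) hF (x + y + 2 * 0) (x - y)).comp 0 h1).const_mul 2
  convert! h2 using 1
  rw [mul_zero, add_zero]
  ring

theorem IsGoursatSolution.isBacksteppingKernel (h : IsGoursatSolution a lam ε α G) :
    IsBacksteppingKernel a lam (kernelOf α G) where
  contDiff_space := fun t _ =>
    (contDiff_waveKernel (continuous_extI _) (continuous_extChar _)).contDiffOn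
  analytic_time := UniformlyAnalyticOn.of_analyticOnNhd h.analytic (Ico_subset_Ioo_neg h.pos)
    fun t ht p => h.kernelOf_eq (Ico_subset_Ioo_neg h.pos ht) p.2
  equation := by
    intro x y t hy hxy hx ht
    have hp := mem_triangle_of_lt hy hxy hx
    have ht' : t ∈ Ioo (-ε) 1 := ⟨by linarith [ht.1, h.pos], ht.2⟩
    have h1 := hasDerivAt_waveKernelDx_sub_Dy (β := extI (α t))
      (continuous_extChar (kernelSource α G t)) x y
    rw [extChar_of_mem _ hp, kernelSource, ContinuousMap.add_apply, ContinuousMap.mul_apply,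
      liftSnd_apply] at h1
    simp only at h1
    rw [h.coeff_eq t ⟨ht.1.le, ht.2⟩ y ⟨hy.le, by linarith⟩, ← h.kernelOf_eq ht' hp,
      ← (h.hasDerivAt_kernelOf ht' hp).deriv] at h1
    refine h1.congr_of_eventuallyEq ?_
    filter_upwards [eventually_shift_mem hy hxy hx] with s hs
    rw [kernelDx_kernelOf hs, kernelDy_kernelOf hs, kernelSource]
  zero_edge := fun x _ t _ => waveKernel_zero x
  diagonal := by
    intro x hx t ht
    have hp := diag_mem_triangle ⟨hx.1.le, hx.2.le⟩
    rw [kernelDx_kernelOf hp, kernelDy_kernelOf hp]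
    have h1 : (fun s => kernelOf α G s s t) = fun s => (1 / 2) * ∫ r in (0 : ℝ)..s, extI (α t) r := by
      funext s; exact waveKernel_self s
    have h2 := (((continuous_extI (α t)).integral_hasStrictDerivAt 0 x).hasDerivAt).const_mul
      (1 / 2 : ℝ)
    rw [h1, h2.deriv, ← h.coeff_eq t ⟨ht.1.le, ht.2⟩ x ⟨hx.1.le, hx.2.le⟩]
    simp only [waveKernelDx, waveKernelDy, charKernelXi]
    rw [sub_self, intervalIntegral.integral_same, add_self_div_two]
    ring

end

/-- Every point is joined by a segment to the interior point (1/2, 1/4). -/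
lemma triangle_subset_closure :
    triangle ⊆ closure {p : ℝ × ℝ | 0 < p.2 ∧ p.2 < p.1 ∧ p.1 < 1} := by
  rintro ⟨x, y⟩ ⟨h1, h2, h3⟩
  simp only at h1 h2 h3
  have hlim : Tendsto (fun δ : ℝ => ((1 - δ) * x + δ * (1 / 2), (1 - δ) * y + δ * (1 / 4)))
      (𝓝[>] 0) (𝓝 (x, y)) := by
    have : Continuous fun δ : ℝ => ((1 - δ) * x + δ * (1 / 2), (1 - δ) * y + δ * (1 / 4)) := by
      fun_prop
    have := this.tendsto 0
    simp only [sub_zero, one_mul, zero_mul, add_zero] at this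
    exact this.mono_left nhdsWithin_le_nhds
  refine mem_closure_of_tendsto hlim ?_
  filter_upwards [Ioo_mem_nhdsGT (show (0 : ℝ) < 1 by norm_num)] with δ hδ
  have := hδ.1
  have := hδ.2
  refine ⟨?_, ?_, ?_⟩ <;> nlinarith

/-- Uniqueness for the Goursat problem: a `C¹` function vanishing on two edges of the triangle
with `(∂_x + ∂_y)(∂_x - ∂_y) e = 0` vanishes. -/
lemma goursat_unique {e : ℝ × ℝ → ℝ} (he : DifferentiableOn ℝ e triangle)
    (h0 : ∀ x ∈ Ioo (0 : ℝ) 1, e (x, 0) = 0) (hd : ∀ x ∈ Ioo (0 : ℝ) 1, e (x, x) = 0)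
    (hw : ∀ x y, 0 < y → y < x → x < 1 → HasDerivAt (fun s : ℝ =>
      fderivWithin ℝ e triangle (x + s, y + s) (1, 0) -
        fderivWithin ℝ e triangle (x + s, y + s) (0, 1)) 0 0) :
    ∀ p ∈ triangle, e p = 0 := by
  have hint : ∀ x y : ℝ, 0 < y → y < x → x < 1 → e (x, y) = 0 := by
    intro x y hy hxy hx
    set N : ℝ × ℝ → ℝ := fun p => fderivWithin ℝ e triangle p (1, 0) -
      fderivWithin ℝ e triangle p (0, 1) with hN
    have hcurve : ∀ ξ s : ℝ, 0 < (ξ - s) / 2 → (ξ - s) / 2 < (ξ + s) / 2 → (ξ + s) / 2 < 1 →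
        HasDerivAt (fun s : ℝ => e ((ξ + s) / 2, (ξ - s) / 2))
          ((1 / 2) * N ((ξ + s) / 2, (ξ - s) / 2)) s := by
      intro ξ s h1 h2 h3
      have hin := mem_interior_triangle h1 h2 h3
      have hf : HasFDerivAt e (fderivWithin ℝ e triangle ((ξ + s) / 2, (ξ - s) / 2))
          ((ξ + s) / 2, (ξ - s) / 2) :=
        (he _ (interior_subset hin)).hasFDerivWithinAt.hasFDerivAt (mem_interior_iff_mem_nhds.1 hin)
      have hc : HasDerivAt (fun s : ℝ => ((ξ + s) / 2, (ξ - s) / 2)) ((1 / 2 : ℝ), (-1 / 2 : ℝ)) s :=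
        (((hasDerivAt_id s).const_add ξ).div_const 2).prodMk
          (((hasDerivAt_id s).const_sub ξ).div_const 2)
      have h := hf.comp_hasDerivAt s hc
      convert! h using 1
      have ev : ((1 / 2 : ℝ), (-1 / 2 : ℝ)) = (1 / 2 : ℝ) • ((1 : ℝ), (0 : ℝ)) -
          (1 / 2 : ℝ) • ((0 : ℝ), (1 : ℝ)) := by
        ext <;> norm_num
      rw [ev, map_sub, map_smul, map_smul, hN]
      simp only [smul_eq_mul]
      ring
    have hcont : ∀ ξ η' : ℝ, 0 ≤ η' → η' ≤ ξ → (ξ + η') / 2 ≤ 1 →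
        ContinuousOn (fun s : ℝ => e ((ξ + s) / 2, (ξ - s) / 2)) (Icc 0 η') := by
      intro ξ η' h1 h2 h3
      refine he.continuousOn.comp (Continuous.continuousOn (by fun_prop)) fun s hs => ?_
      exact ⟨by simp only; linarith [hs.2], by simp only; linarith [hs.1],
        by simp only; linarith [hs.2]⟩
    set ξ := x + y with hξ
    set η := x - y with hη
    have hη0 : 0 < η := by linarith
    -- N = e_x - e_y is constant along (1,1). A shift by y leads from the characteristic coordinates
    -- (η, s) to (ξ, s), because ξ - η = 2y.
    have hNeq : ∀ s ∈ Ioo 0 η, N ((ξ + s) / 2, (ξ - s) / 2) = N ((η + s) / 2, (η - s) / 2) := by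
      intro s hs
      have hder : ∀ r ∈ uIcc 0 y, HasDerivAt
          (fun r => N ((η + s) / 2 + r, (η - s) / 2 + r)) 0 r := by
        intro r hr
        rw [uIcc_of_le hy.le] at hr
        have h := hw ((η + s) / 2 + r) ((η - s) / 2 + r) (by linarith [hs.2, hr.1])
          (by linarith [hs.1]) (by linarith [hs.2, hr.2])
        have h' : HasDerivAt (fun r' : ℝ => r' - r) 1 r := (hasDerivAt_id r).sub_const r
        have h2 := HasDerivAt.comp (h₂ := fun s' : ℝ =>
          fderivWithin ℝ e triangle ((η + s) / 2 + r + s', (η - s) / 2 + r + s') (1, 0) -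
          fderivWithin ℝ e triangle ((η + s) / 2 + r + s', (η - s) / 2 + r + s') (0, 1)) r
          (by simpa using h) h'
        rw [zero_mul] at h2
        refine h2.congr_of_eventuallyEq (Eventually.of_forall fun r' => ?_)
        simp only [hN, Function.comp_apply]
        rw [show (η + s) / 2 + r + (r' - r) = (η + s) / 2 + r' by ring,
          show (η - s) / 2 + r + (r' - r) = (η - s) / 2 + r' by ring]
      have h := intervalIntegral.integral_eq_sub_of_hasDerivAt hder (by simp)
      simp only [intervalIntegral.integral_zero, add_zero] at h
      rw [show (η + s) / 2 + y = (ξ + s) / 2 by rw [hξ, hη]; ring,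
        show (η - s) / 2 + y = (ξ - s) / 2 by rw [hξ, hη]; ring] at h
      linarith
    -- Hence e(ξ,s) - e(η,s), in characteristic coordinates, does not depend on s in [0,η]. At s = 0
    -- both terms lie on the diagonal, and at s = η the second lies on the edge y = 0; what remains
    -- is e(x,y) = 0.
    have hder : ∀ s ∈ Ioo 0 η, HasDerivAt (fun s : ℝ => e ((ξ + s) / 2, (ξ - s) / 2) -
        e ((η + s) / 2, (η - s) / 2)) 0 s := by
      intro s hs
      have h1 := hcurve ξ s (by linarith [hs.2]) (by linarith [hs.1]) (by linarith [hs.2])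
      have h2 := hcurve η s (by linarith [hs.2]) (by linarith [hs.1]) (by linarith [hs.2])
      convert! h1.sub h2 using 1
      rw [hNeq s hs, sub_self]
    have h := intervalIntegral.integral_eq_sub_of_hasDerivAt_of_le hη0.le
      ((hcont ξ η hη0.le (by linarith) (by linarith)).sub
        (hcont η η hη0.le le_rfl (by linarith))) hder (by simp)
    simp only [intervalIntegral.integral_zero, add_zero, sub_zero, sub_self, zero_div, Pi.sub_apply] at h
    rw [hd (ξ / 2) ⟨by linarith, by linarith⟩, hd (η / 2) ⟨by linarith, by linarith⟩,
      add_self_div_two, h0 η ⟨hη0, by linarith⟩, show (ξ + η) / 2 = x by rw [hξ, hη]; ring,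
      show (ξ - η) / 2 = y by rw [hξ, hη]; ring] at h
    linarith
  have hs : {p : ℝ × ℝ | 0 < p.2 ∧ p.2 < p.1 ∧ p.1 < 1} ⊆ triangle :=
    fun p hp => ⟨hp.1.le, hp.2.1.le, hp.2.2.le⟩
  exact Set.EqOn.of_subset_closure (g := fun _ => (0 : ℝ)) (fun p hp => hint p.1 p.2 hp.1 hp.2.1 hp.2.2)
    he.continuousOn continuousOn_const hs triangle_subset_closure

/-- By the chain rule k_x + k_y on the diagonal is itself d/dx k(x,x), so the diagonal condition
reads 2 d/dx k(x,x) = a + λ. The initial value k(0,0) = 0 comes from the edge y = 0 by continuity.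
-/
lemma IsBacksteppingKernel.diagonal_value {a : ℝ → ℝ → ℝ} {lam : ℝ} {k : ℝ → ℝ → ℝ → ℝ}
    (hk : IsBacksteppingKernel a lam k) {β : ℝ → ℝ} (hβ : Continuous β) {t : ℝ}
    (ht : t ∈ Ioo (0 : ℝ) 1) (hβa : ∀ x ∈ Icc (0 : ℝ) 1, β x = a x t + lam) :
    ∀ x ∈ Ioo (0 : ℝ) 1, k x x t = (1 / 2) * ∫ s in (0 : ℝ)..x, β s := by
  have hC := hk.contDiff_space t ⟨ht.1.le, ht.2⟩
  have hcont := hC.continuousOn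
  have hdiff := hC.differentiableOn one_ne_zero
  have hg : ContinuousOn (fun x => k x x t) (Icc 0 1) :=
    hcont.comp (f := fun x : ℝ => (x, x)) (by fun_prop) fun x hx => diag_mem_triangle hx
  have h00 : k 0 0 t = 0 := by
    have hedge : ContinuousOn (fun x => k x 0 t) (Icc 0 1) :=
      hcont.comp (f := fun x : ℝ => (x, (0 : ℝ))) (by fun_prop) fun x hx => edge_mem_triangle hx
    have := Set.EqOn.of_subset_closure (s := Ioo (0 : ℝ) 1) (g := fun _ => (0 : ℝ))
      (fun x hx => hk.zero_edge x hx t ht) hedge continuousOn_const Ioo_subset_Icc_self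
      (by rw [closure_Ioo zero_ne_one])
    exact this (by simp : (0 : ℝ) ∈ Icc (0 : ℝ) 1)
  have hder : ∀ x ∈ Ioo (0 : ℝ) 1, HasDerivAt (fun x => k x x t) ((1 / 2) * β x) x := by
    intro x hx
    have hp := diag_mem_triangle ⟨hx.1.le, hx.2.le⟩
    have hc : HasDerivWithinAt (fun s : ℝ => (s, s)) ((1 : ℝ), (1 : ℝ)) (Icc 0 1) x :=
      ((hasDerivAt_id x).prodMk (hasDerivAt_id x)).hasDerivWithinAt
    have h1 := (HasFDerivWithinAt.comp_hasDerivWithinAt (f := fun s : ℝ => (s, s)) x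
      (hdiff _ hp).hasFDerivWithinAt hc
      (fun s hs => diag_mem_triangle hs)).hasDerivAt (Icc_mem_nhds hx.1 hx.2)
    have h2 := hk.diagonal x hx t ht
    rw [show deriv (fun s => k s s t) x = _ from h1.deriv] at h2
    have e : fderivWithin ℝ (fun p : ℝ × ℝ => k p.1 p.2 t) triangle (x, x) (1, 1) =
        kernelDx k x x t + kernelDy k x x t := by
      rw [kernelDx, kernelDy, ← map_add]
      simp
    rw [e, ← hβa x ⟨hx.1.le, hx.2.le⟩] at h2
    have h3 : (1 / 2) * β x = kernelDx k x x t + kernelDy k x x t := by linarith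
    rw [h3, ← e]
    exact h1
  intro x hx
  have h := intervalIntegral.integral_eq_sub_of_hasDerivAt_of_le hx.1.le
    (hg.mono (Icc_subset_Icc_right hx.2.le)) (fun s hs => hder s ⟨hs.1, hs.2.trans hx.2⟩)
    ((hβ.const_mul _).intervalIntegrable _ _)
  rw [intervalIntegral.integral_const_mul, h00, sub_zero] at h
  exact h.symm

/-- The curve A of an arbitrary kernel is shown to satisfy the same integral equation as G. Their
difference then solves the homogeneous one and vanishes. -/
theorem IsGoursatSolution.kernel_unique {a : ℝ → ℝ → ℝ} {lam ε : ℝ} {α : ℝ → C(Icc (0 : ℝ) 1, ℝ)}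
    {G : ℝ → C(triangle, ℝ)} (h : IsGoursatSolution a lam ε α G) {k : ℝ → ℝ → ℝ → ℝ}
    (hk : IsBacksteppingKernel a lam k) {x y : ℝ} (hp : (x, y) ∈ triangle) {t : ℝ}
    (ht : t ∈ Ico (0 : ℝ) 1) : k x y t = kernelOf α G x y t := by
  obtain ⟨ε', A, hε', hA, hAk⟩ := hk.analytic_time.exists_analyticOnNhd
    fun t ht => (hk.contDiff_space t ht).continuousOn
  have hmem : ∀ t ∈ Ioo (0 : ℝ) 1, t ∈ Ioo (-ε) 1 := fun t ht => ⟨by linarith [ht.1, h.pos], ht.2⟩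
  have hmem' : ∀ t ∈ Ioo (0 : ℝ) 1, t ∈ Ioo (-ε') 1 := fun t ht => ⟨by linarith [ht.1], ht.2⟩
  have hZ : AnalyticOnNhd ℝ (fun t => A t - G t) (Ioo 0 1) := fun t ht =>
    (hA t (hmem' t ht)).sub (h.analytic t (hmem t ht))
  have hb : AnalyticOnNhd ℝ (fun t => liftSnd (α t)) (Ioo 0 1) := fun t ht =>
    (liftSnd.analyticAt _).comp (h.analytic_coeff t (hmem t ht))
  have hAeq : ∀ t ∈ Ioo (0 : ℝ) 1, A t = goursatOp (α t, kernelSource α A t) := by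
    intro t ht
    have ht' : t ∈ Ico (0 : ℝ) 1 := ⟨ht.1.le, ht.2⟩
    set F := extChar (kernelSource α A t) with hF
    have hFc := continuous_extChar (kernelSource α A t)
    have hαc := continuous_extI (α t)
    have hkd := (hk.contDiff_space t ht').differentiableOn one_ne_zero
    have hwd : ∀ p, HasFDerivAt (fun p : ℝ × ℝ => waveKernel (extI (α t)) F p.1 p.2) _ p :=
      fun p => hasFDerivAt_waveKernel hαc hFc p
    -- The time derivative is frozen: with the source computed from A as a given right-hand side,
    -- `waveKernel` and k solve the same Goursat problem at time t.
    have key := goursat_unique (e := fun p => k p.1 p.2 t - waveKernel (extI (α t)) F p.1 p.2)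
      (hkd.sub fun p _ => (hwd p).differentiableAt.differentiableWithinAt) ?_ ?_ ?_
    · ext p
      have := key p p.2
      rw [goursatOp_apply, hAk t ht' p]
      exact sub_eq_zero.1 this
    · intro x hx
      simp only [hk.zero_edge x hx t ht, waveKernel_zero, sub_zero]
    · intro x hx
      simp only
      rw [hk.diagonal_value hαc ht (fun x hx => h.coeff_eq t ht' x hx) x hx, waveKernel_self,
        sub_self]
    · intro x y hy hxy hx
      have hp := mem_triangle_of_lt hy hxy hx
      have h1 := hk.equation x y t hy hxy hx ht
      have h2 := hasDerivAt_waveKernelDx_sub_Dy (β := extI (α t)) hFc x y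
      have e0 : deriv (fun s => k x y s) t = deriv A t ⟨(x, y), hp⟩ := by
        refine HasDerivAt.deriv ((hasDerivAt_eval
          (hA t (hmem' t ht)).differentiableAt.hasDerivAt ⟨(x, y), hp⟩).congr_of_eventuallyEq ?_)
        filter_upwards [isOpen_Ioo.mem_nhds ht] with s hs
        exact (hAk s ⟨hs.1.le, hs.2⟩ ⟨(x, y), hp⟩).symm
      rw [extChar_of_mem _ hp, kernelSource, ContinuousMap.add_apply, ContinuousMap.mul_apply,
        liftSnd_apply] at h2
      simp only at h2
      rw [h.coeff_eq t ht' y ⟨hy.le, by linarith⟩, hAk t ht', ← e0] at h2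
      have h3 := h1.sub h2
      rw [sub_self] at h3
      refine h3.congr_of_eventuallyEq ?_
      filter_upwards [eventually_shift_mem hy hxy hx] with s hs
      have hu := uniqueDiffOn_triangle _ hs
      rw [fderivWithin_fun_sub hu (hkd _ hs) (hwd _).differentiableAt.differentiableWithinAt,
        (hwd _).hasFDerivWithinAt.fderivWithin hu]
      simp [kernelDx, kernelDy, kernelSource]
      ring
  have hzero := eq_zero_of_waveOp_eq isOpen_Ioo hZ hb fun t ht => by
    have e1 : deriv (fun t => A t - G t) t = deriv A t - deriv G t :=
      deriv_fun_sub (hA t (hmem' t ht)).differentiableAt (h.analytic t (hmem t ht)).differentiableAt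
    have e2 : deriv A t - deriv G t + liftSnd (α t) * (A t - G t) =
        kernelSource α A t - kernelSource α G t := by
      simp only [kernelSource]; ring
    have e3 : A t - G t = goursatOp (α t, kernelSource α A t) - goursatOp (α t, kernelSource α G t) := by
      rw [← hAeq t ht, ← h.eq t (hmem t ht)]
    rw [e1, e2, e3, goursatOp_eq_add, goursatOp_eq_add, map_sub]
    abel
  -- The equations are assumed only for t > 0; the value at t = 0 follows by continuity in time.
  have hcont : ContinuousOn (fun t => A t - G t) (Ico 0 1) := fun t ht =>
    ((hA t (Ico_subset_Ioo_neg hε' ht)).continuousAt.sub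
      (h.analytic t (Ico_subset_Ioo_neg h.pos ht)).continuousAt).continuousWithinAt
  have hall := Set.EqOn.of_subset_closure (s := Ioo (0 : ℝ) 1) (g := fun _ => (0 : C(triangle, ℝ)))
    (fun t ht => hzero t ht) hcont continuousOn_const Ioo_subset_Ico_self
    (by rw [closure_Ioo zero_ne_one]; exact Ico_subset_Icc_self)
  have hfin : A t = G t := sub_eq_zero.1 (hall ht)
  rw [h.kernelOf_eq (Ico_subset_Ioo_neg h.pos ht) hp, ← hfin, hAk t ht]

end Kernel

/-! ### The Volterra operator K, its derivative D and the inverse of 1 + K -/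

noncomputable section Volterra

/-- Continuous functions on the unit interval. -/
abbrev UnitC : Type := C(Icc (0 : ℝ) 1, ℝ)

lemma continuous_volterra_integrand (g : C(triangle, ℝ)) (u : UnitC) :
    Continuous (Function.uncurry fun x y : ℝ => extChar g (x + y) (x - y) * extI u y) :=
  ((continuous_extChar g).comp (f := fun p : ℝ × ℝ => (p.1 + p.2, p.1 - p.2)) (by fun_prop)).mul
    ((continuous_extI u).comp continuous_snd)

lemma extI_add (f g : UnitC) (x : ℝ) : extI (f + g) x = extI f x + extI g x := rfl

lemma extI_sub (f g : UnitC) (x : ℝ) : extI (f - g) x = extI f x - extI g x := rfl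

lemma extI_mul (f g : UnitC) (x : ℝ) : extI (f * g) x = extI f x * extI g x := rfl

lemma extI_smul (c : ℝ) (f : UnitC) (x : ℝ) : extI (c • f) x = c * extI f x := rfl

lemma extI_coe (f : UnitC) (x : Icc (0 : ℝ) 1) : extI f x = f x := extI_of_mem f x.2

/-- The primitive vanishing at `0`. -/
def primitive : UnitC →L[ℝ] UnitC :=
  LinearMap.mkContinuous
    { toFun := fun f => ⟨fun x => ∫ y in (0 : ℝ)..x, extI f y,
        (continuous_integral_param (f := fun (_ : ℝ) y => extI f y)
          ((continuous_extI f).comp continuous_snd) continuous_const continuous_id).comp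
            continuous_subtype_val⟩
      map_add' := fun f g => ContinuousMap.ext fun x => by
        simp only [extI_add]
        exact intervalIntegral.integral_add ((continuous_extI f).intervalIntegrable _ _)
          ((continuous_extI g).intervalIntegrable _ _)
      map_smul' := fun c f => ContinuousMap.ext fun x => by
        simp only [extI_smul]
        exact intervalIntegral.integral_const_mul _ _ } 1 <| by
    intro f
    rw [ContinuousMap.norm_le _ (by positivity), one_mul]
    intro x
    refine (abs_integral_le_of_abs_le (abs_extI_le f)).trans ?_
    rw [sub_zero, abs_of_nonneg x.2.1]
    exact mul_le_of_le_one_right (norm_nonneg _) x.2.2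

lemma primitive_apply (f : UnitC) (x : Icc (0 : ℝ) 1) :
    primitive f x = ∫ y in (0 : ℝ)..x, extI f y := rfl

lemma extI_primitive (f : UnitC) {x : ℝ} (hx : x ∈ Icc (0 : ℝ) 1) :
    extI (primitive f) x = ∫ y in (0 : ℝ)..x, extI f y := by
  rw [extI_of_mem _ hx]
  rfl

/-- The Volterra operator `u ↦ ∫₀ˣ g(x,y) u(y) dy`. -/
def volterra : C(triangle, ℝ) →L[ℝ] UnitC →L[ℝ] UnitC :=
  LinearMap.mkContinuous₂
    (LinearMap.mk₂ ℝ (fun g u => (⟨fun x => ∫ y in (0 : ℝ)..x, extChar g (x + y) (x - y) * extI u y,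
        (continuous_integral_param (continuous_volterra_integrand g u) continuous_const
          continuous_id).comp continuous_subtype_val⟩ : UnitC))
      (fun g g' u => ContinuousMap.ext fun x => by
        have h := fun g : C(triangle, ℝ) => ((continuous_volterra_integrand g u).comp
          (Continuous.prodMk_right (x : ℝ))).intervalIntegrable (μ := volume) 0 x
        refine Eq.trans (intervalIntegral.integral_congr fun y _ => ?_)
          (intervalIntegral.integral_add (h g) (h g'))
        exact add_mul (extChar g (x + y) (x - y)) (extChar g' (x + y) (x - y)) _)
      (fun c g u => ContinuousMap.ext fun x => by
        refine Eq.trans (intervalIntegral.integral_congr fun y _ => ?_)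
          (intervalIntegral.integral_const_mul c _)
        exact mul_assoc c (extChar g (x + y) (x - y)) _)
      (fun g u u' => ContinuousMap.ext fun x => by
        have h := fun u : UnitC => ((continuous_volterra_integrand g u).comp
          (Continuous.prodMk_right (x : ℝ))).intervalIntegrable (μ := volume) 0 x
        refine Eq.trans (intervalIntegral.integral_congr fun y _ => ?_)
          (intervalIntegral.integral_add (h u) (h u'))
        exact mul_add (extChar g (x + y) (x - y)) (extI u y) (extI u' y))
      (fun c g u => ContinuousMap.ext fun x => by
        refine Eq.trans (intervalIntegral.integral_congr fun y _ => ?_)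
          (intervalIntegral.integral_const_mul c _)
        exact mul_left_comm (extChar g (x + y) (x - y)) c (extI u y)))
    1 <| by
    intro g u
    rw [ContinuousMap.norm_le _ (by positivity), one_mul]
    intro x
    have hb : ∀ y : ℝ, |extChar g (x + y) (x - y) * extI u y| ≤ ‖g‖ * ‖u‖ := fun y => by
      rw [abs_mul]
      exact mul_le_mul (abs_extChar_le _ _ _) (abs_extI_le _ _) (abs_nonneg _) (norm_nonneg _)
    refine (abs_integral_le_of_abs_le hb).trans ?_
    rw [sub_zero, abs_of_nonneg x.2.1]
    exact mul_le_of_le_one_right (by positivity) x.2.2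

lemma volterra_apply (g : C(triangle, ℝ)) (u : UnitC) (x : Icc (0 : ℝ) 1) :
    volterra g u x = ∫ y in (0 : ℝ)..x, extChar g (x + y) (x - y) * extI u y := rfl

/-- Each application integrates y^n / n! from 0 to x, which produces the next term of the
exponential series. -/
lemma abs_volterra_pow_le (g : C(triangle, ℝ)) (u : UnitC) (n : ℕ) (x : Icc (0 : ℝ) 1) :
    |((volterra g) ^ n) u x| ≤ ‖g‖ ^ n * ‖u‖ * ((x : ℝ) ^ n / n.factorial) := by
  induction n generalizing x with
  | zero => simpa using u.norm_coe_le_norm x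
  | succ n ih =>
    rw [pow_succ', mul_apply_eq_comp, volterra_apply]
    set w := (volterra g ^ n) u
    have hb : ∀ y ∈ Ioc (0 : ℝ) x, ‖extChar g (x + y) (x - y) * extI w y‖ ≤
        ‖g‖ * (‖g‖ ^ n * ‖u‖ * (y ^ n / n.factorial)) := fun y hy => by
      have hyI : y ∈ Icc (0 : ℝ) 1 := ⟨hy.1.le, hy.2.trans x.2.2⟩
      rw [norm_mul]
      refine mul_le_mul (abs_extChar_le _ _ _) ?_ (norm_nonneg _) (norm_nonneg _)
      rw [extI_of_mem _ hyI]
      exact ih ⟨y, hyI⟩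
    have h := intervalIntegral.norm_integral_le_of_norm_le (μ := volume) x.2.1
      (Eventually.of_forall hb) (Continuous.intervalIntegrable (by fun_prop) _ _)
    refine h.trans_eq ?_
    simp only [intervalIntegral.integral_const_mul, intervalIntegral.integral_div, integral_pow]
    rw [Nat.factorial_succ]
    push_cast
    field_simp
    simp
    ring

lemma norm_volterra_pow_le (g : C(triangle, ℝ)) (n : ℕ) :
    ‖(volterra g) ^ n‖ ≤ ‖g‖ ^ n / n.factorial := by
  refine ContinuousLinearMap.opNorm_le_bound _ (by positivity) fun u => ?_
  rw [ContinuousMap.norm_le _ (by positivity)]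
  intro x
  refine (abs_volterra_pow_le g u n x).trans ?_
  have : (x : ℝ) ^ n ≤ 1 := pow_le_one₀ x.2.1 x.2.2
  calc ‖g‖ ^ n * ‖u‖ * ((x : ℝ) ^ n / n.factorial) ≤ ‖g‖ ^ n * ‖u‖ * (1 / n.factorial) := by
        gcongr
    _ = _ := by ring

/-- The unit 1 - (-A)^n is the product of 1 + A with a geometric sum commuting with it. Smallness of
a single power suffices; the norm of a Volterra operator itself can be large. -/
lemma isUnit_one_add_of_norm_pow_lt_one {R : Type*} [NormedRing R] [CompleteSpace R] (A : R) {n : ℕ}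
    (h : ‖A ^ n‖ < 1) : IsUnit (1 + A) := by
  have h1 : ‖(-A) ^ n‖ < 1 := by
    rw [neg_pow]
    have : ‖(-1 : R) ^ n * A ^ n‖ = ‖A ^ n‖ := by
      rcases neg_one_pow_eq_or R n with h | h <;> simp [h]
    rwa [this]
  have hu : IsUnit (1 - (-A) ^ n) := isUnit_one_sub_of_norm_lt_one h1
  have e : (1 - -A) * ∑ i ∈ Finset.range n, (-A) ^ i = 1 - (-A) ^ n := mul_neg_geom_sum _ _
  have hc : Commute (1 - -A) (∑ i ∈ Finset.range n, (-A) ^ i) :=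
    Commute.sum_right _ _ _ fun i _ => (Commute.pow_right
      ((Commute.one_left _).sub_left (Commute.refl _)) _)
  have := (hc.isUnit_mul_iff.1 (e ▸ hu)).1
  rwa [sub_neg_eq_add] at this

lemma isUnit_one_add_volterra (g : C(triangle, ℝ)) : IsUnit (1 + volterra g) := by
  have hlim := FloorSemiring.tendsto_pow_div_factorial_atTop ‖g‖
  obtain ⟨n, hn⟩ := (hlim.eventually_lt_const zero_lt_one).exists
  exact isUnit_one_add_of_norm_pow_lt_one (R := UnitC →L[ℝ] UnitC) _ ((norm_volterra_pow_le g n).trans_lt hn)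

/-- Restriction to the diagonal. -/
def diagTrace : C(triangle, ℝ) →L[ℝ] UnitC :=
  LinearMap.mkContinuous
    { toFun := fun g => ⟨fun x => g ⟨(x, x), diag_mem_triangle x.2⟩, by fun_prop⟩
      map_add' := fun _ _ => rfl
      map_smul' := fun _ _ => rfl } 1 <| by
    intro g
    rw [ContinuousMap.norm_le _ (by positivity), one_mul]
    exact fun x => g.norm_coe_le_norm _

lemma diagTrace_apply (g : C(triangle, ℝ)) (x : Icc (0 : ℝ) 1) :
    diagTrace g x = g ⟨(x, x), diag_mem_triangle x.2⟩ := rfl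

/-- The operator `u ↦ d/dx ∫₀ˣ k(x,y) u(y) dy`. -/
def volterraDx (α : ℝ → UnitC) (G : ℝ → C(triangle, ℝ)) (t : ℝ) : UnitC →L[ℝ] UnitC :=
  ContinuousLinearMap.mul ℝ UnitC (diagTrace (G t)) +
    volterra (goursatDxOp (α t, kernelSource α G t))

lemma volterraDx_apply (α : ℝ → UnitC) (G : ℝ → C(triangle, ℝ)) (t : ℝ) (u : UnitC) :
    volterraDx α G t u = diagTrace (G t) * u +
      volterra (goursatDxOp (α t, kernelSource α G t)) u := rfl

section

variable {a : ℝ → ℝ → ℝ} {lam ε : ℝ} {α : ℝ → UnitC} {G : ℝ → C(triangle, ℝ)}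

lemma volterra_eq_of_eqOn {g : C(triangle, ℝ)} {k : ℝ → ℝ → ℝ}
    (hg : ∀ x y (h : (x, y) ∈ triangle), g ⟨(x, y), h⟩ = k x y) (u : UnitC) (x : Icc (0 : ℝ) 1)
    {v : ℝ → ℝ} (hv : ∀ y ∈ Icc (0 : ℝ) 1, extI u y = v y) :
    volterra g u x = ∫ y in (0 : ℝ)..x, k x y * v y := by
  rw [volterra_apply]
  refine intervalIntegral.integral_congr fun y hy => ?_
  rw [uIcc_of_le x.2.1] at hy
  have hp : ((x : ℝ), y) ∈ triangle := ⟨hy.1, hy.2, x.2.2⟩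
  rw [extChar_of_mem _ hp, hg _ _ hp, hv y ⟨hy.1, hy.2.trans x.2.2⟩]

lemma IsGoursatSolution.volterra_apply (h : IsGoursatSolution a lam ε α G) {t : ℝ}
    (ht : t ∈ Ioo (-ε) 1) (u : UnitC) (x : Icc (0 : ℝ) 1) {v : ℝ → ℝ}
    (hv : ∀ y ∈ Icc (0 : ℝ) 1, extI u y = v y) :
    volterra (G t) u x = ∫ y in (0 : ℝ)..x,
      waveKernel (extI (α t)) (extChar (kernelSource α G t)) x y * v y :=
  volterra_eq_of_eqOn (fun _ _ hp => (h.kernelOf_eq ht hp).symm) u x hv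

lemma IsGoursatSolution.volterraDx_apply (h : IsGoursatSolution a lam ε α G) {t : ℝ}
    (ht : t ∈ Ioo (-ε) 1) (u : UnitC) (x : Icc (0 : ℝ) 1) {v : ℝ → ℝ}
    (hv : ∀ y ∈ Icc (0 : ℝ) 1, extI u y = v y) :
    volterraDx α G t u x = waveKernel (extI (α t)) (extChar (kernelSource α G t)) x x * v x +
      ∫ y in (0 : ℝ)..x, waveKernelDx (extI (α t)) (extChar (kernelSource α G t)) x y * v y := by
  rw [_root_.volterraDx_apply, ContinuousMap.add_apply, ContinuousMap.mul_apply, diagTrace_apply,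
    ← h.kernelOf_eq ht, ← hv x x.2, extI_coe]
  congr 1
  exact volterra_eq_of_eqOn (fun _ _ _ => rfl) u x hv

/-- `(Ku)' = Du`. -/
lemma IsGoursatSolution.volterra_eq_primitive (h : IsGoursatSolution a lam ε α G) {t : ℝ}
    (ht : t ∈ Ioo (-ε) 1) (u : UnitC) :
    volterra (G t) u = primitive (volterraDx α G t u) := by
  ext x
  have hα := continuous_extI (α t)
  have hF := continuous_extChar (kernelSource α G t)
  have hd := hasDerivAt_integral_waveKernel_mul hα hF (continuous_extI u)
  have hc : Continuous fun x => waveKernel (extI (α t)) (extChar (kernelSource α G t)) x x *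
      extI u x + ∫ y in (0 : ℝ)..x,
        waveKernelDx (extI (α t)) (extChar (kernelSource α G t)) x y * extI u y :=
    (((continuous_waveKernel hα hF).comp (continuous_id.prodMk continuous_id)).mul
      (continuous_extI u)).add (continuous_integral_param
        (f := fun x y => waveKernelDx (extI (α t)) (extChar (kernelSource α G t)) x y * extI u y)
        ((continuous_waveKernelDx hα hF).mul
        ((continuous_extI u).comp continuous_snd)) continuous_const continuous_id)
  have hi := intervalIntegral.integral_eq_sub_of_hasDerivAt (a := 0) (b := x) (fun x _ => hd x)
    (hc.intervalIntegrable _ _)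
  rw [intervalIntegral.integral_same, sub_zero] at hi
  rw [h.volterra_apply ht u x (fun _ _ => rfl), ← hi, primitive_apply]
  refine intervalIntegral.integral_congr fun y hy => ?_
  rw [uIcc_of_le x.2.1] at hy
  have hyI : y ∈ Icc (0 : ℝ) 1 := ⟨hy.1, hy.2.trans x.2.2⟩
  rw [extI_of_mem (volterraDx α G t u) hyI]
  exact (h.volterraDx_apply ht u ⟨y, hyI⟩ fun _ _ => rfl).symm

/-- The second derivative of `∫₀ˣ k(x,y) u(y) dy` for `C¹` and `C²` functions `u`. -/
lemma IsGoursatSolution.volterraDx_primitive (h : IsGoursatSolution a lam ε α G) {t : ℝ}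
    (ht : t ∈ Ioo (-ε) 1) (P : UnitC) :
    ∃ Z : UnitC, volterraDx α G t (primitive P) = primitive Z ∧
      ∀ (c : ℝ) (Q : UnitC), P = ContinuousMap.const _ c + primitive Q →
        Z = α t * primitive P + volterra (G t) Q + volterra (kernelSource α G t) (primitive P) := by
  have hα := continuous_extI (α t)
  set F := extChar (kernelSource α G t) with hFdef
  have hF : Continuous (Function.uncurry F) := continuous_extChar (kernelSource α G t)
  have hP := continuous_extI P
  set v : ℝ → ℝ := fun x => ∫ y in (0 : ℝ)..x, extI P y with hv
  have hvd : ∀ x, HasDerivAt v (extI P x) x := fun x => (hP.integral_hasStrictDerivAt 0 x).hasDerivAt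
  have hvc : Continuous v := continuous_iff_continuousAt.2 fun x => (hvd x).continuousAt
  have hv0 : v 0 = 0 := intervalIntegral.integral_same
  have hveq : ∀ y ∈ Icc (0 : ℝ) 1, extI (primitive P) y = v y := fun y hy => extI_primitive P hy
  have hd := hasDerivAt_deriv_integral_waveKernel_mul hα hF hvd hP hv0
  set z : ℝ → ℝ := fun x => extI (α t) x * v x + (waveKernel (extI (α t)) F x x * extI P x -
    ∫ y in (0 : ℝ)..x, waveKernelDy (extI (α t)) F x y * extI P y) +
      ∫ y in (0 : ℝ)..x, F (x + y) (x - y) * v y with hz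
  have hzc : Continuous z := by
    refine ((hα.mul hvc).add ((((continuous_waveKernel hα hF).comp
      (continuous_id.prodMk continuous_id)).mul hP).sub ?_)).add ?_
    · exact continuous_integral_param (f := fun x y => waveKernelDy (extI (α t)) F x y * extI P y)
        ((continuous_waveKernelDy hα hF).mul (hP.comp continuous_snd)) continuous_const continuous_id
    · exact continuous_integral_param (f := fun x y => F (x + y) (x - y) * v y)
        ((hF.comp (f := fun p : ℝ × ℝ => (p.1 + p.2, p.1 - p.2)) (by fun_prop)).mul
          (hvc.comp continuous_snd)) continuous_const continuous_id
  -- Z is the formula before the last integration by parts, so it makes sense when P is merely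
  -- continuous. Only the second clause uses that P is C¹; this separation is needed to recover the
  -- regularity of u from that of w.
  refine ⟨⟨fun x => z x, hzc.comp continuous_subtype_val⟩, ?_, ?_⟩
  · ext x
    have hi := intervalIntegral.integral_eq_sub_of_hasDerivAt (a := 0) (b := x) (fun x _ => hd x)
      (hzc.intervalIntegrable _ _)
    rw [intervalIntegral.integral_same, hv0, mul_zero, add_zero, sub_zero] at hi
    rw [h.volterraDx_apply ht _ x hveq, ← hi, primitive_apply]
    refine intervalIntegral.integral_congr fun y hy => ?_
    rw [uIcc_of_le x.2.1] at hy
    have hyI : y ∈ Icc (0 : ℝ) 1 := ⟨hy.1, hy.2.trans x.2.2⟩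
    exact (extI_of_mem (⟨fun x => z x, hzc.comp continuous_subtype_val⟩ : UnitC) hyI).symm
  · intro c Q hPQ
    have hQ := continuous_extI Q
    have hpq : ∀ x ∈ Ioo (0 : ℝ) 1, HasDerivAt (extI P) (extI Q x) x := by
      intro x hx
      refine ((hQ.integral_hasStrictDerivAt 0 x).hasDerivAt.const_add c).congr_of_eventuallyEq ?_
      filter_upwards [isOpen_Ioo.mem_nhds hx] with y hy
      rw [hPQ, extI_add, extI_primitive Q ⟨hy.1.le, hy.2.le⟩]
      rfl
    ext x
    -- The boundary term at y = 0 vanishes because k(x,0) = 0, and the bracket in z becomes K Q.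
    have h1 := integral_waveKernel_mul_eq hα hF hP hQ hpq x.2
    simp only [ContinuousMap.coe_mk, ContinuousMap.add_apply, ContinuousMap.mul_apply]
    rw [h.volterra_apply ht Q x (fun _ _ => rfl), h1, hz]
    simp only
    rw [extI_coe, volterra_eq_of_eqOn (k := fun x y => F (x + y) (x - y))
      (fun _ _ hp => (extChar_of_mem _ hp).symm) _ x hveq]
    rfl

lemma IsGoursatSolution.continuousOn_volterraDx (h : IsGoursatSolution a lam ε α G) :
    ContinuousOn (volterraDx α G) (Ioo (-ε) 1) := by
  have hG := h.analytic.continuousOn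
  have hα := h.analytic_coeff.continuousOn
  have hG' : ContinuousOn (deriv G) (Ioo (-ε) 1) := h.analytic.deriv.continuousOn
  have hs : ContinuousOn (kernelSource α G) (Ioo (-ε) 1) :=
    hG'.add ((liftSnd.continuous.comp_continuousOn hα).mul hG)
  exact ((ContinuousLinearMap.mul ℝ UnitC).continuous.comp_continuousOn
    (diagTrace.continuous.comp_continuousOn hG)).add
      (volterra.continuous.comp_continuousOn (goursatDxOp.continuous.comp_continuousOn (hα.prodMk hs)))

lemma IsGoursatSolution.hasDerivAt_volterra (h : IsGoursatSolution a lam ε α G) {t : ℝ}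
    (ht : t ∈ Ioo (-ε) 1) :
    HasDerivAt (fun t => 1 + volterra (G t)) (volterra (deriv G t)) t :=
  (HasFDerivAt.comp_hasDerivAt (l := volterra) t (ContinuousLinearMap.hasFDerivAt volterra)
    (h.analytic t ht).differentiableAt.hasDerivAt).const_add _

/-- `V(k_t + (a + lam) k) = V(k_t) + V(k) (a + lam)`. -/
lemma volterra_kernelSource (α : ℝ → UnitC) (G : ℝ → C(triangle, ℝ)) (t : ℝ) (u : UnitC) :
    volterra (kernelSource α G t) u = volterra (deriv G t) u + volterra (G t) (α t * u) := by
  rw [kernelSource, map_add, add_apply]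
  congr 1
  ext x
  rw [volterra_apply, volterra_apply]
  refine intervalIntegral.integral_congr fun y hy => ?_
  rw [uIcc_of_le x.2.1] at hy
  have hp : ((x : ℝ), y) ∈ triangle := ⟨hy.1, hy.2, x.2.2⟩
  simp only [extChar_of_mem _ hp, ContinuousMap.mul_apply, liftSnd_apply, extI_mul]
  ring

end

end Volterra

/-! ### Equivalence of the closed loop with the damped heat equation -/

noncomputable section Loops

/-- The boundary condition at `x = 1` in terms of the transformed state and its derivative. -/
def LoopBC : Feedback → UnitC → UnitC → Prop
  | .dirichlet, w, _ => w 1 = 0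
  | .neumann, _, p => p 1 = 0

lemma LoopBC.sub {b : Feedback} {w p w' p' : UnitC} (h : LoopBC b w p) (h' : LoopBC b w' p') :
    LoopBC b (w - w') (p - p') := by
  cases b <;> simp_all [LoopBC]

/-- `w = ∫₀ˣ p` solves `w_t = w_xx - lam w` on `(0,τ)`, with `q = w_xx`, `w(0) = 0` and the
homogeneous boundary condition at `1`. -/
structure HeatLoop (lam : ℝ) (b : Feedback) (τ : ℝ) (p q : ℝ → UnitC) : Prop where
  space : ∀ t ∈ Ioo 0 τ, ∃ c : ℝ, p t = ContinuousMap.const _ c + primitive (q t)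
  time : ∀ t ∈ Ioo 0 τ,
    HasDerivAt (fun s => primitive (p s)) (q t - lam • primitive (p t)) t
  continuousOn : ContinuousOn q (Ioo 0 τ)
  bc : ∀ t ∈ Ioo 0 τ, LoopBC b (primitive (p t)) (p t)

/-- `u = ∫₀ˣ P` solves `u_t = u_xx + a u` on `(0,τ)`, with `α = a + lam`, `Q = u_xx`, `u(0) = 0` and
the feedback law at `1`. -/
structure ClosedLoop (α : ℝ → UnitC) (G : ℝ → C(triangle, ℝ)) (lam : ℝ) (b : Feedback) (τ : ℝ)
    (P Q : ℝ → UnitC) : Prop where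
  space : ∀ t ∈ Ioo 0 τ, ∃ c : ℝ, P t = ContinuousMap.const _ c + primitive (Q t)
  time : ∀ t ∈ Ioo 0 τ, HasDerivAt (fun s => primitive (P s))
    (Q t + (α t * primitive (P t) - lam • primitive (P t))) t
  continuousOn : ContinuousOn Q (Ioo 0 τ)
  bc : ∀ t ∈ Ioo 0 τ, LoopBC b ((1 + volterra (G t)) (primitive (P t)))
    (P t + volterraDx α G t (primitive (P t)))

lemma ClosedLoop.sub {α : ℝ → UnitC} {G : ℝ → C(triangle, ℝ)} {lam τ : ℝ} {b : Feedback}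
    {P Q P' Q' : ℝ → UnitC} (h : ClosedLoop α G lam b τ P Q) (h' : ClosedLoop α G lam b τ P' Q') :
    ClosedLoop α G lam b τ (fun t => P t - P' t) (fun t => Q t - Q' t) where
  space := fun t ht => by
    obtain ⟨c, hc⟩ := h.space t ht
    obtain ⟨c', hc'⟩ := h'.space t ht
    refine ⟨c - c', ?_⟩
    rw [hc, hc', map_sub]
    ext x
    simp only [ContinuousMap.add_apply, ContinuousMap.sub_apply, ContinuousMap.const_apply]
    ring
  time := fun t ht => by
    have := (h.time t ht).sub (h'.time t ht)
    simp only [map_sub]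
    convert! this using 1
    rw [mul_sub, smul_sub]
    abel
  continuousOn := h.continuousOn.sub h'.continuousOn
  bc := fun t ht => by
    have := (h.bc t ht).sub (h'.bc t ht)
    simp only [map_sub]
    convert this using 1
    abel

/-- The inverse of `1 + K`. -/
def volterraInv (G : ℝ → C(triangle, ℝ)) (t : ℝ) : UnitC →L[ℝ] UnitC :=
  Ring.inverse (1 + volterra (G t))

lemma volterraInv_apply_apply (G : ℝ → C(triangle, ℝ)) (t : ℝ) (u : UnitC) :
    volterraInv G t ((1 + volterra (G t)) u) = u := by
  have h := Ring.inverse_mul_cancel _ (isUnit_one_add_volterra (G t))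
  exact congrArg (fun A : UnitC →L[ℝ] UnitC => A u) h

lemma apply_volterraInv_apply (G : ℝ → C(triangle, ℝ)) (t : ℝ) (u : UnitC) :
    (1 + volterra (G t)) (volterraInv G t u) = u := by
  have h := Ring.mul_inverse_cancel _ (isUnit_one_add_volterra (G t))
  exact congrArg (fun A : UnitC →L[ℝ] UnitC => A u) h

lemma one_add_volterra_apply (G : ℝ → C(triangle, ℝ)) (t : ℝ) (u : UnitC) :
    (1 + volterra (G t)) u = u + volterra (G t) u := rfl

section

variable {a : ℝ → ℝ → ℝ} {lam ε : ℝ} {α : ℝ → UnitC} {G : ℝ → C(triangle, ℝ)}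

lemma IsGoursatSolution.differentiableAt_volterraInv (h : IsGoursatSolution a lam ε α G) {t : ℝ}
    (ht : t ∈ Ioo (-ε) 1) : DifferentiableAt ℝ (volterraInv G) t := by
  have h1 : DifferentiableAt ℝ (fun t => 1 + volterra (G t)) t :=
    ⟨_, (h.hasDerivAt_volterra ht).hasFDerivAt⟩
  obtain ⟨u, hu⟩ := isUnit_one_add_volterra (G t)
  have h2 : DifferentiableAt ℝ (Ring.inverse : (UnitC →L[ℝ] UnitC) → _) (1 + volterra (G t)) := by
    rw [← hu]
    exact differentiableAt_inverse (𝕜 := ℝ) (R := UnitC →L[ℝ] UnitC) (Units.isUnit u)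
  exact DifferentiableAt.comp (𝕜 := ℝ) (E := ℝ) (F := UnitC →L[ℝ] UnitC) (G := UnitC →L[ℝ] UnitC)
    (f := fun t => 1 + volterra (G t)) (g := (Ring.inverse : (UnitC →L[ℝ] UnitC) → _)) t h2 h1

lemma IsGoursatSolution.continuousOn_volterraInv (h : IsGoursatSolution a lam ε α G) :
    ContinuousOn (volterraInv G) (Ioo (-ε) 1) := fun _ ht =>
  (h.differentiableAt_volterraInv ht).continuousAt.continuousWithinAt

lemma IsGoursatSolution.Ioo_subset (h : IsGoursatSolution a lam ε α G) {τ : ℝ} (hτ : τ ≤ 1) :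
    Ioo 0 τ ⊆ Ioo (-ε) 1 := fun t ht => ⟨by linarith [ht.1, h.pos], ht.2.trans_le hτ⟩

/-- With u the primitive of P this says that P + Du is the derivative of w = (1 + K)u. -/
lemma IsGoursatSolution.primitive_add_volterraDx (h : IsGoursatSolution a lam ε α G) {t : ℝ}
    (ht : t ∈ Ioo (-ε) 1) (P : UnitC) :
    primitive (P + volterraDx α G t (primitive P)) = (1 + volterra (G t)) (primitive P) := by
  rw [map_add, ← h.volterra_eq_primitive ht, one_add_volterra_apply]

lemma IsGoursatSolution.continuousOn_source (h : IsGoursatSolution a lam ε α G) {τ : ℝ} (hτ : τ ≤ 1)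
    {U : ℝ → UnitC} (hU : ContinuousOn U (Ioo 0 τ)) :
    ContinuousOn (fun t => α t * U t + volterra (deriv G t) (U t) + volterra (G t) (α t * U t))
      (Ioo 0 τ) := by
  have hs := h.Ioo_subset hτ
  have hG := (h.analytic.continuousOn).mono hs
  have hα := (h.analytic_coeff.continuousOn).mono hs
  have hG' : ContinuousOn (deriv G) (Ioo 0 τ) := (h.analytic.deriv.continuousOn).mono hs
  have hαU := hα.mul hU
  exact (hαU.add ((volterra.continuous.comp_continuousOn hG').clm_apply hU)).add
    ((volterra.continuous.comp_continuousOn hG).clm_apply hαU)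

/-- The backstepping transformation maps the closed loop to the heat equation. -/
theorem ClosedLoop.heatLoop (h : IsGoursatSolution a lam ε α G) {b : Feedback} {τ : ℝ}
    (hτ : τ ≤ 1) {P Q : ℝ → UnitC} (hc : ClosedLoop α G lam b τ P Q) :
    ∃ q, HeatLoop lam b τ (fun t => P t + volterraDx α G t (primitive (P t))) q := by
  have hs := h.Ioo_subset hτ
  have hU : ContinuousOn (fun t => primitive (P t)) (Ioo 0 τ) := fun t ht =>
    (hc.time t ht).continuousAt.continuousWithinAt
  -- The witness is w_xx = Q + KQ + αu + K_t u + K(αu), where αu comes from the diagonal condition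
  -- and the last two terms from the wave equation. In w_t = K_t u + (1 + K)(Q + αu - λu) the same
  -- terms occur, and the difference is -λw.
  refine ⟨fun t => (1 + volterra (G t)) (Q t) + (α t * primitive (P t) +
    volterra (deriv G t) (primitive (P t)) + volterra (G t) (α t * primitive (P t))), ?_, ?_, ?_, ?_⟩
  · intro t ht
    obtain ⟨c, hPc⟩ := hc.space t ht
    obtain ⟨Z, hZ, hZ'⟩ := h.volterraDx_primitive (hs ht) (P t)
    refine ⟨c, ?_⟩
    rw [hZ, hZ' c (Q t) hPc, volterra_kernelSource, one_add_volterra_apply]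
    nth_rewrite 1 [hPc]
    rw [add_assoc, ← map_add]
    congr 2
    abel
  · intro t ht
    have h1 := (h.hasDerivAt_volterra (hs ht)).clm_apply (hc.time t ht)
    have h2 := h1.congr_of_eventuallyEq (f₁ := fun s => primitive
      (P s + volterraDx α G s (primitive (P s)))) (by
        filter_upwards [isOpen_Ioo.mem_nhds ht] with s hs'
        exact h.primitive_add_volterraDx (hs hs') _)
    convert! h2 using 1
    rw [h.primitive_add_volterraDx (hs ht)]
    simp only [one_add_volterra_apply, map_add, map_sub, map_smul, smul_add]
    abel
  · exact (((continuousOn_const.add (volterra.continuous.comp_continuousOn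
      ((h.analytic.continuousOn).mono hs)))).clm_apply hc.continuousOn).add
        (h.continuousOn_source hτ hU)
  · intro t ht
    rw [h.primitive_add_volterraDx (hs ht)]
    exact hc.bc t ht

/-- For U = (1 + K)⁻¹ w the primitive of p - DU is w - KU = U, so p - DU is the gradient of U. -/
lemma IsGoursatSolution.primitive_sub_volterraDx (h : IsGoursatSolution a lam ε α G) {t : ℝ}
    (ht : t ∈ Ioo (-ε) 1) (p : UnitC) :
    primitive (p - volterraDx α G t (volterraInv G t (primitive p))) =
      volterraInv G t (primitive p) := by
  rw [map_sub, ← h.volterra_eq_primitive ht, sub_eq_iff_eq_add, ← one_add_volterra_apply,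
    apply_volterraInv_apply]

/-- The inverse transformation maps the heat equation to the closed loop. -/
theorem HeatLoop.closedLoop (h : IsGoursatSolution a lam ε α G) {b : Feedback} {τ : ℝ}
    (hτ : τ ≤ 1) {p q : ℝ → UnitC} (hh : HeatLoop lam b τ p q) :
    ∃ Q, ClosedLoop α G lam b τ
      (fun t => p t - volterraDx α G t (volterraInv G t (primitive (p t)))) Q := by
  have hs := h.Ioo_subset hτ
  set U : ℝ → UnitC := fun t => volterraInv G t (primitive (p t)) with hUdef
  have hUd : ∀ t ∈ Ioo 0 τ, DifferentiableAt ℝ U t := fun t ht =>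
    (h.differentiableAt_volterraInv (hs ht)).clm_apply (hh.time t ht).differentiableAt
  have hU : ContinuousOn U (Ioo 0 τ) := fun t ht => (hUd t ht).continuousAt.continuousWithinAt
  have hTU : ∀ t, (1 + volterra (G t)) (U t) = primitive (p t) := fun t =>
    apply_volterraInv_apply _ _ _
  have hJ : ∀ t ∈ Ioo 0 τ, primitive (p t - volterraDx α G t (U t)) = U t := fun t ht =>
    h.primitive_sub_volterraDx (hs ht) _
  set R : ℝ → UnitC := fun t => α t * U t + volterra (deriv G t) (U t) + volterra (G t) (α t * U t)
    with hR
  set Q : ℝ → UnitC := fun t => volterraInv G t (q t - R t) with hQdef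
  have hTQ : ∀ t, Q t + volterra (G t) (Q t) = q t - R t := fun t => by
    rw [← one_add_volterra_apply, hQdef, apply_volterraInv_apply]
  refine ⟨Q, ?_, ?_, ?_, ?_⟩
  · intro t ht
    obtain ⟨c, hpc⟩ := hh.space t ht
    obtain ⟨Z, hZ, hZ'⟩ := h.volterraDx_primitive (hs ht) (p t - volterraDx α G t (U t))
    rw [hJ t ht] at hZ hZ'
    -- Both p and DU are primitives up to a constant, hence the gradient of U is C¹. Only now can Z
    -- be computed, and q - Z is identified with Q by applying the injective operator 1 + K.
    have hP : p t - volterraDx α G t (U t) = ContinuousMap.const _ c + primitive (q t - Z) := by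
      rw [hZ, hpc, map_sub]
      abel
    have hZe := hZ' c _ hP
    have hqZ : q t - Z = Q t := by
      have : (1 + volterra (G t)) (q t - Z) = q t - R t := by
        rw [one_add_volterra_apply, hR, ← sub_eq_zero]
        nth_rewrite 1 [hZe]
        rw [volterra_kernelSource]
        simp only [map_sub]
        abel
      rw [hQdef]
      simp only
      rw [← this, volterraInv_apply_apply]
    exact ⟨c, by rw [← hqZ]; exact hP⟩
  · intro t ht
    have h1 := (h.hasDerivAt_volterra (hs ht)).clm_apply (hUd t ht).hasDerivAt
    have h2 : HasDerivAt (fun t => (1 + volterra (G t)) (U t)) (q t - lam • primitive (p t)) t := by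
      simp only [hTU]
      exact hh.time t ht
    obtain ⟨X, hX⟩ : ∃ X, X = volterra (deriv G t) (U t) := ⟨_, rfl⟩
    have hRt : R t = α t * U t + X + volterra (G t) (α t * U t) := by rw [hX]
    have h3 : X + (1 + volterra (G t)) (deriv U t) =
        q t - lam • primitive (p t) := by rw [hX]; exact h1.unique h2
    -- Differentiating (1 + K)U = w determines (1 + K)U_t; the invertibility of 1 + K then gives
    -- U_t.
    have h4 : deriv U t = Q t + (α t * U t - lam • U t) := by
      rw [← volterraInv_apply_apply G t (deriv U t),
        ← volterraInv_apply_apply G t (Q t + (α t * U t - lam • U t))]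
      congr 1
      rw [← eq_sub_iff_add_eq'] at h3
      rw [h3, ← hTU t]
      simp only [one_add_volterra_apply, map_add, map_sub, map_smul, smul_add]
      have := hTQ t
      rw [eq_sub_iff_add_eq] at this
      rw [← this, hRt]
      abel
    have h5 := (hUd t ht).hasDerivAt
    rw [h4] at h5
    rw [hJ t ht]
    refine h5.congr_of_eventuallyEq ?_
    filter_upwards [isOpen_Ioo.mem_nhds ht] with s hs'
    exact hJ s hs'
  · exact ((h.continuousOn_volterraInv).mono hs).clm_apply
      (hh.continuousOn.sub (h.continuousOn_source hτ hU))
  · intro t ht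
    rw [hJ t ht, hTU t, sub_add_cancel]
    exact hh.bc t ht

end

end Loops

/-! ### Energy identity and exponential decay -/

noncomputable section Energy

open scoped RealInnerProductSpace

/-- The Hilbert space `L²(0,1)`. -/
abbrev UnitL2 : Type := Lp ℝ 2 (volume : Measure (Icc (0 : ℝ) 1))

instance : IsProbabilityMeasure (volume : Measure (Icc (0 : ℝ) 1)) :=
  inferInstanceAs (IsProbabilityMeasure (volume : Measure unitInterval))

/-- The embedding of continuous functions into `L²(0,1)`. -/
def toL2 : UnitC →L[ℝ] UnitL2 := ContinuousMap.toLp 2 volume ℝ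

lemma integral_unit (F : ℝ → ℝ) : ∫ x : Icc (0 : ℝ) 1, F x = ∫ x in (0 : ℝ)..1, F x := by
  rw [intervalIntegral.integral_of_le zero_le_one, ← integral_Icc_eq_integral_Ioc]
  exact integral_subtype_comap measurableSet_Icc F

lemma coeFn_toL2 (f : UnitC) : toL2 f =ᵐ[volume] f := ContinuousMap.coeFn_toLp volume f

lemma inner_toL2 (f g : UnitC) : ⟪toL2 f, toL2 g⟫ = ∫ x in (0 : ℝ)..1, extI f x * extI g x := by
  rw [← integral_unit, L2.inner_def]
  refine integral_congr_ae ?_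
  filter_upwards [coeFn_toL2 f, coeFn_toL2 g] with x h1 h2
  rw [h1, h2, extI_coe, extI_coe]
  exact mul_comm _ _

lemma norm_sq_toL2 (f : UnitC) : ‖toL2 f‖ ^ 2 = ∫ x in (0 : ℝ)..1, extI f x ^ 2 := by
  rw [← real_inner_self_eq_norm_sq, inner_toL2]
  simp only [sq]

lemma norm_toL2_le (f : UnitC) : ‖toL2 f‖ ≤ ‖f‖ := by
  refine le_of_sq_le_sq ?_ (norm_nonneg _)
  rw [norm_sq_toL2]
  have h := intervalIntegral.integral_mono_on (μ := volume) (f := fun x => extI f x ^ 2)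
    (g := fun _ => ‖f‖ ^ 2) zero_le_one
    (((continuous_extI f).pow 2).intervalIntegrable _ _) (by simp) fun x _ => by
      rw [← sq_abs]
      exact pow_le_pow_left₀ (abs_nonneg _) (abs_extI_le f x) 2
  simpa using h

lemma abs_primitive_le (f : UnitC) (x : Icc (0 : ℝ) 1) : |primitive f x| ≤ ‖toL2 f‖ := by
  have hc := continuous_extI f
  have h1 : |primitive f x| ≤ ∫ y in (0 : ℝ)..1, |extI f y| := by
    rw [primitive_apply]
    refine (intervalIntegral.abs_integral_le_integral_abs x.2.1).trans ?_
    exact intervalIntegral.integral_mono_interval le_rfl x.2.1 x.2.2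
      (Eventually.of_forall fun _ => abs_nonneg _) (hc.abs.intervalIntegrable _ _)
  -- Cauchy–Schwarz on the unit interval, in the form that the variance of |f| is nonnegative.
  set m := ∫ y in (0 : ℝ)..1, |extI f y| with hm
  have h2 : 0 ≤ ∫ y in (0 : ℝ)..1, (|extI f y| - m) ^ 2 :=
    intervalIntegral.integral_nonneg zero_le_one fun _ _ => sq_nonneg _
  have e : ∀ y, (|extI f y| - m) ^ 2 = (extI f y ^ 2 - 2 * m * |extI f y|) + m ^ 2 := fun y => by
    rw [← sq_abs (extI f y)]; ring
  simp only [e] at h2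
  rw [intervalIntegral.integral_add (Continuous.intervalIntegrable (by fun_prop) _ _) (by simp),
    intervalIntegral.integral_sub (Continuous.intervalIntegrable (by fun_prop) _ _)
      (Continuous.intervalIntegrable (by fun_prop) _ _), intervalIntegral.integral_const_mul,
    ← hm, ← norm_sq_toL2] at h2
  simp only [intervalIntegral.integral_const, smul_eq_mul, sub_zero, one_mul] at h2
  refine h1.trans (le_of_sq_le_sq ?_ (norm_nonneg _))
  linarith

lemma norm_primitive_le (f : UnitC) : ‖primitive f‖ ≤ ‖toL2 f‖ := by
  rw [ContinuousMap.norm_le _ (norm_nonneg _)]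
  exact abs_primitive_le f

/-- Integration by parts. -/
lemma inner_toL2_eq_sub (c : ℝ) (g h : UnitC) :
    ⟪toL2 (ContinuousMap.const (Icc (0 : ℝ) 1) c + primitive g), toL2 h⟫ =
      (ContinuousMap.const (Icc (0 : ℝ) 1) c + primitive g) 1 * primitive h 1 - ⟪toL2 g, toL2 (primitive h)⟫ := by
  have hg := continuous_extI g
  have hh := continuous_extI h
  have h1 := intervalIntegral.integral_mul_deriv_eq_deriv_mul (a := 0) (b := 1)
    (u := fun x => c + ∫ y in (0 : ℝ)..x, extI g y) (v := fun x => ∫ y in (0 : ℝ)..x, extI h y)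
    (u' := extI g) (v' := extI h)
    (fun x _ => (hg.integral_hasStrictDerivAt 0 x).hasDerivAt.const_add c)
    (fun x _ => (hh.integral_hasStrictDerivAt 0 x).hasDerivAt)
    (hg.intervalIntegrable _ _) (hh.intervalIntegrable _ _)
  simp only [intervalIntegral.integral_same, mul_zero, sub_zero] at h1
  rw [inner_toL2, inner_toL2]
  refine Eq.trans ?_ (h1.trans ?_)
  · refine intervalIntegral.integral_congr fun x hx => ?_
    rw [uIcc_of_le zero_le_one] at hx
    rw [extI_add, extI_primitive g hx]
    rfl
  · congr 1
    refine intervalIntegral.integral_congr fun x hx => ?_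
    rw [uIcc_of_le zero_le_one] at hx
    rw [extI_primitive h hx]

/-- For either boundary condition one of the two factors vanishes at 1. This kills the boundary term
of an integration by parts between two different times. -/
lemma LoopBC.mul_eq_zero {b : Feedback} {w w' p p' : UnitC} (h : LoopBC b w p)
    (h' : LoopBC b w' p') : (p + p') 1 * (w - w') 1 = 0 := by
  cases b <;> simp_all [LoopBC]

/-- The energy identity for the heat equation. -/
lemma HeatLoop.hasDerivAt_energy {lam τ : ℝ} {b : Feedback} {p q : ℝ → UnitC}
    (h : HeatLoop lam b τ p q) {t : ℝ} (ht : t ∈ Ioo 0 τ) :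
    HasDerivAt (fun s => ‖toL2 (p s)‖ ^ 2)
      (-2 * ‖toL2 (q t)‖ ^ 2 - 2 * lam * ‖toL2 (p t)‖ ^ 2) t := by
  -- Only w, not p = w_x, is known to be differentiable in time. Writing the difference of squares
  -- as ⟪p s + p t, p s - p t⟫ and integrating by parts moves the x-derivative off the time
  -- increment, so that the difference quotient of w appears.
  have hdiff : ∀ s ∈ Ioo 0 τ, ‖toL2 (p s)‖ ^ 2 - ‖toL2 (p t)‖ ^ 2 =
      -⟪toL2 (q s + q t), toL2 (primitive (p s) - primitive (p t))⟫ := by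
    intro s hs
    obtain ⟨c, hc⟩ := h.space t ht
    obtain ⟨d, hd⟩ := h.space s hs
    have e : p s + p t = ContinuousMap.const _ (d + c) + primitive (q s + q t) := by
      rw [hc, hd, map_add]
      ext x
      simp only [ContinuousMap.add_apply, ContinuousMap.const_apply]
      ring
    have h1 := inner_toL2_eq_sub (d + c) (q s + q t) (p s - p t)
    rw [← e, map_sub primitive, (h.bc s hs).mul_eq_zero (h.bc t ht), zero_sub] at h1
    rw [← h1, map_add, map_sub, inner_add_left, inner_sub_right, inner_sub_right,
      real_inner_self_eq_norm_sq, real_inner_self_eq_norm_sq, real_inner_comm (toL2 (p t))]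
    ring
  have hself : ⟪toL2 (q t), toL2 (primitive (p t))⟫ = -‖toL2 (p t)‖ ^ 2 := by
    obtain ⟨c, hc⟩ := h.space t ht
    have h1 := inner_toL2_eq_sub c (q t) (p t)
    rw [← hc] at h1
    have h0 : (p t) 1 * primitive (p t) 1 = 0 := by
      have := h.bc t ht
      cases b
      · rw [show primitive (p t) 1 = 0 from this, mul_zero]
      · rw [show (p t) 1 = 0 from this, zero_mul]
    rw [h0, zero_sub, real_inner_self_eq_norm_sq] at h1
    linarith
  rw [hasDerivAt_iff_tendsto_slope]
  have hs1 := hasDerivAt_iff_tendsto_slope.1 (h.time t ht)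
  have hnhds : Ioo 0 τ ∈ 𝓝 t := isOpen_Ioo.mem_nhds ht
  have hq : Tendsto q (𝓝[≠] t) (𝓝 (q t)) :=
    ((h.continuousOn t ht).continuousAt hnhds).tendsto.mono_left nhdsWithin_le_nhds
  have h2 : Tendsto (fun s => -⟪toL2 (q s + q t), toL2 (slope (fun s => primitive (p s)) t s)⟫)
      (𝓝[≠] t) (𝓝 (-⟪toL2 (q t + q t), toL2 (q t - lam • primitive (p t))⟫)) :=
    (((toL2.continuous.tendsto _).comp (hq.add_const _)).inner
      ((toL2.continuous.tendsto _).comp hs1)).neg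
  have e : -⟪toL2 (q t + q t), toL2 (q t - lam • primitive (p t))⟫ =
      -2 * ‖toL2 (q t)‖ ^ 2 - 2 * lam * ‖toL2 (p t)‖ ^ 2 := by
    rw [map_add, map_sub, map_smul, inner_add_left, inner_sub_right, inner_smul_right, hself,
      real_inner_self_eq_norm_sq]
    ring
  rw [← e]
  refine h2.congr' ?_
  filter_upwards [nhdsWithin_le_nhds hnhds] with s hs
  rw [slope_def_field, hdiff s hs, slope_def_module, map_smul, inner_smul_right]
  ring

/-- By the energy identity the function exp(2λr) ‖w_x(r)‖² has nonpositive derivative. The initial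
time s stays positive here, since nothing is assumed at t = 0. -/
lemma HeatLoop.norm_le {lam τ : ℝ} {b : Feedback} {p q : ℝ → UnitC}
    (h : HeatLoop lam b τ p q) {s t : ℝ} (hs : 0 < s) (hst : s ≤ t) (ht : t < τ) :
    ‖toL2 (p t)‖ ≤ Real.exp (-lam * (t - s)) * ‖toL2 (p s)‖ := by
  have hd : ∀ r ∈ Ioo 0 τ, HasDerivAt (fun r => Real.exp (2 * lam * r) * ‖toL2 (p r)‖ ^ 2)
      (Real.exp (2 * lam * r) * (-2 * ‖toL2 (q r)‖ ^ 2)) r := by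
    intro r hr
    have h1 : HasDerivAt (fun r => Real.exp (2 * lam * r)) (Real.exp (2 * lam * r) * (2 * lam)) r := by
      simpa using ((hasDerivAt_id r).const_mul (2 * lam)).exp
    convert! h1.mul (h.hasDerivAt_energy hr) using 1
    ring
  have hanti : AntitoneOn (fun r => Real.exp (2 * lam * r) * ‖toL2 (p r)‖ ^ 2) (Ioo 0 τ) := by
    refine antitoneOn_of_deriv_nonpos (convex_Ioo 0 τ)
      (fun r hr => (hd r hr).continuousAt.continuousWithinAt) ?_ ?_
    · rw [interior_Ioo]
      exact fun r hr => (hd r hr).differentiableAt.differentiableWithinAt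
    · rw [interior_Ioo]
      intro r hr
      rw [(hd r hr).deriv]
      exact mul_nonpos_of_nonneg_of_nonpos (Real.exp_nonneg _) (by nlinarith [sq_nonneg ‖toL2 (q r)‖])
  have h1 := hanti ⟨hs, hst.trans_lt ht⟩ ⟨hs.trans_le hst, ht⟩ hst
  simp only at h1
  refine le_of_sq_le_sq ?_ (by positivity)
  have e1 : Real.exp (2 * lam * t) = Real.exp (lam * t) ^ 2 := by
    rw [← Real.exp_nat_mul]; congr 1; push_cast; ring
  have e2 : Real.exp (2 * lam * s) = Real.exp (lam * s) ^ 2 := by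
    rw [← Real.exp_nat_mul]; congr 1; push_cast; ring
  have e3 : Real.exp (-lam * (t - s)) = Real.exp (lam * s) / Real.exp (lam * t) := by
    rw [← Real.exp_sub]; congr 1; ring
  rw [e1, e2] at h1
  rw [e3, mul_pow, div_pow, div_mul_eq_mul_div, le_div_iff₀ (by positivity)]
  linarith

section

variable {a : ℝ → ℝ → ℝ} {lam ε : ℝ} {α : ℝ → UnitC} {G : ℝ → C(triangle, ℝ)}

lemma norm_toL2_add_le {B : ℝ} {D : UnitC →L[ℝ] UnitC} (hD : ‖D‖ ≤ B) (P : UnitC) :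
    ‖toL2 (P + D (primitive P))‖ ≤ (1 + B) * ‖toL2 P‖ := by
  rw [map_add]
  have h1 : ‖toL2 (D (primitive P))‖ ≤ B * ‖toL2 P‖ :=
    (norm_toL2_le _).trans ((D.le_opNorm _).trans (mul_le_mul hD (norm_primitive_le P)
      (norm_nonneg _) ((norm_nonneg D).trans hD)))
  linarith [norm_add_le (toL2 P) (toL2 (D (primitive P)))]

lemma norm_toL2_sub_le {B : ℝ} {D S : UnitC →L[ℝ] UnitC} (hD : ‖D‖ ≤ B) (hS : ‖S‖ ≤ B)
    (p : UnitC) : ‖toL2 (p - D (S (primitive p)))‖ ≤ (1 + B * B) * ‖toL2 p‖ := by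
  rw [map_sub]
  have hB := (norm_nonneg D).trans hD
  have h0 : ‖S (primitive p)‖ ≤ B * ‖toL2 p‖ :=
    (S.le_opNorm _).trans (mul_le_mul hS (norm_primitive_le p) (norm_nonneg _) hB)
  have h1 : ‖toL2 (D (S (primitive p)))‖ ≤ B * (B * ‖toL2 p‖) :=
    (norm_toL2_le _).trans ((D.le_opNorm _).trans (mul_le_mul hD h0 (norm_nonneg _) hB))
  linarith [norm_sub_le (toL2 p) (toL2 (D (S (primitive p))))]

/-- Exponential decay of the closed loop. -/
theorem IsGoursatSolution.exists_decay (h : IsGoursatSolution a lam ε α G) {t₀ : ℝ} (ht₀ : t₀ < 1) :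
    ∃ M : ℝ, 0 < M ∧ ∀ (b : Feedback) (τ : ℝ) (P Q : ℝ → UnitC), τ ≤ 1 →
      ClosedLoop α G lam b τ P Q → ∀ s t, 0 < s → s ≤ t → t < τ → t ≤ t₀ →
        ‖toL2 (P t)‖ ≤ M * (Real.exp (-lam * (t - s)) * ‖toL2 (P s)‖) := by
  have hsub : Icc 0 t₀ ⊆ Ioo (-ε) 1 := fun t ht =>
    ⟨by linarith [ht.1, h.pos], ht.2.trans_lt ht₀⟩
  obtain ⟨B₁, hB₁⟩ := isCompact_Icc.exists_bound_of_continuousOn (E := UnitC →L[ℝ] UnitC)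
    (h.continuousOn_volterraDx.mono hsub)
  obtain ⟨B₂, hB₂⟩ := isCompact_Icc.exists_bound_of_continuousOn (E := UnitC →L[ℝ] UnitC)
    (h.continuousOn_volterraInv.mono hsub)
  set B := max 0 (max B₁ B₂) with hB
  have hB0 : 0 ≤ B := le_max_left _ _
  have hD : ∀ t ∈ Icc 0 t₀, ‖volterraDx α G t‖ ≤ B := fun t ht =>
    (hB₁ t ht).trans ((le_max_left _ _).trans (le_max_right _ _))
  have hS : ∀ t ∈ Icc 0 t₀, ‖volterraInv G t‖ ≤ B := fun t ht =>
    (hB₂ t ht).trans ((le_max_right _ _).trans (le_max_right _ _))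
  -- The factor 1 + B bounds the passage from u_x to w_x = u_x + Du, and 1 + B² the passage back,
  -- u_x = w_x - D(1 + K)⁻¹w.
  refine ⟨(1 + B * B) * (1 + B), by positivity, ?_⟩
  intro b τ P Q hτ hc s t hs hst ht htt
  have hsI : s ∈ Icc 0 t₀ := ⟨hs.le, hst.trans htt⟩
  have htI : t ∈ Icc 0 t₀ := ⟨hs.le.trans hst, htt⟩
  obtain ⟨q, hq⟩ := hc.heatLoop h hτ
  have h1 := hq.norm_le hs hst ht
  have h2 := norm_toL2_add_le (hD s hsI) (P s)
  have h3 := norm_toL2_sub_le (hD t htI) (hS t htI) (P t + volterraDx α G t (primitive (P t)))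
  rw [h.primitive_add_volterraDx (hsub htI), volterraInv_apply_apply, add_sub_cancel_right] at h3
  calc ‖toL2 (P t)‖ ≤ (1 + B * B) * (Real.exp (-lam * (t - s)) * ((1 + B) * ‖toL2 (P s)‖)) := by
        refine h3.trans ?_
        gcongr
        exact h1.trans (by gcongr)
    _ = _ := by ring

end

end Energy

/-! ### H¹ functions and their gradients in L² -/

noncomputable section SobolevSpace

lemma measurePreserving_coe_unit : MeasurePreserving ((↑) : Icc (0 : ℝ) 1 → ℝ) volume
    (volume.restrict (Icc (0 : ℝ) 1)) := measurePreserving_subtype_coe measurableSet_Icc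

lemma restrict_Ioo_eq_restrict_Icc :
    volume.restrict (Ioo (0 : ℝ) 1) = volume.restrict (Icc (0 : ℝ) 1) :=
  Measure.restrict_congr_set Ioo_ae_eq_Icc

lemma memLp_restrict_Ioo_iff {f : ℝ → ℝ} : MemLp f 2 (volume.restrict (Ioo (0 : ℝ) 1)) ↔
    MemLp (fun x : Icc (0 : ℝ) 1 => f x) 2 volume := by
  rw [restrict_Ioo_eq_restrict_Icc, ← measurePreserving_coe_unit.map_eq,
    (MeasurableEmbedding.subtype_coe measurableSet_Icc).memLp_map_measure_iff]
  rfl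

lemma ae_unit_of_ae {p : ℝ → Prop} (h : ∀ᵐ x : ℝ, x ∈ Ioo (0 : ℝ) 1 → p x) :
    ∀ᵐ x : Icc (0 : ℝ) 1, p x := by
  have h1 : ∀ᵐ x ∂(volume.restrict (Icc (0 : ℝ) 1)), p x := by
    rw [← restrict_Ioo_eq_restrict_Icc]
    exact (ae_restrict_iff' measurableSet_Ioo).2 h
  exact measurePreserving_coe_unit.quasiMeasurePreserving.ae h1

lemma AbsolutelyContinuousOnInterval.congr_of_eqOn {f g : ℝ → ℝ} {a b : ℝ}
    (hf : AbsolutelyContinuousOnInterval f a b) (h : EqOn f g (uIcc a b)) :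
    AbsolutelyContinuousOnInterval g a b := by
  rw [absolutelyContinuousOnInterval_iff] at hf ⊢
  intro ε hε
  obtain ⟨δ, hδ, H⟩ := hf ε hε
  refine ⟨δ, hδ, fun E hE hlt => ?_⟩
  convert H E hE hlt using 1
  refine Finset.sum_congr rfl fun i hi => ?_
  rw [h (hE.1 i hi).1, h (hE.1 i hi).2]

/-- `g` is the class in `L²(0,1)` of the derivative of `f ∈ H¹(0,1)`. -/
structure HasGrad (f : ℝ → ℝ) (g : UnitL2) : Prop where
  ac : AbsolutelyContinuousOnInterval f 0 1
  ae : ∀ᵐ x : Icc (0 : ℝ) 1, g x = deriv f x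

lemma MemH1.exists_hasGrad {f : ℝ → ℝ} (h : MemH1 f) : ∃ g, HasGrad f g := by
  have h2 := memLp_restrict_Ioo_iff.1 h.2
  exact ⟨h2.toLp _, h.1, h2.coeFn_toLp⟩

namespace HasGrad

variable {f f' : ℝ → ℝ} {g g' : UnitL2}

lemma memH1 (h : HasGrad f g) : MemH1 f :=
  ⟨h.ac, memLp_restrict_Ioo_iff.2 ((memLp_congr_ae h.ae).1 (Lp.memLp g))⟩

lemma ae_differentiableAt (h : HasGrad f g) : ∀ᵐ x : Icc (0 : ℝ) 1, DifferentiableAt ℝ f x := by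
  refine ae_unit_of_ae ?_
  filter_upwards [h.ac.ae_differentiableAt] with x hx hxI
  exact hx (by rw [uIcc_of_le zero_le_one]; exact Ioo_subset_Icc_self hxI)

lemma sub (h : HasGrad f g) (h' : HasGrad f' g') : HasGrad (fun x => f x - f' x) (g - g') where
  ac := h.ac.sub h'.ac
  ae := by
    filter_upwards [h.ae, h'.ae, h.ae_differentiableAt, h'.ae_differentiableAt,
      Lp.coeFn_sub g g'] with x h1 h2 h3 h4 h5
    rw [h5, Pi.sub_apply, h1, h2, deriv_fun_sub h3 h4]

lemma congr (h : HasGrad f g) (he : EqOn f f' (Icc 0 1)) : HasGrad f' g where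
  ac := h.ac.congr_of_eqOn (by rwa [uIcc_of_le zero_le_one])
  ae := by
    filter_upwards [h.ae, ae_unit_of_ae (p := fun x => deriv f x = deriv f' x)
      (Eventually.of_forall fun x hx => (EventuallyEq.deriv_eq (by
        filter_upwards [isOpen_Ioo.mem_nhds hx] with y hy using he (Ioo_subset_Icc_self hy))))]
      with x h1 h2
    rw [h1, h2]

lemma norm_sq_eq (h : HasGrad f g) : ‖g‖ ^ 2 = ∫ x in (0 : ℝ)..1, deriv f x ^ 2 := by
  rw [← integral_unit (fun x => deriv f x ^ 2), ← real_inner_self_eq_norm_sq, L2.inner_def]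
  refine integral_congr_ae ?_
  filter_upwards [h.ae] with x hx
  rw [hx, real_inner_self_eq_norm_sq, Real.norm_eq_abs, sq_abs]

lemma norm_le_normH1 (h : HasGrad f g) : ‖g‖ ≤ normH1 f := by
  refine Real.le_sqrt_of_sq_le ?_
  rw [h.norm_sq_eq]
  have : 0 ≤ ∫ x in (0 : ℝ)..1, f x ^ 2 :=
    intervalIntegral.integral_nonneg zero_le_one fun _ _ => sq_nonneg _
  linarith

lemma abs_le (h : HasGrad f g) (h0 : f 0 = 0) {x : ℝ} (hx : x ∈ Icc (0 : ℝ) 1) : |f x| ≤ ‖g‖ := by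
  have hx' : AbsolutelyContinuousOnInterval f 0 x :=
    h.ac.mono (by rw [uIcc_of_le hx.1, uIcc_of_le zero_le_one]; exact Icc_subset_Icc_right hx.2)
  have hi := h.ac.intervalIntegrable_deriv
  have hint := hx'.integral_deriv_eq_sub
  rw [h0, sub_zero] at hint
  have h1 : |f x| ≤ ∫ y in (0 : ℝ)..1, |deriv f y| := by
    rw [← hint]
    refine (intervalIntegral.abs_integral_le_integral_abs hx.1).trans ?_
    exact intervalIntegral.integral_mono_interval le_rfl hx.1 hx.2
      (Eventually.of_forall fun _ => abs_nonneg _) hi.abs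
  -- Cauchy–Schwarz again through the variance of |f'|.
  set m := ∫ y in (0 : ℝ)..1, |deriv f y| with hm
  have hsq : IntervalIntegrable (fun y => deriv f y ^ 2) volume 0 1 := by
    rw [intervalIntegrable_iff_integrableOn_Ioo_of_le zero_le_one]
    exact h.memH1.2.integrable_sq
  have h2 : 0 ≤ ∫ y in (0 : ℝ)..1, (|deriv f y| - m) ^ 2 :=
    intervalIntegral.integral_nonneg zero_le_one fun _ _ => sq_nonneg _
  have e : ∀ y, (|deriv f y| - m) ^ 2 = (deriv f y ^ 2 - 2 * m * |deriv f y|) + m ^ 2 := fun y => by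
    rw [← sq_abs (deriv f y)]; ring
  simp only [e] at h2
  rw [intervalIntegral.integral_add (hsq.sub (hi.abs.const_mul _)) (by simp),
    intervalIntegral.integral_sub hsq (hi.abs.const_mul _), intervalIntegral.integral_const_mul,
    ← hm, ← h.norm_sq_eq] at h2
  simp only [intervalIntegral.integral_const, smul_eq_mul, sub_zero, one_mul] at h2
  refine h1.trans (le_of_sq_le_sq ?_ (norm_nonneg _))
  linarith

lemma normH1_le (h : HasGrad f g) (h0 : f 0 = 0) : normH1 f ≤ 2 * ‖g‖ := by
  refine Real.sqrt_le_iff.2 ⟨by positivity, ?_⟩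
  have hc : ContinuousOn f (uIcc 0 1) := h.ac.continuousOn
  have h1 := intervalIntegral.integral_mono_on (μ := volume) (f := fun x => f x ^ 2)
    (g := fun _ => ‖g‖ ^ 2) zero_le_one (hc.pow 2).intervalIntegrable (by simp) fun x hx => by
      rw [← sq_abs]
      exact pow_le_pow_left₀ (abs_nonneg _) (h.abs_le h0 hx) 2
  simp only [intervalIntegral.integral_const, smul_eq_mul, sub_zero, one_mul] at h1
  rw [← h.norm_sq_eq]
  nlinarith [sq_nonneg ‖g‖]

lemma of_primitive {P : UnitC} (h : ∀ x ∈ Icc (0 : ℝ) 1, f x = extI (primitive P) x) :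
    HasGrad f (toL2 P) := by
  have hP := continuous_extI P
  have hd : ∀ x, HasDerivAt (fun x => ∫ y in (0 : ℝ)..x, extI P y) (extI P x) x := fun x =>
    (hP.integral_hasStrictDerivAt 0 x).hasDerivAt
  refine HasGrad.congr (f := fun x => ∫ y in (0 : ℝ)..x, extI P y) ⟨?_, ?_⟩ fun x hx => ?_
  · exact (hP.intervalIntegrable 0 1).absolutelyContinuousOnInterval_intervalIntegral (by simp)
  · filter_upwards [coeFn_toL2 P] with x hx
    rw [hx, (hd x).deriv, extI_coe]
  · rw [h x hx, extI_primitive P hx]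

end HasGrad

end SobolevSpace

/-! ### From solutions to closed loops; uniqueness and decay -/

noncomputable section Solutions

open scoped RealInnerProductSpace

/-- A function that is continuous on `[0,1]`, as an element of `UnitC`. -/
def toUnitC (f : ℝ → ℝ) : UnitC :=
  open Classical in
  if h : ContinuousOn f (Icc 0 1) then ⟨fun x => f x, continuousOn_iff_continuous_domRestrict.1 h⟩ else 0

lemma extI_toUnitC {f : ℝ → ℝ} (h : ContinuousOn f (Icc 0 1)) {x : ℝ} (hx : x ∈ Icc (0 : ℝ) 1) :
    extI (toUnitC f) x = f x := by
  rw [extI_of_mem _ hx, toUnitC, dif_pos h]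
  rfl

lemma toUnitC_apply {f : ℝ → ℝ} (h : ContinuousOn f (Icc 0 1)) (x : Icc (0 : ℝ) 1) :
    toUnitC f x = f x := by
  rw [← extI_coe, extI_toUnitC h x.2]

lemma unitC_ext_Ioo {f g : UnitC} (h : ∀ x ∈ Ioo (0 : ℝ) 1, extI f x = extI g x) : f = g := by
  have h1 : EqOn (extI f) (extI g) (Icc 0 1) :=
    EqOn.of_subset_closure h (continuous_extI f).continuousOn (continuous_extI g).continuousOn
      Ioo_subset_Icc_self (by rw [closure_Ioo zero_ne_one])
  ext x
  rw [← extI_coe, ← extI_coe]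
  exact h1 x.2

lemma primitive_toUnitC_derivWithin {f : ℝ → ℝ} (hf : ContDiffOn ℝ 1 f (Icc 0 1)) {x : ℝ}
    (hx : x ∈ Icc (0 : ℝ) 1) :
    extI (primitive (toUnitC (derivWithin f (Icc 0 1)))) x = f x - f 0 := by
  have hc : ContinuousOn (derivWithin f (Icc 0 1)) (Icc 0 1) :=
    hf.continuousOn_derivWithin (uniqueDiffOn_Icc zero_lt_one) le_rfl
  rw [extI_primitive _ hx]
  refine intervalIntegral.integral_eq_sub_of_hasDerivAt_of_le hx.1
    (hf.continuousOn.mono (Icc_subset_Icc_right hx.2)) (fun y hy => ?_)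
    ((continuous_extI _).intervalIntegrable _ _)
  have hyI : y ∈ Ioo (0 : ℝ) 1 := ⟨hy.1, hy.2.trans_le hx.2⟩
  rw [extI_toUnitC hc (Ioo_subset_Icc_self hyI)]
  exact ((hf.differentiableOn one_ne_zero) y (Ioo_subset_Icc_self hyI)).hasDerivWithinAt.hasDerivAt
    (Icc_mem_nhds hyI.1 hyI.2)

lemma continuousOn_toUnitC {F : ℝ → ℝ → ℝ} {τ : ℝ}
    (hF : ContinuousOn (fun p : ℝ × ℝ => F p.1 p.2) (Icc (0 : ℝ) 1 ×ˢ Ioo 0 τ)) :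
    ContinuousOn (fun t => toUnitC fun x => F x t) (Ioo 0 τ) := by
  rw [continuousOn_iff_continuous_domRestrict]
  refine ContinuousMap.continuous_of_continuous_uncurry _ ?_
  have h1 : Continuous fun p : Ioo 0 τ × Icc (0 : ℝ) 1 => F p.2 p.1 :=
    hF.comp_continuous (f := fun p : Ioo 0 τ × Icc (0 : ℝ) 1 => ((p.2 : ℝ), (p.1 : ℝ)))
      (by fun_prop) fun p => ⟨p.2.2, p.1.2⟩
  refine h1.congr fun p => ?_
  refine (toUnitC_apply (f := fun x => F x p.1) ?_ p.2).symm
  exact hF.comp (f := fun x : ℝ => (x, (p.1 : ℝ))) (by fun_prop) fun x hx => ⟨hx, p.1.2⟩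

/-- A pointwise derivative that is continuous in the uniform norm is a derivative in the uniform norm. -/
lemma hasDerivAt_unitC {U V : ℝ → UnitC} {s : Set ℝ} (hs : IsOpen s)
    (hV : ContinuousOn V s) (hd : ∀ t ∈ s, ∀ x, HasDerivAt (fun r => U r x) (V t x) t) {t : ℝ}
    (ht : t ∈ s) : HasDerivAt U (V t) t := by
  rw [hasDerivAt_iff_isLittleO, Asymptotics.isLittleO_iff]
  intro ε hε
  have h1 : ∀ᶠ r in 𝓝 t, r ∈ s ∧ ‖V r - V t‖ < ε := by
    refine (show ∀ᶠ r in 𝓝 t, r ∈ s from hs.mem_nhds ht).and ?_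
    have := (hV.continuousAt (hs.mem_nhds ht)).tendsto.eventually (Metric.ball_mem_nhds (V t) hε)
    simpa [dist_eq_norm] using this
  obtain ⟨δ, hδ, hball⟩ := Metric.eventually_nhds_iff_ball.1 h1
  filter_upwards [Metric.ball_mem_nhds t hδ] with r hr
  rw [ContinuousMap.norm_le _ (by positivity)]
  intro x
  -- The mean value inequality for U r x - r · V t x, whose derivative is below ε on a ball that
  -- does not depend on x.
  have h2 := (convex_ball t δ).norm_image_sub_le_of_norm_hasDerivWithin_le (C := ε)
    (f := fun r => U r x - r * V t x) (f' := fun r => V r x - 1 * V t x)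
    (fun y hy => ((hd y (hball y hy).1 x).sub
      ((hasDerivAt_id y).mul_const (V t x))).hasDerivWithinAt)
    (fun y hy => by
      rw [one_mul]
      exact ((V y - V t).norm_coe_le_norm x).trans (hball y hy).2.le)
    (Metric.mem_ball_self hδ) hr
  refine (le_of_eq ?_).trans h2
  congr 1
  simp only [ContinuousMap.sub_apply, ContinuousMap.smul_apply, smul_eq_mul]
  ring

section

variable {a : ℝ → ℝ → ℝ} {lam ε : ℝ} {α : ℝ → UnitC} {G : ℝ → C(triangle, ℝ)}
  {k : ℝ → ℝ → ℝ → ℝ}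

lemma IsGoursatSolution.kernelDx_unique (h : IsGoursatSolution a lam ε α G)
    (hk : IsBacksteppingKernel a lam k) {x y : ℝ} (hp : (x, y) ∈ triangle) {t : ℝ}
    (ht : t ∈ Ico (0 : ℝ) 1) :
    kernelDx k x y t = waveKernelDx (extI (α t)) (extChar (kernelSource α G t)) x y := by
  rw [← kernelDx_kernelOf hp, kernelDx, kernelDx]
  congr 1
  exact fderivWithin_congr (fun p hp => h.kernel_unique hk hp ht) (h.kernel_unique hk hp ht)

lemma IsGoursatSolution.integral_kernel (h : IsGoursatSolution a lam ε α G)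
    (hk : IsBacksteppingKernel a lam k) {t : ℝ} (ht : t ∈ Ico (0 : ℝ) 1) {U : UnitC} {f : ℝ → ℝ}
    (hf : ∀ y ∈ Icc (0 : ℝ) 1, extI U y = f y) :
    ∫ y in (0 : ℝ)..1, k 1 y t * f y = volterra (G t) U 1 := by
  rw [h.volterra_apply (Ico_subset_Ioo_neg h.pos ht) U 1 hf]
  refine intervalIntegral.integral_congr fun y hy => ?_
  rw [uIcc_of_le zero_le_one] at hy
  change k 1 y t * f y = kernelOf α G 1 y t * f y
  rw [h.kernel_unique hk ⟨hy.1, hy.2, le_rfl⟩ ht]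

lemma IsGoursatSolution.integral_kernelDx (h : IsGoursatSolution a lam ε α G)
    (hk : IsBacksteppingKernel a lam k) {t : ℝ} (ht : t ∈ Ico (0 : ℝ) 1) {U : UnitC} {f : ℝ → ℝ}
    (hf : ∀ y ∈ Icc (0 : ℝ) 1, extI U y = f y) :
    k 1 1 t * f 1 + ∫ y in (0 : ℝ)..1, kernelDx k 1 y t * f y = volterraDx α G t U 1 := by
  rw [h.volterraDx_apply (Ico_subset_Ioo_neg h.pos ht) U 1 hf]
  congr 1
  · change k 1 1 t * f 1 = kernelOf α G 1 1 t * f 1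
    rw [h.kernel_unique hk ⟨zero_le_one, le_rfl, le_rfl⟩ ht]
  · refine intervalIntegral.integral_congr fun y hy => ?_
    rw [uIcc_of_le zero_le_one] at hy
    rw [h.kernelDx_unique hk ⟨hy.1, hy.2, le_rfl⟩ ht]
    rfl

/-- The feedback laws are designed for this: u(1) + ∫ k u is w(1), and u_x(1) + k(1,1) u(1) + ∫ k_x
u is w_x(1). -/
lemma IsGoursatSolution.feedbackLaw_iff (h : IsGoursatSolution a lam ε α G)
    (hk : IsBacksteppingKernel a lam k) {t : ℝ} (ht : t ∈ Ico (0 : ℝ) 1) {u : ℝ → ℝ → ℝ}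
    {P : UnitC} (hu : ∀ x ∈ Icc (0 : ℝ) 1, extI (primitive P) x = u x t)
    (hP : spaceDeriv u 1 t = P 1) (b : Feedback) :
    FeedbackLaw k u t b ↔ LoopBC b ((1 + volterra (G t)) (primitive P))
      (P + volterraDx α G t (primitive P)) := by
  have h1 : u 1 t = primitive P 1 := by
    rw [← hu 1 ⟨zero_le_one, le_rfl⟩]
    exact extI_coe (primitive P) 1
  cases b
  · simp only [FeedbackLaw, LoopBC, one_add_volterra_apply, ContinuousMap.add_apply]
    rw [h.integral_kernel hk ht hu, h1, eq_neg_iff_add_eq_zero]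
  · have h2 := h.integral_kernelDx hk ht hu
    simp only [FeedbackLaw, LoopBC, ContinuousMap.add_apply]
    rw [← h2, hP]
    constructor <;> intro h3 <;> linarith

lemma Compatible.zero {u₀ : ℝ → ℝ} {b : Feedback} (h : Compatible k u₀ b) : u₀ 0 = 0 := by
  cases b
  · exact h.1
  · exact h

/-- A solution of the initial boundary value problem is a trajectory of the closed loop. -/
theorem IsSolution.exists_closedLoop (h : IsGoursatSolution a lam ε α G)
    (hk : IsBacksteppingKernel a lam k) {b : Feedback} {u₀ : ℝ → ℝ} {τ : ℝ} (hτ0 : 0 < τ)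
    (hτ : τ ≤ 1) {u : ℝ → ℝ → ℝ} (hu : IsSolution a k b u₀ τ u) {g : UnitL2} (hg : HasGrad u₀ g) :
    ∃ P Q, ClosedLoop α G lam b τ P Q ∧
      (∀ t ∈ Ioo 0 τ, ∀ x ∈ Icc (0 : ℝ) 1, extI (primitive (P t)) x = u x t) ∧
      Tendsto (fun s => toL2 (P s)) (𝓝[>] 0) (𝓝 g) := by
  have hud := uniqueDiffOn_Icc (zero_lt_one' ℝ)
  have hmem : ∀ t ∈ Ioo 0 τ, t ∈ Ico (0 : ℝ) 1 := fun t ht => ⟨ht.1.le, ht.2.trans_le hτ⟩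
  set P : ℝ → UnitC := fun t => toUnitC fun x => spaceDeriv u x t with hP
  set Q : ℝ → UnitC := fun t => toUnitC fun x => spaceDeriv (spaceDeriv u) x t with hQ
  set V : ℝ → UnitC := fun t => toUnitC fun x => deriv (fun s => u x s) t with hV
  have hC1 : ∀ t ∈ Ioo 0 τ, ContDiffOn ℝ 1 (fun x => spaceDeriv u x t) (Icc 0 1) := fun t ht =>
    (hu.contDiff_space t ht).derivWithin hud (by norm_num)
  have hPc : ∀ t ∈ Ioo 0 τ, ContinuousOn (fun x => spaceDeriv u x t) (Icc 0 1) := fun t ht =>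
    (hC1 t ht).continuousOn
  have hQc : ∀ t ∈ Ioo 0 τ, ContinuousOn (fun x => spaceDeriv (spaceDeriv u) x t) (Icc 0 1) :=
    fun t ht => (hC1 t ht).continuousOn_derivWithin hud le_rfl
  have hVc : ∀ t ∈ Ioo 0 τ, ContinuousOn (fun x => deriv (fun s => u x s) t) (Icc 0 1) :=
    fun t ht => hu.continuous_time_deriv.comp (f := fun x : ℝ => (x, t)) (by fun_prop)
      fun x hx => ⟨hx, ht⟩
  have hJ : ∀ t ∈ Ioo 0 τ, ∀ x ∈ Icc (0 : ℝ) 1, extI (primitive (P t)) x = u x t := by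
    intro t ht x hx
    have h1 := primitive_toUnitC_derivWithin
      ((hu.contDiff_space t ht).of_le (by norm_num)) hx
    rw [hu.left_boundary t ht, sub_zero] at h1
    exact h1
  refine ⟨P, Q, ⟨fun t ht => ?_, fun t ht => ?_, ?_, fun t ht => ?_⟩, hJ, ?_⟩
  · refine ⟨spaceDeriv u 0 t, ?_⟩
    ext x
    have h1 := primitive_toUnitC_derivWithin (hC1 t ht) x.2
    rw [extI_coe] at h1
    rw [ContinuousMap.add_apply, ContinuousMap.const_apply, hP]
    simp only
    rw [toUnitC_apply (hPc t ht)]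
    linarith [show primitive (Q t) x = _ from h1]
  · have h1 : HasDerivAt (fun s => primitive (P s)) (V t) t := by
      refine hasDerivAt_unitC isOpen_Ioo (continuousOn_toUnitC hu.continuous_time_deriv) ?_ ht
      intro r hr x
      have h2 := (hu.differentiable_time x x.2 r hr).hasDerivAt
      rw [toUnitC_apply (hVc r hr)]
      refine h2.congr_of_eventuallyEq ?_
      filter_upwards [isOpen_Ioo.mem_nhds hr] with s hs
      rw [← hJ s hs x x.2, extI_coe]
    convert! h1 using 1
    refine unitC_ext_Ioo fun x hx => ?_
    have hxI := Ioo_subset_Icc_self hx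
    rw [extI_add, extI_sub, extI_mul, extI_smul, hJ t ht x hxI, h.coeff_eq t (hmem t ht) x hxI,
      extI_toUnitC (hQc t ht) hxI, extI_toUnitC (hVc t ht) hxI, hu.equation x hx t ht]
    ring
  · exact continuousOn_toUnitC hu.continuous_space_deriv
  · refine (h.feedbackLaw_iff hk (hmem t ht) (hJ t ht) ?_ b).1 (hu.right_boundary t ht)
    exact (toUnitC_apply (hPc t ht) 1).symm
  · have h0 : HasGrad (fun x => u x 0) g := hg.congr fun x hx => (hu.initial x hx).symm
    -- Continuity in H¹ at time 0 is used through the L² convergence of the gradients only.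
    have h1 := (hu.continuousH1 0 ⟨le_rfl, hτ0⟩).mono_left
      (nhdsWithin_mono (0 : ℝ) (Ioo_subset_Ico_self : Ioo 0 τ ⊆ Ico 0 τ))
    rw [nhdsWithin_Ioo_eq_nhdsGT hτ0] at h1
    rw [tendsto_iff_norm_sub_tendsto_zero]
    refine squeeze_zero' (Eventually.of_forall fun _ => norm_nonneg _) ?_ h1
    filter_upwards [Ioo_mem_nhdsGT hτ0] with t ht
    exact ((HasGrad.of_primitive fun x hx => (hJ t ht x hx).symm).sub h0).norm_le_normH1

/-- The decay estimate from an initial time tending to `0`. -/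
lemma ClosedLoop.norm_le_of_tendsto {M lam τ t : ℝ} {P : ℝ → UnitC} {g : UnitL2}
    (hM : ∀ s, 0 < s → s ≤ t → ‖toL2 (P t)‖ ≤ M * (Real.exp (-lam * (t - s)) * ‖toL2 (P s)‖))
    (hlim : Tendsto (fun s => toL2 (P s)) (𝓝[>] 0) (𝓝 g)) (ht : t ∈ Ioo 0 τ) :
    ‖toL2 (P t)‖ ≤ M * (Real.exp (-lam * t) * ‖g‖) := by
  have h1 : Tendsto (fun s => M * (Real.exp (-lam * (t - s)) * ‖toL2 (P s)‖)) (𝓝[>] 0)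
      (𝓝 (M * (Real.exp (-lam * (t - 0)) * ‖g‖))) := by
    refine Tendsto.const_mul _ (Tendsto.mul ?_ hlim.norm)
    have : Continuous fun s => Real.exp (-lam * (t - s)) := by fun_prop
    exact (this.tendsto 0).mono_left nhdsWithin_le_nhds
  rw [sub_zero] at h1
  refine ge_of_tendsto h1 ?_
  filter_upwards [Ioo_mem_nhdsGT ht.1] with s hs
  exact hM s hs.1 hs.2.le

/-- The difference of the two gradients is again a closed loop, with initial limit g - g = 0, so the
decay estimate makes it vanish. -/
theorem IsGoursatSolution.solution_unique (h : IsGoursatSolution a lam ε α G)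
    (hk : IsBacksteppingKernel a lam k) {b : Feedback} {τ : ℝ} (hτ : τ ∈ Ioc (0 : ℝ) 1) {u₀ : ℝ → ℝ}
    (hu₀ : MemH1 u₀) {u v : ℝ → ℝ → ℝ} (hu : IsSolution a k b u₀ τ u)
    (hv : IsSolution a k b u₀ τ v) {x : ℝ} (hx : x ∈ Icc (0 : ℝ) 1) {t : ℝ} (ht : t ∈ Ico 0 τ) :
    u x t = v x t := by
  rcases ht.1.eq_or_lt with h0 | h0
  · rw [← h0, hu.initial x hx, hv.initial x hx]
  obtain ⟨g, hg⟩ := hu₀.exists_hasGrad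
  obtain ⟨P, Q, hc, hJ, hlim⟩ := hu.exists_closedLoop h hk hτ.1 hτ.2 hg
  obtain ⟨P', Q', hc', hJ', hlim'⟩ := hv.exists_closedLoop h hk hτ.1 hτ.2 hg
  obtain ⟨M, hM, hdec⟩ := h.exists_decay (ht.2.trans_le hτ.2)
  have ht' : t ∈ Ioo 0 τ := ⟨h0, ht.2⟩
  have hl : Tendsto (fun s => toL2 (P s - P' s)) (𝓝[>] 0) (𝓝 (g - g)) := by
    simp only [map_sub]
    exact hlim.sub hlim'
  have h1 := ClosedLoop.norm_le_of_tendsto (P := fun s => P s - P' s)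
    (fun s hs hst => hdec b τ _ _ hτ.2 (hc.sub hc') s t hs hst ht.2 le_rfl) hl ht'
  rw [sub_self, norm_zero, mul_zero, mul_zero] at h1
  have h2 := (abs_primitive_le (P t - P' t) ⟨x, hx⟩).trans h1
  rw [map_sub, ContinuousMap.sub_apply, ← extI_of_mem _ hx, ← extI_of_mem _ hx, hJ t ht' x hx,
    hJ' t ht' x hx] at h2
  exact sub_eq_zero.1 (abs_nonpos_iff.1 h2)

theorem IsGoursatSolution.solution_decay (h : IsGoursatSolution a lam ε α G)
    (hk : IsBacksteppingKernel a lam k) (b : Feedback) {t₀ : ℝ} (ht₀ : t₀ ∈ Ioo (0 : ℝ) 1) :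
    ∃ M : ℝ, 0 < M ∧ ∀ u₀ : ℝ → ℝ, MemH1 u₀ → Compatible k u₀ b →
      ∀ u : ℝ → ℝ → ℝ, IsSolution a k b u₀ t₀ u → ∀ t ∈ Ioo 0 t₀,
        normH1 (fun x => u x t) ≤ M * normH1 u₀ * Real.exp (-lam * t) := by
  obtain ⟨M, hM, hdec⟩ := h.exists_decay ht₀.2
  refine ⟨2 * M, by positivity, fun u₀ hu₀ _ u hu t ht => ?_⟩
  obtain ⟨g, hg⟩ := hu₀.exists_hasGrad
  obtain ⟨P, Q, hc, hJ, hlim⟩ := hu.exists_closedLoop h hk ht₀.1 ht₀.2.le hg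
  have h1 := ClosedLoop.norm_le_of_tendsto (P := P)
    (fun s hs hst => hdec b t₀ _ _ ht₀.2.le hc s t hs hst ht.2 ht.2.le) hlim ht
  have h2 := (HasGrad.of_primitive fun x hx => (hJ t ht x hx).symm).normH1_le
    (hu.left_boundary t ht)
  calc normH1 (fun x => u x t) ≤ 2 * (M * (Real.exp (-lam * t) * ‖g‖)) := by linarith
    _ ≤ 2 * (M * (Real.exp (-lam * t) * normH1 u₀)) := by
        gcongr
        exact hg.norm_le_normH1
    _ = _ := by ring

end

end Solutions

/-! ### Completeness of the cosine systems -/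

noncomputable section CosineBasis

open scoped RealInnerProductSpace

/-- The function `x ↦ cos (r x)` on `[0,1]`. -/
def cosFun (r : ℝ) : UnitC := ⟨fun x => Real.cos (r * x), by fun_prop⟩

/-- The function `x ↦ sin (r x)` on `[0,1]`. -/
def sinFun (r : ℝ) : UnitC := ⟨fun x => Real.sin (r * x), by fun_prop⟩

lemma cosFun_apply (r : ℝ) (x : Icc (0 : ℝ) 1) : cosFun r x = Real.cos (r * x) := rfl

lemma sinFun_apply (r : ℝ) (x : Icc (0 : ℝ) 1) : sinFun r x = Real.sin (r * x) := rfl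

lemma extI_cosFun (r : ℝ) {x : ℝ} (hx : x ∈ Icc (0 : ℝ) 1) : extI (cosFun r) x = Real.cos (r * x) := by
  rw [extI_of_mem _ hx]
  rfl

lemma extI_sinFun (r : ℝ) {x : ℝ} (hx : x ∈ Icc (0 : ℝ) 1) : extI (sinFun r) x = Real.sin (r * x) := by
  rw [extI_of_mem _ hx]
  rfl

lemma norm_cosFun_le (r : ℝ) : ‖cosFun r‖ ≤ 1 :=
  (ContinuousMap.norm_le _ zero_le_one).2 fun _ => Real.abs_cos_le_one _

lemma norm_sinFun_le (r : ℝ) : ‖sinFun r‖ ≤ 1 :=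
  (ContinuousMap.norm_le _ zero_le_one).2 fun _ => Real.abs_sin_le_one _

lemma cosFun_neg (r : ℝ) : cosFun (-r) = cosFun r := by
  ext x
  rw [cosFun_apply, cosFun_apply, neg_mul, Real.cos_neg]

lemma cosFun_mul (r s : ℝ) :
    cosFun r * cosFun s = (1 / 2 : ℝ) • (cosFun (r - s) + cosFun (r + s)) := by
  ext x
  simp only [ContinuousMap.mul_apply, ContinuousMap.smul_apply, ContinuousMap.add_apply,
    cosFun_apply, smul_eq_mul, sub_mul, add_mul, Real.cos_sub, Real.cos_add]
  ring

lemma smul_primitive_cosFun (r : ℝ) : r • primitive (cosFun r) = sinFun r := by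
  ext x
  have hd : ∀ y ∈ uIcc 0 (x : ℝ), HasDerivAt (fun y => Real.sin (r * y)) (r * extI (cosFun r) y) y := by
    intro y hy
    rw [uIcc_of_le x.2.1] at hy
    rw [extI_cosFun r ⟨hy.1, hy.2.trans x.2.2⟩]
    have := ((hasDerivAt_id y).const_mul r).sin
    convert! this using 1
    simp [mul_comm]
  have h := intervalIntegral.integral_eq_sub_of_hasDerivAt hd
    (((continuous_extI _).const_mul r).intervalIntegrable _ _)
  rw [intervalIntegral.integral_const_mul] at h
  simpa [primitive_apply, sinFun_apply] using h

lemma cosFun_eq_primitive (r : ℝ) :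
    cosFun r = ContinuousMap.const _ 1 + primitive (-r • sinFun r) := by
  ext x
  have hd : ∀ y ∈ uIcc 0 (x : ℝ), HasDerivAt (fun y => Real.cos (r * y))
      (extI (-r • sinFun r) y) y := by
    intro y hy
    rw [uIcc_of_le x.2.1] at hy
    rw [extI_smul, extI_sinFun r ⟨hy.1, hy.2.trans x.2.2⟩]
    have := ((hasDerivAt_id y).const_mul r).cos
    convert! this using 1
    simp [mul_comm]
  have h := intervalIntegral.integral_eq_sub_of_hasDerivAt hd
    ((continuous_extI _).intervalIntegrable _ _)
  rw [ContinuousMap.add_apply, primitive_apply, h]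
  simp [cosFun_apply]

lemma integral_cosFun (j : ℤ) :
    ∫ x in (0 : ℝ)..1, extI (cosFun (j * Real.pi)) x = if j = 0 then 1 else 0 := by
  have h := congrArg (fun f : UnitC => f 1) (smul_primitive_cosFun (j * Real.pi))
  simp only [ContinuousMap.smul_apply, sinFun_apply, smul_eq_mul] at h
  have h1 : primitive (cosFun (j * Real.pi)) 1 =
    ∫ x in (0 : ℝ)..1, extI (cosFun (j * Real.pi)) x := rfl
  rw [← h1]
  split_ifs with hj
  · subst hj
    rw [h1]
    have : ∀ x ∈ uIcc (0 : ℝ) 1, extI (cosFun ((0 : ℤ) * Real.pi)) x = 1 := fun x hx => by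
      rw [uIcc_of_le zero_le_one] at hx
      rw [extI_cosFun _ hx]
      simp
    rw [intervalIntegral.integral_congr this]
    simp
  · have h2 : Real.sin (j * Real.pi * ((1 : Icc (0 : ℝ) 1) : ℝ)) = 0 := by
      rw [show ((1 : Icc (0 : ℝ) 1) : ℝ) = 1 from rfl, mul_one]
      exact Real.sin_int_mul_pi j
    rw [h2] at h
    have h3 : (j : ℝ) * Real.pi ≠ 0 := mul_ne_zero (Int.cast_ne_zero.2 hj) Real.pi_ne_zero
    exact (mul_eq_zero.1 h).resolve_left h3

/-- Only r - s and r + s have to be integer multiples of π, so integer and half-integer frequencies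
are covered together. -/
lemma inner_cosFun (r s : ℝ) (i j : ℤ) (hi : r - s = i * Real.pi) (hj : r + s = j * Real.pi) :
    ⟪toL2 (cosFun r), toL2 (cosFun s)⟫ =
      (1 / 2) * ((if i = 0 then 1 else 0) + if j = 0 then 1 else 0) := by
  rw [inner_toL2]
  simp only [← extI_mul]
  rw [cosFun_mul, hi, hj]
  simp only [extI_smul, extI_add]
  rw [intervalIntegral.integral_const_mul, intervalIntegral.integral_add
    ((continuous_extI _).intervalIntegrable _ _) ((continuous_extI _).intervalIntegrable _ _),
    integral_cosFun, integral_cosFun]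

/-- A continuous functional annihilating all `cos (n π x)` vanishes. -/
lemma eq_zero_of_apply_cosFun_eq_zero (φ : UnitC →L[ℝ] ℝ)
    (h : ∀ n : ℕ, φ (cosFun (n * Real.pi)) = 0) : φ = 0 := by
  -- The span M is stable under multiplication by X by the product formula, hence contains all
  -- polynomials in X. As cos(πx) is injective on [0,1], Stone–Weierstrass makes these dense.
  set X : UnitC := cosFun Real.pi with hX
  set M : Submodule ℝ UnitC := Submodule.span ℝ (range fun n : ℕ => cosFun (n * Real.pi)) with hM
  have hgen : ∀ n : ℕ, cosFun (n * Real.pi) ∈ M := fun n => Submodule.subset_span ⟨n, rfl⟩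
  have hmul : ∀ f ∈ M, X * f ∈ M := by
    intro f hf
    induction hf using Submodule.span_induction with
    | mem f hf =>
      obtain ⟨n, rfl⟩ := hf
      rw [hX]
      simp only
      rw [cosFun_mul]
      refine M.smul_mem _ (M.add_mem ?_ ?_)
      · rcases n with _ | n
        · simpa using hgen 1
        · rw [← cosFun_neg]
          convert hgen n using 2
          push_cast
          ring
      · convert hgen (n + 1) using 2
        push_cast
        ring
    | zero => rw [mul_zero]; exact M.zero_mem
    | add f g _ _ hf hg => rw [mul_add]; exact M.add_mem hf hg
    | smul c f _ hf => rw [mul_smul_comm]; exact M.smul_mem c hf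
  have hpow : ∀ n : ℕ, X ^ n ∈ M := by
    intro n
    induction n with
    | zero =>
      convert hgen 0 using 1
      ext x
      simp [cosFun_apply]
    | succ n ih => rw [pow_succ']; exact hmul _ ih
  have hadj : ∀ f ∈ Algebra.adjoin ℝ {X}, φ f = 0 := by
    intro f hf
    rw [Algebra.adjoin_singleton_eq_range_aeval] at hf
    obtain ⟨p, rfl⟩ := hf
    have hfM : Polynomial.aeval X p ∈ M := by
      rw [Polynomial.aeval_eq_sum_range]
      exact M.sum_mem fun i _ => M.smul_mem _ (hpow i)
    have hle : M ≤ LinearMap.ker (φ : UnitC →ₗ[ℝ] ℝ) := by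
      rw [hM, Submodule.span_le]
      rintro _ ⟨n, rfl⟩
      exact h n
    exact hle hfM
  have hsep : (Algebra.adjoin ℝ {X}).SeparatesPoints := by
    intro x y hxy
    refine ⟨X, ⟨X, Algebra.subset_adjoin rfl, rfl⟩, fun hXY => hxy ?_⟩
    have hmem : ∀ z : Icc (0 : ℝ) 1, Real.pi * (z : ℝ) ∈ Icc 0 Real.pi := fun z =>
      ⟨mul_nonneg Real.pi_pos.le z.2.1, mul_le_of_le_one_right Real.pi_pos.le z.2.2⟩
    exact Subtype.ext (mul_left_cancel₀ Real.pi_ne_zero (Real.injOn_cos (hmem x) (hmem y) hXY))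
  have htop := ContinuousMap.subalgebra_topologicalClosure_eq_top_of_separatesPoints _ hsep
  ext f
  have hf : f ∈ (Algebra.adjoin ℝ {X}).topologicalClosure := by rw [htop]; trivial
  have hcl : IsClosed {f : UnitC | φ f = 0} := isClosed_eq φ.continuous continuous_const
  exact closure_minimal (s := (Algebra.adjoin ℝ {X} : Set UnitC)) hadj hcl hf

lemma eq_zero_of_inner_toL2_eq_zero {f : UnitL2} (h : ∀ u : UnitC, ⟪toL2 u, f⟫ = 0) : f = 0 := by
  have hd : DenseRange (toL2 : UnitC → UnitL2) :=
    ContinuousMap.toLp_denseRange ℝ (volume : Measure (Icc (0 : ℝ) 1)) ℝ (by norm_num)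
  have hall : ∀ g : UnitL2, ⟪g, f⟫ = 0 := fun g =>
    hd.induction_on (p := fun g => ⟪g, f⟫ = 0) g
      (isClosed_eq (continuous_id.inner continuous_const) continuous_const) h
  exact inner_self_eq_zero.1 (hall f)

/-- The functional u ↦ ⟪m u, f⟫ annihilates all cosines, hence all continuous u, so m f = 0 in L²;
then f = 0 because m vanishes almost nowhere. -/
lemma eq_zero_of_inner_mul_cosFun {m : UnitC} (hm : ∀ᵐ x : Icc (0 : ℝ) 1, m x ≠ 0) {f : UnitL2}
    (h : ∀ n : ℕ, ⟪toL2 (m * cosFun (n * Real.pi)), f⟫ = 0) : f = 0 := by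
  have h1 := eq_zero_of_apply_cosFun_eq_zero
    (((innerSL ℝ f).comp toL2).comp (ContinuousLinearMap.mul ℝ UnitC m)) fun n =>
      (real_inner_comm _ _).trans (h n)
  have h2 : ∀ u : UnitC, ⟪toL2 (m * u), f⟫ = 0 := fun u => by
    rw [real_inner_comm]
    exact congrArg (fun φ : UnitC →L[ℝ] ℝ => φ u) h1
  have hmem : MemLp (fun x => m x * f x) 2 (volume : Measure (Icc (0 : ℝ) 1)) :=
    (Lp.memLp f).of_le_mul (c := ‖m‖)
      (m.continuous.aestronglyMeasurable.mul (Lp.aestronglyMeasurable f))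
      (Eventually.of_forall fun x => by
        rw [norm_mul]
        exact mul_le_mul_of_nonneg_right (m.norm_coe_le_norm x) (norm_nonneg _))
  have h3 : hmem.toLp _ = 0 := eq_zero_of_inner_toL2_eq_zero fun u => by
    refine Eq.trans ?_ (h2 u)
    rw [L2.inner_def, L2.inner_def]
    refine integral_congr_ae ?_
    filter_upwards [hmem.coeFn_toLp, coeFn_toL2 u, coeFn_toL2 (m * u)] with x h4 h5 h6
    rw [h4, h5, h6, ContinuousMap.mul_apply]
    change m x * f x * u x = f x * (m x * u x)
    ring
  refine Lp.ext ?_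
  filter_upwards [hm, hmem.coeFn_toLp, Lp.coeFn_zero ℝ 2 (volume : Measure (Icc (0 : ℝ) 1))]
    with x h4 h5 h6
  rw [h3, h6] at h5
  rw [h6]
  exact (mul_eq_zero.1 h5.symm).resolve_left h4

/-- The frequencies of the eigenfunctions `sin (μ x)` of the heat equation on `(0,1)` with a
Dirichlet condition at `0` and either condition at `1`. -/
def freq : Feedback → ℕ → ℝ
  | .dirichlet, n => n * Real.pi
  | .neumann, n => (n + 1 / 2) * Real.pi

/-- The derivatives of the eigenfunctions. -/
def cosMode (b : Feedback) (n : ℕ) : UnitC := cosFun (freq b n)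

lemma inner_cosMode_of_ne (b : Feedback) {n m : ℕ} (h : n ≠ m) :
    ⟪toL2 (cosMode b n), toL2 (cosMode b m)⟫ = 0 := by
  have h1 : (n : ℤ) - m ≠ 0 := by omega
  cases b
  · rw [cosMode, cosMode, inner_cosFun _ _ (n - m) (n + m) (by simp only [freq]; push_cast; ring)
      (by simp only [freq]; push_cast; ring), if_neg h1, if_neg (by omega)]
    norm_num
  · rw [cosMode, cosMode, inner_cosFun _ _ (n - m) (n + m + 1)
      (by simp only [freq]; push_cast; ring) (by simp only [freq]; push_cast; ring), if_neg h1,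
      if_neg (by omega)]
    norm_num

/-- The squared norm is 1 for the constant mode and 1/2 for the others; the lower bound serves all
coefficients. -/
lemma half_le_norm_sq_cosMode (b : Feedback) (n : ℕ) : 1 / 2 ≤ ‖toL2 (cosMode b n)‖ ^ 2 := by
  rw [← real_inner_self_eq_norm_sq]
  cases b
  · rw [cosMode, inner_cosFun _ _ (n - n) (n + n) (by simp only [freq]; push_cast; ring)
      (by simp only [freq]; push_cast; ring), if_pos (sub_self _)]
    split_ifs <;> norm_num
  · rw [cosMode, inner_cosFun _ _ (n - n) (n + n + 1)
      (by simp only [freq]; push_cast; ring) (by simp only [freq]; push_cast; ring),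
      if_pos (sub_self _)]
    split_ifs <;> norm_num

lemma norm_cosMode_pos (b : Feedback) (n : ℕ) : 0 < ‖toL2 (cosMode b n)‖ := by
  have := half_le_norm_sq_cosMode b n
  by_contra h
  have h0 : ‖toL2 (cosMode b n)‖ = 0 := le_antisymm (not_lt.1 h) (norm_nonneg _)
  rw [h0] at this
  norm_num at this

lemma eq_zero_of_inner_cosMode (b : Feedback) {f : UnitL2}
    (h : ∀ n, ⟪toL2 (cosMode b n), f⟫ = 0) : f = 0 := by
  cases b
  · refine eq_zero_of_inner_mul_cosFun (m := 1) (Eventually.of_forall fun x => one_ne_zero) fun n => ?_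
    rw [one_mul]
    exact h n
  -- Half-integer frequencies reduce to integer ones: cos(πx/2) cos(nπx) is half the sum of two
  -- cosines of half-integer frequency, the negative ones being reflected by evenness.
  · refine eq_zero_of_inner_mul_cosFun (m := cosFun (Real.pi / 2)) ?_ fun n => ?_
    · refine ae_unit_of_ae (p := fun x => extI (cosFun (Real.pi / 2)) x ≠ 0)
        (Eventually.of_forall fun x hx => ?_) |>.mono fun x hx => by rwa [extI_coe] at hx
      rw [extI_cosFun _ (Ioo_subset_Icc_self hx)]
      have := Real.pi_pos
      exact (Real.cos_pos_of_mem_Ioo ⟨by nlinarith [hx.1], by nlinarith [hx.2]⟩).ne'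
    · rw [cosFun_mul, map_smul, map_add, inner_smul_left, inner_add_left]
      have h1 : ⟪toL2 (cosFun (Real.pi / 2 + n * Real.pi)), f⟫ = 0 := by
        rw [show Real.pi / 2 + n * Real.pi = freq .neumann n by simp only [freq]; ring]
        exact h n
      have h2 : ⟪toL2 (cosFun (Real.pi / 2 - n * Real.pi)), f⟫ = 0 := by
        rcases n with _ | n
        · rw [show Real.pi / 2 - (0 : ℕ) * Real.pi = freq .neumann 0 by
            simp only [freq]; push_cast; ring]
          exact h 0
        · rw [← cosFun_neg, show -(Real.pi / 2 - (n + 1 : ℕ) * Real.pi) = freq .neumann n by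
            simp only [freq]; push_cast; ring]
          exact h n
      rw [h1, h2, add_zero, mul_zero]

lemma orthonormal_cosMode (b : Feedback) : Orthonormal ℝ fun n =>
    (‖toL2 (cosMode b n)‖⁻¹ : ℝ) • toL2 (cosMode b n) := by
  refine ⟨fun n => ?_, fun n m hnm => ?_⟩
  · rw [norm_smul, norm_inv, norm_norm, inv_mul_cancel₀ (norm_cosMode_pos b n).ne']
  · change ⟪_, _⟫ = 0
    rw [inner_smul_left, inner_smul_right, inner_cosMode_of_ne b hnm, mul_zero, mul_zero]

/-- The Hilbert basis of cosines. -/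
def cosBasis (b : Feedback) : HilbertBasis ℕ ℝ UnitL2 :=
  HilbertBasis.mkOfOrthogonalEqBot (orthonormal_cosMode b) <| by
    rw [Submodule.eq_bot_iff]
    intro f hf
    refine eq_zero_of_inner_cosMode b fun n => ?_
    have h1 := (Submodule.mem_orthogonal _ _).1 hf _ (Submodule.subset_span ⟨n, rfl⟩)
    rw [inner_smul_left] at h1
    exact (mul_eq_zero.1 h1).resolve_left (by
      simpa using (norm_cosMode_pos b n).ne')

lemma cosBasis_apply (b : Feedback) (n : ℕ) :
    cosBasis b n = (‖toL2 (cosMode b n)‖⁻¹ : ℝ) • toL2 (cosMode b n) := by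
  rw [cosBasis, HilbertBasis.coe_mkOfOrthogonalEqBot]

end CosineBasis

/-! ### The heat equation solved by cosine series -/

noncomputable section HeatSeries

open scoped RealInnerProductSpace

/-- Decay rates of the modes. -/
def modeRate (lam : ℝ) (b : Feedback) (n : ℕ) : ℝ := freq b n ^ 2 + lam

/-- The coefficients of the solution of the heat equation with initial derivative `g`. -/
def heatCoeff (lam : ℝ) (b : Feedback) (g : UnitL2) (n : ℕ) (t : ℝ) : ℝ :=
  ⟪toL2 (cosMode b n), g⟫ / ‖toL2 (cosMode b n)‖ ^ 2 * Real.exp (-(modeRate lam b n * t))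

/-- The derivative of the solution of the heat equation. -/
def heatGrad (lam : ℝ) (b : Feedback) (g : UnitL2) (t : ℝ) : UnitC :=
  ∑' n, heatCoeff lam b g n t • cosMode b n

/-- The second derivative of the solution of the heat equation. -/
def heatLaplace (lam : ℝ) (b : Feedback) (g : UnitL2) (t : ℝ) : UnitC :=
  ∑' n, heatCoeff lam b g n t • (-freq b n • sinFun (freq b n))

section

variable {lam : ℝ} {b : Feedback} {g : UnitL2}

lemma freq_nonneg (b : Feedback) (n : ℕ) : 0 ≤ freq b n := by
  cases b <;> simp only [freq] <;> positivity

lemma natCast_le_modeRate (hlam : 0 ≤ lam) (b : Feedback) (n : ℕ) : (n : ℝ) ≤ modeRate lam b n := by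
  have h1 : (n : ℝ) ≤ freq b n := by
    have hpi := Real.pi_gt_three
    have hn : (0 : ℝ) ≤ n := n.cast_nonneg
    cases b <;> simp only [freq] <;> nlinarith
  have h2 : freq b n ≤ freq b n ^ 2 ∨ n = 0 := by
    rcases n with _ | n
    · exact Or.inr rfl
    · refine Or.inl ?_
      push_cast at h1
      have : (0 : ℝ) ≤ n := n.cast_nonneg
      nlinarith
  rcases h2 with h2 | h2
  · rw [modeRate]; linarith
  · rw [h2, modeRate, Nat.cast_zero]
    linarith [sq_nonneg (freq b 0)]

lemma modeRate_nonneg (hlam : 0 ≤ lam) (b : Feedback) (n : ℕ) : 0 ≤ modeRate lam b n :=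
  (Nat.cast_nonneg n).trans (natCast_le_modeRate hlam b n)

/-- One half of the exponent absorbs the polynomial factor 1 + x, the other half gives a geometric
sequence because n ≤ x. With x the rate of the n-th mode this dominates the series and its
derivatives uniformly for t ≥ δ. -/
lemma one_add_mul_exp_le {x δ t : ℝ} (hx : 0 ≤ x) (hδ : 0 < δ) (ht : δ ≤ t) {n : ℕ} (hn : n ≤ x) :
    (1 + x) * Real.exp (-(x * t)) ≤ (1 + 2 / δ) * Real.exp (-(δ / 2)) ^ n := by
  have h1 : Real.exp (-(x * t)) ≤ Real.exp (-(x * δ / 2)) * Real.exp (-(x * δ / 2)) := by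
    rw [← Real.exp_add]
    exact Real.exp_le_exp.2 (by nlinarith)
  have h2 : (1 + x) * Real.exp (-(x * δ / 2)) ≤ 1 + 2 / δ := by
    have h3 := Real.add_one_le_exp (x * δ / 2)
    have h4 : x ≤ 2 / δ * Real.exp (x * δ / 2) := by
      rw [div_mul_eq_mul_div, le_div_iff₀ hδ]
      linarith
    have h5 : 1 ≤ Real.exp (x * δ / 2) := Real.one_le_exp (by positivity)
    rw [Real.exp_neg, ← div_eq_mul_inv, div_le_iff₀ (Real.exp_pos _)]
    linarith
  have h3 : Real.exp (-(x * δ / 2)) ≤ Real.exp (-(δ / 2)) ^ n := by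
    rw [← Real.exp_nat_mul]
    exact Real.exp_le_exp.2 (by nlinarith)
  calc (1 + x) * Real.exp (-(x * t))
      ≤ (1 + x) * (Real.exp (-(x * δ / 2)) * Real.exp (-(x * δ / 2))) := by gcongr
    _ = (1 + x) * Real.exp (-(x * δ / 2)) * Real.exp (-(x * δ / 2)) := by ring
    _ ≤ (1 + 2 / δ) * Real.exp (-(δ / 2)) ^ n := by gcongr

/-- The common summable majorant for times `t ≥ δ`. -/
def heatMajorant (g : UnitL2) (δ : ℝ) (n : ℕ) : ℝ :=
  2 * ‖g‖ * ((1 + 2 / δ) * Real.exp (-(δ / 2)) ^ n)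

lemma summable_heatMajorant (g : UnitL2) {δ : ℝ} (hδ : 0 < δ) : Summable (heatMajorant g δ) :=
  ((summable_geometric_of_lt_one (Real.exp_nonneg _)
    (by rw [← Real.exp_zero]; exact Real.exp_lt_exp.2 (by linarith))).mul_left _).mul_left _

lemma abs_heatCoeff_mul_le (hlam : 0 ≤ lam) {δ t : ℝ} (hδ : 0 < δ) (ht : δ ≤ t) (n : ℕ) :
    |heatCoeff lam b g n t| * (1 + modeRate lam b n) ≤ heatMajorant g δ n := by
  have h1 : |⟪toL2 (cosMode b n), g⟫ / ‖toL2 (cosMode b n)‖ ^ 2| ≤ 2 * ‖g‖ := by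
    have hh := half_le_norm_sq_cosMode b n
    have hpos := norm_cosMode_pos b n
    rw [abs_div, abs_of_pos (by positivity : 0 < ‖toL2 (cosMode b n)‖ ^ 2), div_le_iff₀ (by positivity)]
    have h2 : ‖toL2 (cosMode b n)‖ ≤ 1 := (norm_toL2_le _).trans (norm_cosFun_le _)
    have h3 := abs_real_inner_le_norm (toL2 (cosMode b n)) g
    have h4 : ‖toL2 (cosMode b n)‖ * ‖g‖ ≤ 1 * ‖g‖ := by gcongr
    nlinarith [norm_nonneg g]
  rw [heatCoeff, abs_mul, Real.abs_exp, heatMajorant]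
  have h2 := one_add_mul_exp_le (modeRate_nonneg hlam b n) hδ ht (natCast_le_modeRate hlam b n)
  calc _ = |⟪toL2 (cosMode b n), g⟫ / ‖toL2 (cosMode b n)‖ ^ 2| *
        ((1 + modeRate lam b n) * Real.exp (-(modeRate lam b n * t))) := by ring
    _ ≤ _ := by
        gcongr
        have := modeRate_nonneg hlam b n
        positivity

lemma norm_heatCoeff_smul_le (hlam : 0 ≤ lam) {δ t : ℝ} (hδ : 0 < δ) (ht : δ ≤ t) (n : ℕ) {v : UnitC}
    (hv : ‖v‖ ≤ 1 + modeRate lam b n) : ‖heatCoeff lam b g n t • v‖ ≤ heatMajorant g δ n := by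
  rw [norm_smul, Real.norm_eq_abs]
  exact (mul_le_mul_of_nonneg_left hv (abs_nonneg _)).trans (abs_heatCoeff_mul_le hlam hδ ht n)

lemma norm_cosMode_le (hlam : 0 ≤ lam) (b : Feedback) (n : ℕ) :
    ‖cosMode b n‖ ≤ 1 + modeRate lam b n :=
  (norm_cosFun_le _).trans (by linarith [modeRate_nonneg hlam b n])

lemma norm_sinMode_le (hlam : 0 ≤ lam) (b : Feedback) (n : ℕ) :
    ‖-freq b n • sinFun (freq b n)‖ ≤ 1 + modeRate lam b n := by
  rw [norm_smul, norm_neg, Real.norm_eq_abs, abs_of_nonneg (freq_nonneg b n), modeRate]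
  have := mul_le_mul_of_nonneg_left (norm_sinFun_le (freq b n)) (freq_nonneg b n)
  nlinarith [sq_nonneg (freq b n - 1)]

lemma hasSum_heatGrad (hlam : 0 ≤ lam) (b : Feedback) (g : UnitL2) {t : ℝ} (ht : 0 < t) :
    HasSum (fun n => heatCoeff lam b g n t • cosMode b n) (heatGrad lam b g t) :=
  (Summable.of_norm_bounded (summable_heatMajorant g ht) fun n =>
    norm_heatCoeff_smul_le hlam ht le_rfl n (norm_cosMode_le hlam b n)).hasSum

lemma hasSum_heatLaplace (hlam : 0 ≤ lam) (b : Feedback) (g : UnitL2) {t : ℝ} (ht : 0 < t) :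
    HasSum (fun n => heatCoeff lam b g n t • (-freq b n • sinFun (freq b n)))
      (heatLaplace lam b g t) :=
  (Summable.of_norm_bounded (summable_heatMajorant g ht) fun n =>
    norm_heatCoeff_smul_le hlam ht le_rfl n (norm_sinMode_le hlam b n)).hasSum

lemma hasDerivAt_heatCoeff (lam : ℝ) (b : Feedback) (g : UnitL2) (n : ℕ) (t : ℝ) :
    HasDerivAt (heatCoeff lam b g n) (heatCoeff lam b g n t * -modeRate lam b n) t := by
  have h1 : HasDerivAt (fun t => Real.exp (-(modeRate lam b n * t)))
      (Real.exp (-(modeRate lam b n * t)) * -(modeRate lam b n)) t := by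
    simpa using ((hasDerivAt_id t).const_mul (modeRate lam b n)).neg.exp
  convert! h1.const_mul (⟪toL2 (cosMode b n), g⟫ / ‖toL2 (cosMode b n)‖ ^ 2) using 1
  rw [heatCoeff, mul_assoc]

lemma continuousOn_heatLaplace (hlam : 0 ≤ lam) (b : Feedback) (g : UnitL2) :
    ContinuousOn (heatLaplace lam b g) (Ioi 0) := by
  intro t ht
  have hδ : 0 < t / 2 := half_pos ht
  have h1 : ContinuousOn (heatLaplace lam b g) (Ici (t / 2)) :=
    continuousOn_tsum (fun n => Continuous.continuousOn (Continuous.smul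
      (continuous_iff_continuousAt.2 fun s => (hasDerivAt_heatCoeff lam b g n s).continuousAt)
      continuous_const)) (summable_heatMajorant g hδ) fun n s hs =>
        norm_heatCoeff_smul_le hlam hδ hs n (norm_sinMode_le hlam b n)
  exact (h1.continuousAt (Ici_mem_nhds (half_lt_self ht))).continuousWithinAt

lemma modeRate_smul_primitive (lam : ℝ) (b : Feedback) (n : ℕ) :
    -modeRate lam b n • primitive (cosMode b n) =
      -freq b n • sinFun (freq b n) - lam • primitive (cosMode b n) := by
  rw [modeRate, ← smul_primitive_cosFun, smul_smul, cosMode, ← sub_smul]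
  congr 1
  ring

lemma hasDerivAt_primitive_heatGrad (hlam : 0 ≤ lam) (b : Feedback) (g : UnitL2) {t : ℝ}
    (ht : 0 < t) : HasDerivAt (fun s => primitive (heatGrad lam b g s))
      (heatLaplace lam b g t - lam • primitive (heatGrad lam b g t)) t := by
  have hδ : 0 < t / 2 := half_pos ht
  have hJ : ∀ s, 0 < s → HasSum (fun n => heatCoeff lam b g n s • primitive (cosMode b n))
      (primitive (heatGrad lam b g s)) := fun s hs => by
    simpa only [map_smul] using (hasSum_heatGrad hlam b g hs).mapL primitive
  have hsum : HasSum (fun n => (heatCoeff lam b g n t * -modeRate lam b n) • primitive (cosMode b n))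
      (heatLaplace lam b g t - lam • primitive (heatGrad lam b g t)) := by
    have h1 := (hasSum_heatLaplace hlam b g ht).sub ((hJ t ht).const_smul lam)
    refine h1.congr_fun ?_
    intro n
    rw [mul_smul, modeRate_smul_primitive, smul_sub, smul_comm lam]
  have h2 := hasDerivAt_tsum_of_isPreconnected (𝕜 := ℝ)
    (g := fun n s => heatCoeff lam b g n s • primitive (cosMode b n))
    (g' := fun n s => (heatCoeff lam b g n s * -modeRate lam b n) • primitive (cosMode b n))
    (summable_heatMajorant g hδ) (isOpen_Ioi (a := t / 2)) isPreconnected_Ioi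
    (fun n s _ => (hasDerivAt_heatCoeff lam b g n s).smul_const (primitive (cosMode b n))) (fun n s hs => by
      rw [norm_smul, norm_mul, norm_neg, Real.norm_eq_abs, Real.norm_eq_abs,
        abs_of_nonneg (modeRate_nonneg hlam b n)]
      have h3 : ‖primitive (cosMode b n)‖ ≤ 1 :=
        (norm_primitive_le _).trans ((norm_toL2_le _).trans (norm_cosFun_le _))
      have h4 := abs_heatCoeff_mul_le (b := b) (g := g) hlam hδ (le_of_lt hs) n
      have h5 : 0 ≤ |heatCoeff lam b g n s| * modeRate lam b n :=
        mul_nonneg (abs_nonneg _) (modeRate_nonneg hlam b n)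
      nlinarith [abs_nonneg (heatCoeff lam b g n s)])
    (y₀ := t) (half_lt_self ht) (hJ t ht).summable (half_lt_self ht)
  rw [hsum.tsum_eq] at h2
  refine h2.congr_of_eventuallyEq ?_
  filter_upwards [lt_mem_nhds ht] with s hs
  exact (hJ s hs).tsum_eq.symm

lemma exp_modeRate_tendsto (lam : ℝ) (b : Feedback) (n : ℕ) :
    Tendsto (fun t => Real.exp (-(modeRate lam b n * t))) (𝓝[>] 0) (𝓝 1) := by
  have : Continuous fun t => Real.exp (-(modeRate lam b n * t)) := by fun_prop
  simpa using (this.tendsto 0).mono_left nhdsWithin_le_nhds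

lemma inner_cosMode_heatGrad (hlam : 0 ≤ lam) (b : Feedback) (g : UnitL2) {t : ℝ} (ht : 0 < t)
    (m : ℕ) : ⟪toL2 (cosMode b m), toL2 (heatGrad lam b g t)⟫ =
      Real.exp (-(modeRate lam b m * t)) * ⟪toL2 (cosMode b m), g⟫ := by
  have h1 := ((hasSum_heatGrad hlam b g ht).mapL toL2).mapL (innerSL ℝ (toL2 (cosMode b m)))
  have h2 := hasSum_single (f := fun n => innerSL ℝ (toL2 (cosMode b m))
    (toL2 (heatCoeff lam b g n t • cosMode b n))) m fun n hn => by
      rw [innerSL_apply_apply, map_smul, inner_smul_right, inner_cosMode_of_ne b hn.symm, mul_zero]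
  have h3 := h1.unique h2
  rw [innerSL_apply_apply, innerSL_apply_apply, map_smul, inner_smul_right,
    real_inner_self_eq_norm_sq, heatCoeff] at h3
  rw [h3]
  have := norm_cosMode_pos b m
  field_simp

/-- By Parseval the squared distance is the sum of (1 - exp(-rate·t))² times the squared
coefficients of g; every term tends to 0 and the squared coefficients dominate. -/
lemma tendsto_toL2_heatGrad (hlam : 0 ≤ lam) (b : Feedback) (g : UnitL2) :
    Tendsto (fun t => toL2 (heatGrad lam b g t)) (𝓝[>] 0) (𝓝 g) := by
  have hco : ∀ t, 0 < t → ∀ n, ⟪cosBasis b n, g - toL2 (heatGrad lam b g t)⟫ =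
      (1 - Real.exp (-(modeRate lam b n * t))) * ⟪cosBasis b n, g⟫ := by
    intro t ht n
    rw [inner_sub_right, cosBasis_apply, inner_smul_left, inner_smul_left,
      inner_cosMode_heatGrad hlam b g ht]
    ring
  have hnorm : ∀ t, 0 < t → ∑' n, ((1 - Real.exp (-(modeRate lam b n * t))) *
      ⟪cosBasis b n, g⟫) ^ 2 = ‖g - toL2 (heatGrad lam b g t)‖ ^ 2 := by
    intro t ht
    rw [← real_inner_self_eq_norm_sq, ← (cosBasis b).tsum_inner_mul_inner]
    refine tsum_congr fun n => ?_
    have e : ⟪g - toL2 (heatGrad lam b g t), cosBasis b n⟫ =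
        ⟪cosBasis b n, g - toL2 (heatGrad lam b g t)⟫ := real_inner_comm _ _
    rw [e, hco t ht n, sq]
  have hsum : Summable fun n => ⟪cosBasis b n, g⟫ ^ 2 := by
    refine ((cosBasis b).summable_inner_mul_inner g g).congr fun n => ?_
    rw [real_inner_comm, sq]
  have hlim : Tendsto (fun t => ∑' n, ((1 - Real.exp (-(modeRate lam b n * t))) *
      ⟪cosBasis b n, g⟫) ^ 2) (𝓝[>] 0) (𝓝 (∑' _ : ℕ, (0 : ℝ))) := by
    refine tendsto_tsum_of_dominated_convergence hsum (fun n => ?_) ?_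
    · have := (((exp_modeRate_tendsto lam b n).const_sub 1).mul_const ⟪cosBasis b n, g⟫).pow 2
      simpa using this
    · filter_upwards [self_mem_nhdsWithin] with t ht n
      have h1 : Real.exp (-(modeRate lam b n * t)) ≤ 1 :=
        Real.exp_le_one_iff.2 (neg_nonpos.2 (mul_nonneg (modeRate_nonneg hlam b n) (le_of_lt ht)))
      have h2 := Real.exp_pos (-(modeRate lam b n * t))
      rw [Real.norm_eq_abs, abs_of_nonneg (sq_nonneg _), mul_pow]
      exact mul_le_of_le_one_left (sq_nonneg _) (by nlinarith)
  rw [tsum_zero] at hlim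
  rw [tendsto_iff_norm_sub_tendsto_zero]
  have h1 : Tendsto (fun t => ‖g - toL2 (heatGrad lam b g t)‖ ^ 2) (𝓝[>] 0) (𝓝 0) :=
    hlim.congr' (by filter_upwards [self_mem_nhdsWithin] with t ht using hnorm t ht)
  have h2 := h1.sqrt
  simp only [Real.sqrt_zero, Real.sqrt_sq (norm_nonneg _)] at h2
  simpa only [norm_sub_rev] using h2

/-- The heat equation with homogeneous boundary conditions is solvable for `H¹` data. -/
theorem heatLoop_heatGrad (hlam : 0 ≤ lam) (b : Feedback) (g : UnitL2)
    (hg : b = .dirichlet → ⟪toL2 (1 : UnitC), g⟫ = 0) (τ : ℝ) :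
    HeatLoop lam b τ (heatGrad lam b g) (heatLaplace lam b g) where
  space := fun t ht => by
    have h1 := (hasSum_heatLaplace hlam b g ht.1).mapL primitive
    have h2 := hasSum_heatGrad hlam b g ht.1
    have h3 := h2.sub h1
    -- Each mode differs from the primitive of its derivative by its value at x = 0, which is the
    -- coefficient. The sums at different x therefore agree, and p - ∫q is constant.
    have h4 : ∀ n, heatCoeff lam b g n t • cosMode b n -
        primitive (heatCoeff lam b g n t • (-freq b n • sinFun (freq b n))) =
        heatCoeff lam b g n t • (1 : UnitC) := fun n => by
      rw [map_smul, ← smul_sub]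
      congr 1
      rw [cosMode, sub_eq_iff_eq_add]
      exact cosFun_eq_primitive _
    simp only [h4] at h3
    refine ⟨heatGrad lam b g t 1 - primitive (heatLaplace lam b g t) 1, ?_⟩
    have h5 : ∀ x, HasSum (fun n => heatCoeff lam b g n t)
        ((heatGrad lam b g t - primitive (heatLaplace lam b g t)) x) := fun x => by
      have := h3.mapL (ContinuousMap.evalCLM ℝ x : UnitC →L[ℝ] ℝ)
      simpa using this
    ext x
    have h6 := (h5 x).unique (h5 1)
    simp only [ContinuousMap.sub_apply] at h6
    rw [ContinuousMap.add_apply, ContinuousMap.const_apply]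
    linarith
  time := fun t ht => hasDerivAt_primitive_heatGrad hlam b g ht.1
  continuousOn := (continuousOn_heatLaplace hlam b g).mono fun t ht => ht.1
  bc := fun t ht => by
    have h2 := hasSum_heatGrad hlam b g ht.1
    cases b
    · have h3 := (h2.mapL primitive).mapL (ContinuousMap.evalCLM ℝ 1 : UnitC →L[ℝ] ℝ)
      refine h3.unique ?_
      convert hasSum_zero (α := ℝ) (β := ℕ) using 2 with n
      change primitive (heatCoeff lam .dirichlet g n t • cosMode .dirichlet n) 1 = 0
      rw [map_smul, ContinuousMap.smul_apply, smul_eq_mul]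
      -- The constant mode has the primitive x, which does not vanish at 1; its coefficient is zero
      -- by the hypothesis on g. The other modes have primitives proportional to sin(nπx).
      rcases n with _ | n
      · have : cosMode .dirichlet 0 = 1 := by
          ext x
          simp [cosMode, freq, cosFun_apply]
        rw [heatCoeff, this, hg rfl, zero_div, zero_mul, zero_mul]
      · have h4 := congrArg (fun f : UnitC => f 1) (smul_primitive_cosFun (freq .dirichlet (n + 1)))
        simp only [ContinuousMap.smul_apply, smul_eq_mul, sinFun_apply] at h4
        rw [show ((1 : Icc (0 : ℝ) 1) : ℝ) = 1 from rfl, mul_one,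
          show Real.sin (freq .dirichlet (n + 1)) = 0 from Real.sin_nat_mul_pi _] at h4
        have h5 : freq .dirichlet (n + 1) ≠ 0 := by
          simp only [freq]
          exact mul_ne_zero (Nat.cast_ne_zero.2 n.succ_ne_zero) Real.pi_ne_zero
        rw [cosMode, (mul_eq_zero.1 h4).resolve_left h5, mul_zero]
    · have h3 := h2.mapL (ContinuousMap.evalCLM ℝ 1 : UnitC →L[ℝ] ℝ)
      refine h3.unique ?_
      convert hasSum_zero (α := ℝ) (β := ℕ) using 2 with n
      change heatCoeff lam .neumann g n t * cosMode .neumann n 1 = 0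
      have h4 : cosMode .neumann n 1 = 0 := by
        rw [cosMode, cosFun_apply, show ((1 : Icc (0 : ℝ) 1) : ℝ) = 1 from rfl, mul_one, freq,
          Real.cos_eq_zero_iff]
        exact ⟨n, by push_cast; ring⟩
      rw [h4, mul_zero]

end

end HeatSeries

/-! ### Existence for the closed loop -/

noncomputable section Existence

open scoped RealInnerProductSpace

lemma HasGrad.inner_one {f : ℝ → ℝ} {g : UnitL2} (h : HasGrad f g) :
    ⟪toL2 (1 : UnitC), g⟫ = f 1 - f 0 := by
  rw [← h.ac.integral_deriv_eq_sub, ← integral_unit, L2.inner_def]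
  refine integral_congr_ae ?_
  filter_upwards [h.ae, coeFn_toL2 1] with x h1 h2
  rw [h1, h2]
  exact mul_one _

lemma tendsto_clm_apply {X : Type*} {l : Filter X} {A : X → UnitC →L[ℝ] UnitC} {u : X → UnitC}
    {A₀ : UnitC →L[ℝ] UnitC} {u₀ : UnitC} (hA : Tendsto A l (𝓝 A₀)) (hu : Tendsto u l (𝓝 u₀)) :
    Tendsto (fun x => A x (u x)) l (𝓝 (A₀ u₀)) :=
  ((isBoundedBilinearMap_apply (𝕜 := ℝ) (E := UnitC) (F := UnitC)).continuous.tendsto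
    (A₀, u₀)).comp (hA.prodMk_nhds hu)

lemma const_eq_smul_one (c : ℝ) : (ContinuousMap.const _ c : UnitC) = c • (1 : UnitC) := by
  ext x
  simp

lemma contDiff_two_primitive_primitive {P Q : UnitC} {c : ℝ}
    (hP : P = ContinuousMap.const _ c + primitive Q) :
    ContDiff ℝ 2 (fun x => ∫ y in (0 : ℝ)..x, (c + ∫ z in (0 : ℝ)..y, extI Q z)) ∧
      ∀ x ∈ Icc (0 : ℝ) 1, extI P x = c + ∫ z in (0 : ℝ)..x, extI Q z := by
  have hQ := continuous_extI Q
  have hd1 : ∀ x, HasDerivAt (fun y => c + ∫ z in (0 : ℝ)..y, extI Q z) (extI Q x) x := fun x =>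
    ((hQ.integral_hasStrictDerivAt 0 x).hasDerivAt).const_add c
  have hc1 : Continuous (fun y => c + ∫ z in (0 : ℝ)..y, extI Q z) :=
    continuous_iff_continuousAt.2 fun x => (hd1 x).continuousAt
  have hd2 : ∀ x, HasDerivAt (fun x => ∫ y in (0 : ℝ)..x, (c + ∫ z in (0 : ℝ)..y, extI Q z))
      (c + ∫ z in (0 : ℝ)..x, extI Q z) x := fun x => (hc1.integral_hasStrictDerivAt 0 x).hasDerivAt
  refine ⟨?_, fun x hx => ?_⟩
  · have h1 : ContDiff ℝ 1 (fun y => c + ∫ z in (0 : ℝ)..y, extI Q z) := by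
      rw [contDiff_one_iff_deriv]
      refine ⟨fun x => (hd1 x).differentiableAt, ?_⟩
      rw [show deriv (fun y => c + ∫ z in (0 : ℝ)..y, extI Q z) = extI Q from
        funext fun x => (hd1 x).deriv]
      exact hQ
    rw [show (2 : WithTop ℕ∞) = 1 + 1 by norm_num, contDiff_succ_iff_deriv]
    refine ⟨fun x => (hd2 x).differentiableAt, by simp, ?_⟩
    rw [show deriv (fun x => ∫ y in (0 : ℝ)..x, (c + ∫ z in (0 : ℝ)..y, extI Q z)) =
      (fun y => c + ∫ z in (0 : ℝ)..y, extI Q z) from funext fun x => (hd2 x).deriv]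
    exact h1
  · rw [hP, extI_add, extI_primitive Q hx]
    rfl

lemma contDiffOn_two_of_primitive {f : ℝ → ℝ} {P Q : UnitC} {c : ℝ}
    (hP : P = ContinuousMap.const _ c + primitive Q)
    (hf : ∀ x ∈ Icc (0 : ℝ) 1, f x = extI (primitive P) x) : ContDiffOn ℝ 2 f (Icc 0 1) := by
  obtain ⟨h1, h2⟩ := contDiff_two_primitive_primitive hP
  refine h1.contDiffOn.congr fun x hx => ?_
  rw [hf x hx, extI_primitive P hx]
  refine intervalIntegral.integral_congr fun y hy => ?_
  rw [uIcc_of_le hx.1] at hy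
  exact h2 y ⟨hy.1, hy.2.trans hx.2⟩

lemma derivWithin_of_primitive {f : ℝ → ℝ} {P : UnitC} {c : ℝ}
    (hf : ∀ x ∈ Icc (0 : ℝ) 1, f x = c + extI (primitive P) x) {x : ℝ} (hx : x ∈ Icc (0 : ℝ) 1) :
    derivWithin f (Icc 0 1) x = extI P x := by
  have hd : HasDerivWithinAt (fun x => c + ∫ y in (0 : ℝ)..x, extI P y) (extI P x) (Icc 0 1) x :=
    ((((continuous_extI P).integral_hasStrictDerivAt 0 x).hasDerivAt).const_add c).hasDerivWithinAt
  have he : ∀ y ∈ Icc (0 : ℝ) 1, f y = c + ∫ z in (0 : ℝ)..y, extI P z := fun y hy => by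
    rw [hf y hy, extI_primitive P hy]
  exact (hd.congr he (he x hx)).derivWithin (uniqueDiffOn_Icc zero_lt_one x hx)

lemma continuousOn_extI_prod {V : ℝ → UnitC} {s : Set ℝ} (hV : ContinuousOn V s) :
    ContinuousOn (fun p : ℝ × ℝ => extI (V p.2) p.1) (Icc (0 : ℝ) 1 ×ˢ s) := by
  have h1 : ContinuousOn (fun p : ℝ × ℝ => (V p.2, projIcc (0 : ℝ) 1 zero_le_one p.1))
      (Icc (0 : ℝ) 1 ×ˢ s) :=
    (hV.comp continuousOn_snd fun p hp => hp.2).prodMk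
      (continuous_projIcc.comp continuous_fst).continuousOn
  exact (ContinuousEval.continuous_eval (F := UnitC)).comp_continuousOn h1

section

variable {a : ℝ → ℝ → ℝ} {lam ε : ℝ} {α : ℝ → UnitC} {G : ℝ → C(triangle, ℝ)}
  {k : ℝ → ℝ → ℝ → ℝ} {b : Feedback} {P Q : ℝ → UnitC} {τ : ℝ}

/-- In P = c + ∫Q the constant is recovered as c = u(1) - ∬Q, and both terms are continuous in time.
-/
lemma ClosedLoop.continuousOn_grad (h : ClosedLoop α G lam b τ P Q) : ContinuousOn P (Ioo 0 τ) := by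
  have hU : ContinuousOn (fun t => primitive (P t)) (Ioo 0 τ) := fun t ht =>
    (h.time t ht).continuousAt.continuousWithinAt
  have hJQ := primitive.continuous.comp_continuousOn h.continuousOn
  have hJJQ := primitive.continuous.comp_continuousOn hJQ
  have heval : Continuous fun f : UnitC => f 1 := ContinuousEvalConst.continuous_eval_const 1
  have h1 : ContinuousOn (fun t => (primitive (P t) 1 - primitive (primitive (Q t)) 1) • (1 : UnitC) +
      primitive (Q t)) (Ioo 0 τ) :=
    (((heval.comp_continuousOn hU).sub (heval.comp_continuousOn hJJQ)).smul continuousOn_const).add hJQ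
  refine h1.congr fun t ht => ?_
  obtain ⟨c, hc⟩ := h.space t ht
  have h2 : primitive (P t) 1 = c + primitive (primitive (Q t)) 1 := by
    have h3 : primitive (ContinuousMap.const _ c : UnitC) 1 = c := by
      rw [primitive_apply]
      change ∫ y in (0 : ℝ)..1, c = c
      simp
    rw [hc, map_add, ContinuousMap.add_apply, h3]
  simp only
  rw [h2, add_sub_cancel_right, ← const_eq_smul_one]
  exact hc

/-- The function of `(x,t)` described by a trajectory of the closed loop and its initial value. -/
def loopState (u₀ : ℝ → ℝ) (P : ℝ → UnitC) (x t : ℝ) : ℝ :=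
  if 0 < t then extI (primitive (P t)) x else u₀ x

lemma loopState_of_pos {u₀ : ℝ → ℝ} {t : ℝ} (ht : 0 < t) (x : ℝ) :
    loopState u₀ P x t = extI (primitive (P t)) x := if_pos ht

lemma loopState_zero {u₀ : ℝ → ℝ} (x : ℝ) : loopState u₀ P x 0 = u₀ x := if_neg (lt_irrefl 0)

lemma extI_primitive_zero (p : UnitC) : extI (primitive p) 0 = 0 := by
  rw [extI_primitive p ⟨le_rfl, zero_le_one⟩, intervalIntegral.integral_same]

/-- A trajectory of the closed loop with `u_x(t) → u₀'` in `L²` is a solution of the initial boundary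
value problem. -/
theorem ClosedLoop.isSolution (h : IsGoursatSolution a lam ε α G) (hk : IsBacksteppingKernel a lam k)
    (hτ : τ ≤ 1) (hc : ClosedLoop α G lam b τ P Q) {u₀ : ℝ → ℝ} {g : UnitL2} (hg : HasGrad u₀ g)
    (h0 : u₀ 0 = 0) (hlim : Tendsto (fun s => toL2 (P s)) (𝓝[>] 0) (𝓝 g)) :
    IsSolution a k b u₀ τ (loopState u₀ P) := by
  set u := loopState u₀ P with hu
  set U : ℝ → UnitC := fun t => primitive (P t) with hUdef
  set V : ℝ → UnitC := fun t => Q t + (α t * U t - lam • U t) with hV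
  have hmem : ∀ t ∈ Ioo 0 τ, t ∈ Ico (0 : ℝ) 1 := fun t ht => ⟨ht.1.le, ht.2.trans_le hτ⟩
  have huU : ∀ t, 0 < t → ∀ x, u x t = extI (U t) x := fun t ht x => loopState_of_pos ht x
  have hUc : ContinuousOn U (Ioo 0 τ) := fun t ht =>
    (hc.time t ht).continuousAt.continuousWithinAt
  have hαc : ContinuousOn α (Ioo 0 τ) := (h.analytic_coeff.continuousOn).mono (h.Ioo_subset hτ)
  have hVc : ContinuousOn V (Ioo 0 τ) :=
    hc.continuousOn.add ((hαc.mul hUc).sub (hUc.const_smul lam))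
  have htime : ∀ x, ∀ t ∈ Ioo 0 τ, HasDerivAt (fun s => u x s) (extI (V t) x) t := by
    intro x t ht
    refine (hasDerivAt_eval (hc.time t ht) (projIcc 0 1 zero_le_one x)).congr_of_eventuallyEq ?_
    filter_upwards [lt_mem_nhds ht.1] with s hs using huU s hs x
  have hux : ∀ t ∈ Ioo 0 τ, ∀ x ∈ Icc (0 : ℝ) 1, spaceDeriv u x t = extI (P t) x := fun t ht x hx =>
    derivWithin_of_primitive (c := 0) (fun y _ => by rw [zero_add]; exact huU t ht.1 y) hx
  have huxx : ∀ t ∈ Ioo 0 τ, ∀ x ∈ Icc (0 : ℝ) 1,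
      spaceDeriv (spaceDeriv u) x t = extI (Q t) x := by
    intro t ht x hx
    obtain ⟨c, hPc⟩ := hc.space t ht
    refine derivWithin_of_primitive (c := c) (fun y hy => ?_) hx
    rw [hux t ht y hy, hPc, extI_add]
    rfl
  have hgrad : ∀ t ∈ Ico 0 τ, HasGrad (fun x => u x t) (if 0 < t then toL2 (P t) else g) := by
    intro t ht
    split_ifs with h1
    · exact HasGrad.of_primitive fun x _ => huU t h1 x
    · have : t = 0 := le_antisymm (not_lt.1 h1) ht.1
      subst this
      exact hg.congr fun x _ => (loopState_zero x).symm
  have hzero : ∀ t ∈ Ico 0 τ, u 0 t = 0 := by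
    intro t ht
    rcases ht.1.eq_or_lt with h1 | h1
    · rw [← h1, hu, loopState_zero, h0]
    · rw [huU t h1]
      exact extI_primitive_zero _
  have hgc : ∀ s ∈ Ico 0 τ, Tendsto (fun t => if 0 < t then toL2 (P t) else g) (𝓝[Ico 0 τ] s)
      (𝓝 (if 0 < s then toL2 (P s) else g)) := by
    intro s hs
    rcases hs.1.eq_or_lt with h1 | h1
    · subst h1
      rw [if_neg (lt_irrefl 0)]
      -- The one-sided filter at 0 splits into positive times, where the assumed limit applies, and
      -- the point 0, where the gradient is g by definition.
      have h2 : 𝓝[Ico 0 τ] (0 : ℝ) ≤ 𝓝[>] 0 ⊔ pure 0 := by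
        rw [sup_comm, ← nhdsWithin_insert, Ioi_insert]
        exact nhdsWithin_mono _ Ico_subset_Ici_self
      refine Tendsto.mono_left (tendsto_sup.2 ⟨?_, ?_⟩) h2
      · refine hlim.congr' ?_
        filter_upwards [self_mem_nhdsWithin] with t ht using (if_pos ht).symm
      · rw [tendsto_pure_left]
        intro s hs
        rw [if_neg (lt_irrefl 0)]
        exact mem_of_mem_nhds hs
    · rw [if_pos h1]
      have h2 : ContinuousAt P s := (hc.continuousOn_grad s ⟨h1, hs.2⟩).continuousAt
        (isOpen_Ioo.mem_nhds ⟨h1, hs.2⟩)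
      refine Tendsto.mono_left ?_ nhdsWithin_le_nhds
      refine ((toL2.continuous.tendsto _).comp h2.tendsto).congr' ?_
      filter_upwards [lt_mem_nhds h1] with t ht using (if_pos ht).symm
  refine ⟨fun t ht => (hgrad t ht).memH1, fun s hs => ?_, fun x _ t ht =>
    (htime x t ht).differentiableAt, fun t ht => ?_, ?_, ?_, fun x hx t ht => ?_, fun t ht =>
    hzero t ⟨ht.1.le, ht.2⟩, fun t ht => ?_, fun x _ => loopState_zero x⟩
  · have h1 := ((hgc s hs).sub_const (if 0 < s then toL2 (P s) else g)).norm.const_mul 2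
    rw [sub_self, norm_zero, mul_zero] at h1
    refine squeeze_zero' (Eventually.of_forall fun _ => Real.sqrt_nonneg _) ?_ h1
    filter_upwards [self_mem_nhdsWithin] with t ht
    exact ((hgrad t ht).sub (hgrad s hs)).normH1_le (by rw [hzero t ht, hzero s hs, sub_zero])
  · obtain ⟨c, hPc⟩ := hc.space t ht
    exact contDiffOn_two_of_primitive hPc fun x _ => huU t ht.1 x
  · exact (continuousOn_extI_prod hVc).congr fun p hp => (htime p.1 p.2 hp.2).deriv
  · exact (continuousOn_extI_prod hc.continuousOn).congr fun p hp => huxx p.2 hp.2 p.1 hp.1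
  · have hxI := Ioo_subset_Icc_self hx
    rw [(htime x t ht).deriv, huxx t ht x hxI, huU t ht.1, hV, extI_add, extI_sub, extI_mul,
      extI_smul, h.coeff_eq t (hmem t ht) x hxI]
    ring
  · refine (h.feedbackLaw_iff hk (hmem t ht) (P := P t) (fun x _ => (huU t ht.1 x).symm) ?_ b).2
      (hc.bc t ht)
    rw [hux t ht 1 ⟨zero_le_one, le_rfl⟩]
    exact extI_coe (P t) 1

theorem IsGoursatSolution.exists_solution (h : IsGoursatSolution a lam ε α G) (hlam : 0 ≤ lam)
    (hk : IsBacksteppingKernel a lam k) {u₀ : ℝ → ℝ} (hu₀ : MemH1 u₀) (hcomp : Compatible k u₀ b) :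
    ∃ u, IsSolution a k b u₀ 1 u := by
  obtain ⟨g₀, hg₀⟩ := hu₀.exists_hasGrad
  have h0 := hcomp.zero
  have h0mem : (0 : ℝ) ∈ Ioo (-ε) 1 := ⟨by linarith [h.pos], zero_lt_one⟩
  have hu₀c : ContinuousOn u₀ (Icc 0 1) := by
    have := hu₀.1.continuousOn
    rwa [uIcc_of_le zero_le_one] at this
  set U₀ : UnitC := toUnitC u₀ with hU₀
  have hU₀e : ∀ x ∈ Icc (0 : ℝ) 1, extI U₀ x = u₀ x := fun x hx => extI_toUnitC hu₀c hx
  set w₀ : UnitC := (1 + volterra (G 0)) U₀ with hw₀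
  set D₀ : UnitC := volterraDx α G 0 U₀ with hD₀
  -- The gradient of w₀ = u₀ + Ku₀ is g₀ + D₀; the sum is written as a difference with the primitive
  -- of -D₀ in order to use `HasGrad.sub`.
  have hw₀g : HasGrad (fun x => -extI (primitive (-D₀)) x + u₀ x) (g₀ + toL2 D₀) := by
    have h1 := hg₀.sub (HasGrad.of_primitive (P := -D₀) fun x _ => rfl)
    rw [show toL2 (-D₀) = -toL2 D₀ from map_neg _ _, sub_neg_eq_add] at h1
    exact h1.congr fun x _ => by ring
  have hw₀e : ∀ x ∈ Icc (0 : ℝ) 1, -extI (primitive (-D₀)) x + u₀ x = extI w₀ x := by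
    intro x hx
    rw [hw₀, one_add_volterra_apply, h.volterra_eq_primitive h0mem, extI_add, hU₀e x hx, ← hD₀,
      map_neg, extI_of_mem _ hx, extI_of_mem _ hx, ContinuousMap.neg_apply]
    ring
  have hw₀' : HasGrad (extI w₀) (g₀ + toL2 D₀) := hw₀g.congr hw₀e
  set g : UnitL2 := g₀ + toL2 D₀ with hg
  have hw₀0 : extI w₀ 0 = 0 := by
    rw [← hw₀e 0 ⟨le_rfl, zero_le_one⟩, extI_primitive_zero, h0, neg_zero, zero_add]
  -- The mean of w₀' is w₀(1) - w₀(0), and w₀(1) = 0 is the Dirichlet compatibility condition.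
  have hbc : b = .dirichlet → ⟪toL2 (1 : UnitC), g⟫ = 0 := by
    intro hb
    subst hb
    have h1 : u₀ 1 = -∫ y in (0 : ℝ)..1, k 1 y 0 * u₀ y := hcomp.2
    rw [h.integral_kernel hk ⟨le_rfl, zero_lt_one⟩ hU₀e, ← hU₀e 1 ⟨zero_le_one, le_rfl⟩] at h1
    rw [hw₀'.inner_one, hw₀0, sub_zero, hw₀, one_add_volterra_apply, extI_add, h1]
    rw [show extI (volterra (G 0) U₀) 1 = volterra (G 0) U₀ 1 from extI_coe _ 1]
    exact neg_add_cancel _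
  have hheat := heatLoop_heatGrad hlam b g hbc 1
  have hplim := tendsto_toL2_heatGrad hlam b g
  obtain ⟨Q, hclosed⟩ := hheat.closedLoop h le_rfl
  refine ⟨_, hclosed.isSolution h hk le_rfl hg₀ h0 ?_⟩
  have hW : Tendsto (fun t => primitive (heatGrad lam b g t)) (𝓝[>] 0) (𝓝 w₀) := by
    rw [tendsto_iff_norm_sub_tendsto_zero]
    refine squeeze_zero (fun _ => norm_nonneg _) (fun t => ?_)
      (tendsto_iff_norm_sub_tendsto_zero.1 hplim)
    rw [ContinuousMap.norm_le _ (norm_nonneg _)]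
    intro x
    have h1 := ((HasGrad.of_primitive (P := heatGrad lam b g t) fun x _ => rfl).sub hw₀').abs_le
      (by rw [extI_primitive_zero, hw₀0, sub_zero]) x.2
    rw [extI_coe, extI_coe] at h1
    exact h1
  have hnhds : 𝓝[>] (0 : ℝ) ≤ 𝓝 0 := nhdsWithin_le_nhds
  have hS : Tendsto (volterraInv G) (𝓝[>] 0) (𝓝 (volterraInv G 0)) :=
    ((h.differentiableAt_volterraInv h0mem).continuousAt.tendsto).mono_left hnhds
  have hD : Tendsto (volterraDx α G) (𝓝[>] 0) (𝓝 (volterraDx α G 0)) :=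
    ((h.continuousOn_volterraDx 0 h0mem).continuousAt (isOpen_Ioo.mem_nhds h0mem)).tendsto.mono_left
      hnhds
  have hU : Tendsto (fun t => volterraInv G t (primitive (heatGrad lam b g t))) (𝓝[>] 0) (𝓝 U₀) := by
    have := tendsto_clm_apply hS hW
    rwa [hw₀, volterraInv_apply_apply] at this
  -- In L² the gradient p - DU tends to (g₀ + D₀) - D₀ = g₀, because w → w₀ uniformly and both
  -- operator families are norm continuous at t = 0.
  have hfin := hplim.sub ((toL2.continuous.tendsto _).comp (tendsto_clm_apply hD hU))
  rw [← hD₀, hg, add_sub_cancel_right] at hfin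
  simpa only [map_sub] using! hfin

end

end Existence

/-! ### The theorem -/

theorem theorem2p1 (lam : ℝ) (hlam : 0 < lam) (a : ℝ → ℝ → ℝ)
    (ha_cont : ∀ t ∈ Ico (0 : ℝ) 1, ContinuousOn (fun x => a x t) (Icc (0 : ℝ) 1))
    (ha_analytic : UniformlyAnalyticOn a (Icc (0 : ℝ) 1) (Ico (0 : ℝ) 1)) :
    -- the kernel exists and is unique
    (∃ k : ℝ → ℝ → ℝ → ℝ, IsBacksteppingKernel a lam k ∧
      ∀ k' : ℝ → ℝ → ℝ → ℝ, IsBacksteppingKernel a lam k' →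
        ∀ x y : ℝ, (x, y) ∈ triangle → ∀ t ∈ Ico (0 : ℝ) 1, k' x y t = k x y t) ∧
    ∀ k : ℝ → ℝ → ℝ → ℝ, IsBacksteppingKernel a lam k → ∀ b : Feedback,
      -- existence of a solution on `[0,1)`
      (∀ u₀ : ℝ → ℝ, MemH1 u₀ → Compatible k u₀ b → ∃ u : ℝ → ℝ → ℝ, IsSolution a k b u₀ 1 u) ∧
      -- uniqueness on every interval `[0,τ)`, `τ ≤ 1`
      (∀ τ ∈ Ioc (0 : ℝ) 1, ∀ u₀ : ℝ → ℝ, MemH1 u₀ → Compatible k u₀ b →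
        ∀ u v : ℝ → ℝ → ℝ, IsSolution a k b u₀ τ u → IsSolution a k b u₀ τ v →
          ∀ x ∈ Icc (0 : ℝ) 1, ∀ t ∈ Ico 0 τ, u x t = v x t) ∧
      -- exponential decay at the rate `lam`
      (∀ t₀ ∈ Ioo (0 : ℝ) 1, ∃ M : ℝ, 0 < M ∧
        ∀ u₀ : ℝ → ℝ, MemH1 u₀ → Compatible k u₀ b →
          ∀ u : ℝ → ℝ → ℝ, IsSolution a k b u₀ t₀ u → ∀ t ∈ Ioo 0 t₀,
            normH1 (fun x => u x t) ≤ M * normH1 u₀ * Real.exp (-lam * t)) := by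
  obtain ⟨ε, α, G, h⟩ := exists_isGoursatSolution (lam := lam) ha_cont ha_analytic
  refine ⟨⟨kernelOf α G, h.isBacksteppingKernel, fun k' hk' x y hp t ht =>
    h.kernel_unique hk' hp ht⟩, fun k hk b => ⟨fun u₀ hu₀ hc => ?_, ?_, ?_⟩⟩
  · exact h.exists_solution hlam.le hk hu₀ hc
  · exact fun τ hτ u₀ hu₀ _ u v hu hv x hx t ht => h.solution_unique hk hτ hu₀ hu hv hx ht
  · exact fun t₀ ht₀ => h.solution_decay hk b ht₀
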